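/- **Setting.** IRIs come from one sort: the same IRI may be used as a class, as an object property and as an individual. An OWL 2 QL ontology $\mathcal O$ (no data properties) is a finite set of axioms of the forms $B\sqsubseteq E$, $B_1\sqsubseteq\neg B_2$, $r\sqsubseteq S$, $r\sqsubseteq\neg S$, $\mathrm{refl}(r)$, $\mathrm{irref}(r)$, $c(x)$, $r(x,y)$, $x\neq y$, where $B,B_1,B_2$ are of the form $c$, $\exists r$ or $\exists r^-$, $E$ is of the form $c$, $\exists r.c$ or $\exists r^-.c$, and $S$ is $r'$ or $r'^-$; $\exists r$ abbreviates $\exists r.\mathtt{owl{:}Thing}$. *Metamodeling semantics.* An interpretation has a non-empty object domain $\Delta^o$, the value domain of the datatype map, a truth value on each object telling whether it is an individual, partial functions giving an object an extension as a class, object property, data property or datatype, and a map of all expressions to $\Delta^o$. Objects without any extension and objects that occur in extensions are individuals, $\mathtt{owl{:}Thing}$ denotes the class of all individuals, and $r^-$ and $\exists R.c$ have the usual extensions. An axiom is satisfied if its expressions have the kinds of extension required by their positions and the usual set-theoretic condition holds; reflexivity and irreflexivity range over individuals. Models, consistency and $\mathcal O\models\alpha$ are as usual; distinct IRIs may denote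 the same object. *Queries.* A conjunctive SPARQL query $\mathcal Q$ is $\mathrm{SELECT}\ x_1\ldots x_n\ \mathrm{WHERE}\ \{\alpha_1,\ldots,\alpha_m\}$, each $\alpha_j$ being an axiom in which variables may stand in place of any entity, and each $x_i$ occurring in some $\alpha_j$. Its answers under the Metamodeling Semantics Entailment Regime are $ANS(\mathcal Q,\mathcal O)=\{\langle\mu(x_1),\ldots,\mu(x_n)\rangle \mid \mu \text{ maps variables to IRIs and } \mathcal O\models\mu(\alpha_j)\text{ for all }j\}$. *Programs.* $\tau$ turns an axiom into an atom, with one predicate per axiom form ($\mathit{isacCC}(c_1,c_2)$ for $c_1\sqsubseteq c_2$, $\mathit{isacCR}(c_1,r_2,c_2)$ for $c_1\sqsubseteq\exists r_2.c_2$, $\mathit{instc}(c,x)$ for $c(x)$, $\mathit{instr}(r,x,y)$ for $r(x,y)$, and so on; $c\sqsubseteq\neg\exists r$ is treated as $\exists r\sqsubseteq\neg c$); $\tau(\mathcal O)$ is the resulting set of facts, and $\tau^q(\mathcal Q)$ is the rule $q(x_1,\ldots,x_n)\leftarrow\tau(\alpha_1),\ldots,\tau(\alpha_m)$ with a fresh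 predicate $q$. $\mathcal R^{ql}$ is a fixed finite Datalog program, independent of $\mathcal O$ and $\mathcal Q$, encoding saturation under OWL 2 QL inference. It consists of the rules for typing; for reflexivity, composition and $\mathtt{owl{:}Thing}$ in class and property inclusions; for propagation of disjointness, unsatisfiability, reflexivity and irreflexivity; for propagation of assertions; for contradictions; of a copy of these rules relativized to the assumption that two given individuals are equal, with replacement of equals by equals; and of the rule that two individuals are different if that assumption yields a contradiction. *Hybrid knowledge bases.* A hybrid knowledge base $\langle\mathcal O',\mathcal P\rangle$ consists of an ontology and a hex program, i.e. a set of positive rules whose bodies may contain the external atoms $\&g[c](x)$ and $\&g[r](x,y)$, true iff $\mathcal O'\models c(x)$, respectively $\mathcal O'\models r(x,y)$. Its answer sets are the interpretations (sets of regular atoms of the Herbrand base, whose constants are those of $\mathcal P$ and the IRIs of $\mathcal O'$) that are minimal models of their FLP-reduct. When the answer set is unique, $ANS(q,\mathcal K)$ is the set of tuples $t$ with $q(t)$ in it. For a set $N$ of IRIs, $\pi(N)$ is the set of the interface rules $\mathit{instc}(c,X)\leftarrow\&g[c](X)$ for the class identifiers $c\in N$ and $\mathit{instr}(r,X,Y)\leftarrow\&g[r](X,Y)$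 for the property identifiers $r\in N$. With $\mathbf S(\cdot)$ the signature of an ontology, put $$\mathcal K^{E\text{-}AT}_{All}(\mathcal O,\mathcal Q)=\langle\emptyset,\ \mathcal R^{ql}\cup\tau(\mathcal O)\cup\tau^q(\mathcal Q)\cup\pi(\mathbf S(\emptyset))\rangle .$$ **Proposition.** Let $\mathcal O$ be a consistent OWL 2 QL ontology and $\mathcal Q$ a conjunctive SPARQL query; let $\mathcal K=\mathcal K^{E\text{-}AT}_{All}(\mathcal O,\mathcal Q)$ and $P=\mathcal R^{ql}\cup\tau(\mathcal O)\cup\tau^q(\mathcal Q)$. Then $\mathcal K$ has exactly one answer set, and $$ANS(\mathcal Q,\mathcal O)=ANS(q,\mathcal K).$$ Moreover $\mathcal K=\langle\emptyset,P\rangle$, where $P$ contains no external atoms; adding interface rules for the signature of $\mathcal O$ (its class and property identifiers) does not change the answer sets, i.e. $\langle\emptyset,P\cup\pi(\mathbf S(\mathcal O))\rangle$ and $\langle\emptyset,P\rangle$ have the same answer sets; and the unique answer set of $\mathcal K$ is the least Herbrand model $MM(P)$. -/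

import Mathlib

universe u v

namespace OWLQL

/-! ### Syntax of OWL 2 QL (object part, no data properties) -/

/-- IRIs over a type of names. `owlThing` is the reserved class `owl:Thing`; it is the filler of an
unqualified existential: `∃ r` abbreviates `∃ r . owl:Thing`. There is a single sort of IRIs: any
IRI may be used as a class, as an object property and as an individual (metamodeling). -/
inductive IRI (Name : Type u) : Type u
  | owlThing : IRI Name
  | name : Name → IRI Name

/-- A property `r` or an inverse property `r⁻`. -/
inductive RoleExp (α : Type u) : Type u
  | dir : α → RoleExp α
  | inv : α → RoleExp α

/-- Left-hand sides of class inclusions: `c`, `∃ r`, `∃ r⁻`. -/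
inductive LeftExp (α : Type u) : Type u
  | cls : α → LeftExp α
  | ex : RoleExp α → LeftExp α

/-- Right-hand sides of positive class inclusions: `c`, `∃ r . c`, `∃ r⁻ . c`. -/
inductive RightExp (α : Type u) : Type u
  | cls : α → RightExp α
  | ex : RoleExp α → α → RightExp α

/-- Logical axioms, with entities drawn from `α`. With `α` the type of IRIs these are the axioms of
an ontology; with `α` the type of terms they are the atoms of a query. -/
inductive QLAx (α : Type u) : Type u
  /-- `B ⊑ E` -/
  | sub : LeftExp α → RightExp α → QLAx α
  /-- `B₁ ⊑ ¬ B₂` -/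
  | disj : LeftExp α → LeftExp α → QLAx α
  /-- `r ⊑ S` with `S` a property or an inverse property -/
  | subRole : α → RoleExp α → QLAx α
  /-- `r ⊑ ¬ S` with `S` a property or an inverse property -/
  | disjRole : α → RoleExp α → QLAx α
  | refl : α → QLAx α
  | irrefl : α → QLAx α
  /-- `c(x)` -/
  | classAssert : α → α → QLAx α
  /-- `r(x, y)` -/
  | roleAssert : α → α → α → QLAx α
  /-- `x ≠ y` -/
  | diff : α → α → QLAx α

section Operations

variable {α β : Type u}

def RoleExp.map (f : α → β) : RoleExp α → RoleExp β
  | .dir r => .dir (f r)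
  | .inv r => .inv (f r)

def RoleExp.role : RoleExp α → α
  | .dir r => r
  | .inv r => r

/-- `r ↦ r⁻`, `r⁻ ↦ r`. -/
def RoleExp.flip : RoleExp α → RoleExp α
  | .dir r => .inv r
  | .inv r => .dir r

/-- `S` composed with the orientation of `R`: if `R = r` and `r ⊑ S` then `R ⊑ S`, and if `R = r⁻`
and `r ⊑ S` then `R ⊑ S⁻`. -/
def RoleExp.orient (R S : RoleExp α) : RoleExp α :=
  match R with
  | .dir _ => S
  | .inv _ => S.flip

def LeftExp.map (f : α → β) : LeftExp α → LeftExp β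
  | .cls c => .cls (f c)
  | .ex R => .ex (R.map f)

def RightExp.map (f : α → β) : RightExp α → RightExp β
  | .cls c => .cls (f c)
  | .ex R c => .ex (R.map f) (f c)

def QLAx.map (f : α → β) : QLAx α → QLAx β
  | .sub B E => .sub (B.map f) (E.map f)
  | .disj B₁ B₂ => .disj (B₁.map f) (B₂.map f)
  | .subRole r S => .subRole (f r) (S.map f)
  | .disjRole r S => .disjRole (f r) (S.map f)
  | .refl r => .refl (f r)
  | .irrefl r => .irrefl (f r)
  | .classAssert c x => .classAssert (f c) (f x)
  | .roleAssert r x y => .roleAssert (f r) (f x) (f y)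
  | .diff x y => .diff (f x) (f y)

def LeftExp.classArgs : LeftExp α → List α
  | .cls c => [c]
  | .ex _ => []

def LeftExp.roleArgs : LeftExp α → List α
  | .cls _ => []
  | .ex R => [R.role]

def RightExp.classArgs : RightExp α → List α
  | .cls c => [c]
  | .ex _ c => [c]

def RightExp.roleArgs : RightExp α → List α
  | .cls _ => []
  | .ex R _ => [R.role]

/-- The entities in class position. -/
def QLAx.classArgs : QLAx α → List α
  | .sub B E => B.classArgs ++ E.classArgs
  | .disj B₁ B₂ => B₁.classArgs ++ B₂.classArgs
  | .classAssert c _ => [c]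
  | _ => []

/-- The entities in property position. -/
def QLAx.roleArgs : QLAx α → List α
  | .sub B E => B.roleArgs ++ E.roleArgs
  | .disj B₁ B₂ => B₁.roleArgs ++ B₂.roleArgs
  | .subRole r S => [r, S.role]
  | .disjRole r S => [r, S.role]
  | .refl r => [r]
  | .irrefl r => [r]
  | .roleAssert r _ _ => [r]
  | _ => []

/-- The entities in individual position. -/
def QLAx.indArgs : QLAx α → List α
  | .classAssert _ x => [x]
  | .roleAssert _ x y => [x, y]
  | .diff x y => [x, y]
  | _ => []

/-- All entities occurring in an axiom. -/
def QLAx.args (a : QLAx α) : List α := a.classArgs ++ a.roleArgs ++ a.indArgs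

end Operations

/-- An OWL 2 QL ontology is a finite set of axioms (TBox and ABox together). -/
abbrev Ontology (Name : Type u) : Type u := Finset (QLAx (IRI Name))

/-- The signature: all atomic classes, properties and individuals that occur in the ontology. -/
def Ontology.sig {Name : Type u} (O : Ontology Name) : Set (IRI Name) :=
  {e | ∃ a ∈ O, e ∈ a.args}

/-- The class identifiers of an ontology. -/
def Ontology.classes {Name : Type u} (O : Ontology Name) : Set (IRI Name) :=
  {e | ∃ a ∈ O, e ∈ a.classArgs}

/-- The property identifiers of an ontology. -/
def Ontology.roles {Name : Type u} (O : Ontology Name) : Set (IRI Name) :=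
  {e | ∃ a ∈ O, e ∈ a.roleArgs}

/-! ### The metamodeling semantics -/

/-- Well-formed expressions: atomic ones, inverse properties, and `∃ R . c`. -/
inductive Exp (Name : Type u) : Type u
  | iri : IRI Name → Exp Name
  | inv : IRI Name → Exp Name
  | some : RoleExp (IRI Name) → IRI Name → Exp Name

def RoleExp.toExp {Name : Type u} : RoleExp (IRI Name) → Exp Name
  | .dir r => .iri r
  | .inv r => .inv r

/-- `∃ R` is `∃ R . owl:Thing`. -/
def LeftExp.toExp {Name : Type u} : LeftExp (IRI Name) → Exp Name
  | .cls c => .iri c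
  | .ex R => .some R .owlThing

def RightExp.toExp {Name : Type u} : RightExp (IRI Name) → Exp Name
  | .cls c => .iri c
  | .ex R c => .some R c

/-- A datatype map: literals, a non-empty value domain, and the value of each literal. -/
structure DatatypeMap : Type (v + 1) where
  Literal : Type v
  Value : Type v
  nonempty : Nonempty Value
  value : Literal → Value

/-- An interpretation of the metamodeling semantics. The value domain and the values of the literals
are those of the datatype map; `Obj` is the object domain. The partial functions `extC`, `extP`,
`extD`, `extT` give the extension of an object as a class, an object property, a data property, a
datatype; `isInd` tells whether the object is an individual; `den` is the interpretation function on
expressions. -/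
structure Interp (Name : Type u) (D : DatatypeMap.{v}) : Type (max (u + 1) v) where
  Obj : Type u
  nonempty : Nonempty Obj
  isInd : Obj → Prop
  extC : Obj → Option (Set Obj)
  extP : Obj → Option (Set (Obj × Obj))
  extD : Obj → Option (Set (Obj × D.Value))
  extT : Obj → Option (Set D.Value)
  den : Exp Name → Obj
  /-- An object without any extension is an individual. -/
  ind_of_none : ∀ o, extC o = none → extP o = none → extD o = none → extT o = none → isInd o
  /-- The objects that occur in extensions are individuals. -/
  ind_of_extC : ∀ o A, extC o = some A → ∀ a ∈ A, isInd a
  ind_of_extP : ∀ o S, extP o = some S → ∀ p ∈ S, isInd p.1 ∧ isInd p.2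
  ind_of_extD : ∀ o S, extD o = some S → ∀ p ∈ S, isInd p.1
  /-- `owl:Thing` is the class of all individuals. -/
  den_thing : extC (den (.iri .owlThing)) = some {o | isInd o}
  /-- `r⁻` has a property extension exactly if `r` has one, namely the converse relation. -/
  den_inv : ∀ r, extP (den (.inv r)) = (extP (den (.iri r))).map fun S => {p | (p.2, p.1) ∈ S}
  /-- `∃ R . c` has a class extension exactly if `R` has a property extension and `c` a class
  extension. -/
  den_some : ∀ R c, extC (den (.some R c)) =
    (extP (den R.toExp)).bind fun S =>
      (extC (den (.iri c))).map fun A => {o | ∃ o', (o, o') ∈ S ∧ o' ∈ A}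

/-- Satisfaction of an axiom. Each expression must have the extension that its position calls for:
a class position requires `extC`, a property position `extP`, an individual position `isInd`. -/
def Interp.Sat {Name : Type u} {D : DatatypeMap.{v}} (I : Interp Name D) :
    QLAx (IRI Name) → Prop
  | .sub B E => ∃ A A', I.extC (I.den B.toExp) = some A ∧ I.extC (I.den E.toExp) = some A' ∧ A ⊆ A'
  | .disj B₁ B₂ => ∃ A A', I.extC (I.den B₁.toExp) = some A ∧ I.extC (I.den B₂.toExp) = some A' ∧
      Disjoint A A'
  | .subRole r S => ∃ A A', I.extP (I.den (.iri r)) = some A ∧ I.extP (I.den S.toExp) = some A' ∧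
      A ⊆ A'
  | .disjRole r S => ∃ A A', I.extP (I.den (.iri r)) = some A ∧ I.extP (I.den S.toExp) = some A' ∧
      Disjoint A A'
  | .refl r => ∃ A, I.extP (I.den (.iri r)) = some A ∧ ∀ o, I.isInd o → (o, o) ∈ A
  | .irrefl r => ∃ A, I.extP (I.den (.iri r)) = some A ∧ ∀ o, I.isInd o → (o, o) ∉ A
  | .classAssert c x => ∃ A, I.extC (I.den (.iri c)) = some A ∧ I.den (.iri x) ∈ A
  | .roleAssert r x y => ∃ A, I.extP (I.den (.iri r)) = some A ∧
      (I.den (.iri x), I.den (.iri y)) ∈ A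
  | .diff x y => I.isInd (I.den (.iri x)) ∧ I.isInd (I.den (.iri y)) ∧
      I.den (.iri x) ≠ I.den (.iri y)

def Interp.IsModel {Name : Type u} {D : DatatypeMap.{v}} (I : Interp Name D)
    (O : Ontology Name) : Prop :=
  ∀ a ∈ O, I.Sat a

/-- `O` has a model. -/
def Consistent {Name : Type u} (D : DatatypeMap.{v}) (O : Ontology Name) : Prop :=
  ∃ I : Interp Name D, I.IsModel O

/-- Logical implication `O ⊨ a`. -/
def Entails {Name : Type u} (D : DatatypeMap.{v}) (O : Ontology Name) (a : QLAx (IRI Name)) :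
    Prop :=
  ∀ I : Interp Name D, I.IsModel O → I.Sat a

/-! ### Conjunctive SPARQL queries and their answers under the entailment regime -/

/-- Variables (numbered) and constants. -/
inductive Term (Name : Type u) : Type u
  | var : ℕ → Term Name
  | iri : IRI Name → Term Name

def Term.eval {Name : Type u} (σ : ℕ → IRI Name) : Term Name → IRI Name
  | .var n => σ n
  | .iri e => e

/-- `SELECT x₁ … xₙ WHERE { a₁ . … . aₘ }`, the `aᵢ` being axioms with variables allowed in place of
any entity; every selected variable occurs in the pattern. -/
structure Query (Name : Type u) : Type u where
  select : List ℕ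
  body : List (QLAx (Term Name))
  safe : ∀ n ∈ select, ∃ a ∈ body, Term.var n ∈ a.args

/-- The answers to `Q` over `O` under the metamodeling semantics entailment regime: the projections
of the assignments `μ` of IRIs to variables for which `O` implies every axiom of `μ(body)`. -/
def Query.answers {Name : Type u} (D : DatatypeMap.{v}) (Q : Query Name) (O : Ontology Name) :
    Set (List (IRI Name)) :=
  {t | ∃ μ : ℕ → IRI Name, t = Q.select.map μ ∧ ∀ a ∈ Q.body, Entails D O (a.map (Term.eval μ))}

/-! ### Hex programs -/

/-- The predicates that encode axioms (`C`, `R`, `I` in a name stand for `c`, `∃ r`, `∃ r⁻` in a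
class inclusion, and `R`, `I` for `r`, `r⁻` in a property inclusion), and four auxiliary ones:
"is a class", "is a property", "is an individual", "there is a contradiction". -/
inductive BasePred : Type
  | isacCC | isacCR | isacCI | isacRC | isacRR | isacRI | isacIC | isacIR | isacII
  | isarRR | isarRI
  | disjcCC | disjcCI | disjcRC | disjcRR | disjcRI | disjcIC | disjcIR | disjcII
  | disjrRR | disjrRI
  | refl | irrefl
  | instc | instr | diff
  | cls | prop | ind | clash

/-- Predicates of programs. `assuming p` has two more arguments than `p`, in front, and means that
`p` holds of the others under the assumption that these two individuals are equal. `query` is the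
query predicate `q`. -/
inductive Pred : Type
  | base : BasePred → Pred
  | assuming : BasePred → Pred
  | query : Pred

/-- Regular atoms. -/
structure RegAtom (T : Type u) : Type u where
  pred : Pred
  args : List T

/-- A body atom is regular, or the external atom `&g[input](output)`. -/
inductive BodyAtom (T : Type u) : Type u
  | reg : RegAtom T → BodyAtom T
  | ext : (input output : List T) → BodyAtom T

/-- Hex rules `head ← body`. -/
structure Rule (T : Type u) : Type u where
  head : RegAtom T
  body : List (BodyAtom T)

/-- A program is a set of rules whose terms are variables and IRIs. -/
abbrev Program (Name : Type u) : Type u := Set (Rule (Term Name))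

def RegAtom.map {T T' : Type u} (f : T → T') (a : RegAtom T) : RegAtom T' := ⟨a.pred, a.args.map f⟩

def BodyAtom.map {T T' : Type u} (f : T → T') : BodyAtom T → BodyAtom T'
  | .reg a => .reg (a.map f)
  | .ext i o => .ext (i.map f) (o.map f)

def Rule.map {T T' : Type u} (f : T → T') (r : Rule T) : Rule T' :=
  ⟨r.head.map f, r.body.map (BodyAtom.map f)⟩

def BodyAtom.terms {T : Type u} : BodyAtom T → List T
  | .reg a => a.args
  | .ext i o => i ++ o

def Rule.terms {T : Type u} (r : Rule T) : List T := r.head.args ++ r.body.flatMap BodyAtom.terms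

/-- No external atoms. -/
def Rule.Ordinary {T : Type u} (r : Rule T) : Prop := ∀ b ∈ r.body, ∃ a, b = .reg a

/-- The constants of a program. -/
def Program.constants {Name : Type u} (P : Program Name) : Set (IRI Name) :=
  {e | ∃ r ∈ P, Term.iri e ∈ r.terms}

/-- The grounding over a set `U` of constants. -/
def Program.ground {Name : Type u} (P : Program Name) (U : Set (IRI Name)) :
    Set (Rule (IRI Name)) :=
  {g | ∃ r ∈ P, ∃ σ : ℕ → IRI Name, (∀ n, Term.var n ∈ r.terms → σ n ∈ U) ∧
    g = r.map (Term.eval σ)}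

/-- The regular part of the Herbrand base over a set `U` of constants. -/
def Program.herbrandBase {Name : Type u} (P : Program Name) (U : Set (IRI Name)) :
    Set (RegAtom (IRI Name)) :=
  {g | ∃ r ∈ P, ∃ a : RegAtom (Term Name), (a = r.head ∨ BodyAtom.reg a ∈ r.body) ∧
    ∃ σ : ℕ → IRI Name, (∀ n, Term.var n ∈ a.args → σ n ∈ U) ∧ g = a.map (Term.eval σ)}

/-- Oracle functions of the external atom. -/
abbrev Oracle (Name : Type u) : Type u :=
  Set (RegAtom (IRI Name)) → List (IRI Name) → List (IRI Name) → Prop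

/-- Truth of a ground body atom in `J`. -/
def HoldsAtom {Name : Type u} (f : Oracle Name) (J : Set (RegAtom (IRI Name))) :
    BodyAtom (IRI Name) → Prop
  | .reg a => a ∈ J
  | .ext i o => f J i o

/-- `J` satisfies the body of a ground rule. -/
def HoldsBody {Name : Type u} (f : Oracle Name) (J : Set (RegAtom (IRI Name)))
    (g : Rule (IRI Name)) : Prop :=
  ∀ b ∈ g.body, HoldsAtom f J b

/-- `J` satisfies every rule of a set of ground rules. -/
def SatGround {Name : Type u} (f : Oracle Name) (J : Set (RegAtom (IRI Name)))
    (G : Set (Rule (IRI Name))) : Prop :=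
  ∀ g ∈ G, HoldsBody f J g → g.head ∈ J

/-- The FLP-reduct: the ground rules whose body is true. -/
def flpReduct {Name : Type u} (f : Oracle Name) (G : Set (Rule (IRI Name)))
    (J : Set (RegAtom (IRI Name))) : Set (Rule (IRI Name)) :=
  {g | g ∈ G ∧ HoldsBody f J g}

/-- The least Herbrand model `MM(P)` of a Datalog program, the intersection of its models. -/
def Program.minimalModel {Name : Type u} (P : Program Name) : Set (RegAtom (IRI Name)) :=
  ⋂₀ {J | SatGround (fun _ _ _ => False) J (P.ground P.constants)}

/-! ### Hybrid knowledge bases -/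

/-- A hybrid knowledge base: an ontology and a hex program. -/
structure HKB (Name : Type u) : Type u where
  ontology : Ontology Name
  program : Program Name

/-- The external atom imports the extensions of classes and properties from the ontology:
`&g[c](x)` is true iff `O ⊨ c(x)`, and `&g[r](x, y)` is true iff `O ⊨ r(x, y)`. -/
def ontologyOracle {Name : Type u} (D : DatatypeMap.{v}) (O : Ontology Name) : Oracle Name
  | _, [c], [x] => Entails D O (.classAssert c x)
  | _, [r], [x, y] => Entails D O (.roleAssert r x y)
  | _, _, _ => False

/-- The constants used for grounding: those of the program and the IRIs of the ontology. -/
def HKB.constants {Name : Type u} (K : HKB Name) : Set (IRI Name) :=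
  K.program.constants ∪ K.ontology.sig

/-- The answer sets: interpretations (subsets of the Herbrand base) that are minimal models of their
FLP-reduct. -/
def HKB.answerSets {Name : Type u} (D : DatatypeMap.{v}) (K : HKB Name) :
    Set (Set (RegAtom (IRI Name))) :=
  {I | I ⊆ K.program.herbrandBase K.constants ∧
    Minimal (fun J => SatGround (ontologyOracle D K.ontology) J
      (flpReduct (ontologyOracle D K.ontology) (K.program.ground K.constants) I)) I}

/-- The answers of the query predicate `q` in the unique answer set. -/
def HKB.answers {Name : Type u} (D : DatatypeMap.{v}) (K : HKB Name) : Set (List (IRI Name)) :=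
  {t | ∃ I, K.answerSets D = {I} ∧ (⟨.query, t⟩ : RegAtom (IRI Name)) ∈ I}

/-! ### The translations of ontologies and queries -/

section Translation

open BasePred

variable {T : Type u}

/-- The translation of an axiom: its predicate and its arguments. There is no predicate for
`c ⊑ ¬ ∃ r`, which is written as the equivalent `∃ r ⊑ ¬ c`. -/
def QLAx.encode : QLAx T → BasePred × List T
  | .sub (.cls c₁) (.cls c₂) => (isacCC, [c₁, c₂])
  | .sub (.cls c₁) (.ex (.dir r₂) c₂) => (isacCR, [c₁, r₂, c₂])
  | .sub (.cls c₁) (.ex (.inv r₂) c₂) => (isacCI, [c₁, r₂, c₂])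
  | .sub (.ex (.dir r₁)) (.cls c₂) => (isacRC, [r₁, c₂])
  | .sub (.ex (.dir r₁)) (.ex (.dir r₂) c₂) => (isacRR, [r₁, r₂, c₂])
  | .sub (.ex (.dir r₁)) (.ex (.inv r₂) c₂) => (isacRI, [r₁, r₂, c₂])
  | .sub (.ex (.inv r₁)) (.cls c₂) => (isacIC, [r₁, c₂])
  | .sub (.ex (.inv r₁)) (.ex (.dir r₂) c₂) => (isacIR, [r₁, r₂, c₂])
  | .sub (.ex (.inv r₁)) (.ex (.inv r₂) c₂) => (isacII, [r₁, r₂, c₂])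
  | .disj (.cls c₁) (.cls c₂) => (disjcCC, [c₁, c₂])
  | .disj (.cls c₁) (.ex (.dir r₂)) => (disjcRC, [r₂, c₁])
  | .disj (.cls c₁) (.ex (.inv r₂)) => (disjcCI, [c₁, r₂])
  | .disj (.ex (.dir r₁)) (.cls c₂) => (disjcRC, [r₁, c₂])
  | .disj (.ex (.dir r₁)) (.ex (.dir r₂)) => (disjcRR, [r₁, r₂])
  | .disj (.ex (.dir r₁)) (.ex (.inv r₂)) => (disjcRI, [r₁, r₂])
  | .disj (.ex (.inv r₁)) (.cls c₂) => (disjcIC, [r₁, c₂])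
  | .disj (.ex (.inv r₁)) (.ex (.dir r₂)) => (disjcIR, [r₁, r₂])
  | .disj (.ex (.inv r₁)) (.ex (.inv r₂)) => (disjcII, [r₁, r₂])
  | .subRole r₁ (.dir r₂) => (isarRR, [r₁, r₂])
  | .subRole r₁ (.inv r₂) => (isarRI, [r₁, r₂])
  | .disjRole r₁ (.dir r₂) => (disjrRR, [r₁, r₂])
  | .disjRole r₁ (.inv r₂) => (disjrRI, [r₁, r₂])
  | .refl r => (BasePred.refl, [r])
  | .irrefl r => (BasePred.irrefl, [r])
  | .classAssert c x => (instc, [c, x])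
  | .roleAssert r x y => (instr, [r, x, y])
  | .diff x y => (BasePred.diff, [x, y])

/-- `τ` on one axiom. -/
def QLAx.tau (a : QLAx T) : RegAtom T := ⟨.base a.encode.1, a.encode.2⟩

end Translation

/-- `τ(O)`: one fact for each axiom. -/
def Ontology.tau {Name : Type u} (O : Ontology Name) : Program Name :=
  {ρ | ∃ a ∈ O, ρ = ⟨(a.map Term.iri).tau, []⟩}

/-- `τ^q(Q)`: the rule `q(x₁, …, xₙ) ← τ(a₁), …, τ(aₘ)`. -/
def Query.tau {Name : Type u} (Q : Query Name) : Program Name :=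
  {⟨⟨.query, Q.select.map Term.var⟩, Q.body.map fun a => .reg a.tau⟩}

/-! ### The fixed rule base

The rules are written as inference rules between axioms with variables; `encode` turns them into
Datalog rules. -/

/-- The statements derived by the rule base: axioms and the four auxiliary predicates. -/
inductive Stmt (T : Type u) : Type u
  | ax : QLAx T → Stmt T
  | cls : T → Stmt T
  | prop : T → Stmt T
  | ind : T → Stmt T
  | clash : Stmt T

def Stmt.map {T T' : Type u} (f : T → T') : Stmt T → Stmt T'
  | .ax a => .ax (a.map f)
  | .cls c => .cls (f c)
  | .prop r => .prop (f r)
  | .ind x => .ind (f x)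
  | .clash => .clash

def Stmt.args {T : Type u} : Stmt T → List T
  | .ax a => a.args
  | .cls c => [c]
  | .prop r => [r]
  | .ind x => [x]
  | .clash => []

def Stmt.encode {T : Type u} : Stmt T → BasePred × List T
  | .ax a => a.encode
  | .cls c => (.cls, [c])
  | .prop r => (.prop, [r])
  | .ind x => (.ind, [x])
  | .clash => (.clash, [])

/-- The atom of a statement. -/
def Stmt.atom {T : Type u} (s : Stmt T) : RegAtom T := ⟨.base s.encode.1, s.encode.2⟩

/-- The atom of a statement under the assumption that `a` and `b` are equal. -/
def Stmt.atomAssuming {T : Type u} (a b : T) (s : Stmt T) : RegAtom T :=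
  ⟨.assuming s.encode.1, a :: b :: s.encode.2⟩

/-- Inference rules: a conclusion and its premises. -/
structure Inference (T : Type u) : Type u where
  concl : Stmt T
  prems : List (Stmt T)

section RuleBase

variable {T : Type u}

/-- `[r, r⁻]` -/
def roleForms (r : T) : List (RoleExp T) := [.dir r, .inv r]

/-- `[b, ∃ b, ∃ b⁻]` -/
def leftForms (b : T) : List (LeftExp T) := [.cls b, .ex (.dir b), .ex (.inv b)]

/-- `[c, ∃ s . c, ∃ s⁻ . c]` -/
def rightForms (s c : T) : List (RightExp T) := [.cls c, .ex (.dir s) c, .ex (.inv s) c]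

/-- The statements that make the entities of a left-hand side a class or a property. -/
def LeftExp.typing (B : LeftExp T) : List (Stmt T) :=
  B.classArgs.map .cls ++ B.roleArgs.map .prop

def RightExp.typing (E : RightExp T) : List (Stmt T) :=
  E.classArgs.map .cls ++ E.roleArgs.map .prop

/-- All forms of axioms. -/
def axiomForms (a b c x y : T) : List (QLAx T) :=
  ((leftForms a).flatMap fun B => (rightForms b c).map fun E => .sub B E) ++
  ((leftForms a).flatMap fun B => (leftForms b).map fun B' => .disj B B') ++
  ((roleForms b).map fun S => .subRole a S) ++
  ((roleForms b).map fun S => .disjRole a S) ++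
  [.refl a, .irrefl a, .classAssert a x, .roleAssert a x y, .diff x y]

/-- All forms of statements. -/
def stmtForms (a b c x y : T) : List (Stmt T) :=
  (axiomForms a b c x y).map .ax ++ [.cls a, .prop a, .ind a, .clash]

/-- Which entities are classes, properties, individuals. -/
def typingRules (thing a b c x y : T) : List (Inference T) :=
  [⟨.cls thing, []⟩] ++
  (axiomForms a b c x y).flatMap fun α =>
    (α.classArgs.map fun e => ⟨.cls e, [.ax α]⟩) ++
    (α.roleArgs.map fun e => ⟨.prop e, [.ax α]⟩) ++
    (α.indArgs.map fun e => ⟨.ind e, [.ax α]⟩)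

/-- Class inclusions. -/
def classInclusionRules (thing b c d r s : T) : List (Inference T) :=
  [⟨.ax (.sub (.cls c) (.cls c)), [.cls c]⟩] ++
  ((roleForms r).map fun R => ⟨.ax (.sub (.ex R) (.ex R thing)), [.prop r]⟩) ++
  (leftForms b).flatMap fun B =>
    [⟨.ax (.sub B (.cls thing)), B.typing⟩] ++
    ((rightForms s d).map fun E =>
      ⟨.ax (.sub B E), [.ax (.sub B (.cls c)), .ax (.sub (.cls c) E)]⟩) ++
    ((rightForms s d).map fun E =>
      ⟨.ax (.sub B E), .ax (.disj B B) :: E.typing⟩) ++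
    (roleForms r).flatMap fun R =>
      ((rightForms s d).map fun E =>
        ⟨.ax (.sub B E), [.ax (.sub B (.ex R c)), .ax (.sub (.ex R) E)]⟩) ++
      [⟨.ax (.sub B (.ex R d)), [.ax (.sub B (.ex R c)), .ax (.sub (.cls c) (.cls d))]⟩,
       ⟨.ax (.sub B (.ex R d)), [.ax (.sub B (.ex R c)), .ax (.sub (.ex R.flip) (.cls d))]⟩,
       ⟨.ax (.sub B (.ex R c)), [.ax (.refl r), .ax (.sub B (.cls c))]⟩] ++
      ((roleForms s).map fun S =>
        ⟨.ax (.sub B (.ex (R.orient S) c)), [.ax (.sub B (.ex R c)), .ax (.subRole r S)]⟩)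

/-- Class disjointness. -/
def classDisjointnessRules (b b' c r : T) : List (Inference T) :=
  ((roleForms r).map fun R =>
    ⟨.ax (.disj (.ex R) (.ex R)), [.ax (.disjRole r (.dir r))]⟩) ++
  (leftForms b).flatMap fun B =>
    ((roleForms r).map fun R =>
      ⟨.ax (.disj B B), [.ax (.sub B (.ex R c)), .ax (.disj (.ex R.flip) (.cls c))]⟩) ++
    (leftForms b').flatMap fun B' =>
      [⟨.ax (.disj B' B), [.ax (.disj B B')]⟩,
       ⟨.ax (.disj B B'), .ax (.disj B B) :: B'.typing⟩,
       ⟨.ax (.disj B B'), [.ax (.sub B (.cls c)), .ax (.disj (.cls c) B')]⟩] ++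
      (roleForms r).map fun R =>
        ⟨.ax (.disj B B'), [.ax (.sub B (.ex R c)), .ax (.disj (.ex R) B')]⟩

/-- Property inclusions and disjointness, reflexivity and irreflexivity. -/
def propertyRules (thing r s t : T) : List (Inference T) :=
  [⟨.ax (.subRole r (.dir r)), [.prop r]⟩,
   ⟨.ax (.irrefl r), [.ax (.disjRole r (.dir r))]⟩,
   ⟨.ax (.irrefl r), [.ax (.disjRole r (.inv r))]⟩,
   ⟨.ax (.disj (.cls thing) (.cls thing)), [.ax (.refl r), .ax (.irrefl r)]⟩,
   ⟨.ax (.refl r), [.ax (.disj (.cls thing) (.cls thing)), .prop r]⟩,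
   ⟨.ax (.disjRole r (.dir s)), [.ax (.disjRole s (.dir r))]⟩,
   ⟨.ax (.disjRole r (.inv s)), [.ax (.disjRole s (.inv r))]⟩] ++
  (roleForms s).flatMap fun S =>
    [⟨.ax (.disjRole r S), [.ax (.disj (.ex (.dir r)) (.ex S))]⟩,
     ⟨.ax (.disjRole r S), [.ax (.disj (.ex (.inv r)) (.ex S.flip))]⟩,
     ⟨.ax (.subRole r S), [.ax (.disjRole r (.dir r)), .prop s]⟩,
     ⟨.ax (.disjRole r S), [.ax (.disjRole r (.dir r)), .prop s]⟩,
     ⟨.ax (.refl s), [.ax (.refl r), .ax (.subRole r S)]⟩,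
     ⟨.ax (.irrefl r), [.ax (.subRole r S), .ax (.irrefl s)]⟩,
     ⟨.ax (.irrefl r), [.ax (.refl s), .ax (.disjRole r S)]⟩] ++
    (roleForms t).flatMap fun U =>
      [⟨.ax (.subRole r (S.orient U)), [.ax (.subRole r S), .ax (.subRole s U)]⟩,
       ⟨.ax (.disjRole r (S.orient U)), [.ax (.subRole r S), .ax (.disjRole s U)]⟩]

/-- Assertions. -/
def assertionRules (thing c d r s x y : T) : List (Inference T) :=
  [⟨.ax (.classAssert thing x), [.ind x]⟩,
   ⟨.ax (.roleAssert r x x), [.ax (.refl r), .ind x]⟩,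
   ⟨.ax (.classAssert d x), [.ax (.classAssert c x), .ax (.sub (.cls c) (.cls d))]⟩,
   ⟨.ax (.classAssert d x), [.ax (.roleAssert r x y), .ax (.sub (.ex (.dir r)) (.cls d))]⟩,
   ⟨.ax (.classAssert d y), [.ax (.roleAssert r x y), .ax (.sub (.ex (.inv r)) (.cls d))]⟩,
   ⟨.ax (.roleAssert s x y), [.ax (.roleAssert r x y), .ax (.subRole r (.dir s))]⟩,
   ⟨.ax (.roleAssert s y x), [.ax (.roleAssert r x y), .ax (.subRole r (.inv s))]⟩,
   ⟨.ax (.diff y x), [.ax (.diff x y)]⟩]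

/-- Contradictions. -/
def clashRules (c d r s x y z : T) : List (Inference T) :=
  [⟨.clash, [.ax (.diff x x)]⟩,
   ⟨.clash, [.ax (.irrefl r), .ax (.roleAssert r x x)]⟩,
   ⟨.clash, [.ax (.classAssert c x), .ax (.classAssert d x), .ax (.disj (.cls c) (.cls d))]⟩,
   ⟨.clash, [.ax (.classAssert c x), .ax (.roleAssert r x y),
      .ax (.disj (.ex (.dir r)) (.cls c))]⟩,
   ⟨.clash, [.ax (.classAssert c x), .ax (.roleAssert r y x),
      .ax (.disj (.ex (.inv r)) (.cls c))]⟩,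
   ⟨.clash, [.ax (.roleAssert r x y), .ax (.roleAssert s x z),
      .ax (.disj (.ex (.dir r)) (.ex (.dir s)))]⟩,
   ⟨.clash, [.ax (.roleAssert r x y), .ax (.roleAssert s z x),
      .ax (.disj (.ex (.dir r)) (.ex (.inv s)))]⟩,
   ⟨.clash, [.ax (.roleAssert r y x), .ax (.roleAssert s z x),
      .ax (.disj (.ex (.inv r)) (.ex (.inv s)))]⟩,
   ⟨.clash, [.ax (.roleAssert r x y), .ax (.roleAssert s x y), .ax (.disjRole r (.dir s))]⟩,
   ⟨.clash, [.ax (.roleAssert r x y), .ax (.roleAssert s y x), .ax (.disjRole r (.inv s))]⟩]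

end RuleBase

/-- The saturation rules for the axioms of OWL 2 QL. -/
def saturationRules (Name : Type u) : List (Inference (Term Name)) :=
  typingRules (.iri .owlThing) (.var 0) (.var 1) (.var 2) (.var 3) (.var 4) ++
  classInclusionRules (.iri .owlThing) (.var 0) (.var 1) (.var 2) (.var 3) (.var 4) ++
  classDisjointnessRules (.var 0) (.var 1) (.var 2) (.var 3) ++
  propertyRules (.iri .owlThing) (.var 0) (.var 1) (.var 2) ++
  assertionRules (.iri .owlThing) (.var 0) (.var 1) (.var 2) (.var 3) (.var 4) (.var 5) ++
  clashRules (.var 0) (.var 1) (.var 2) (.var 3) (.var 4) (.var 5) (.var 6)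

/-- Substitution of one variable by another. -/
def Term.subst {Name : Type u} (n m : ℕ) : Term Name → Term Name
  | .var k => if k = n then .var m else .var k
  | .iri e => .iri e

/-- Replacement of equals by equals under the assumption that the variables 10 and 11 are equal:
one occurrence at a time, in any statement and in both directions. -/
def congruenceRules (Name : Type u) : List (Inference (Term Name)) :=
  (stmtForms (.var 0) (.var 1) (.var 2) (.var 3) (.var 4)).flatMap fun s =>
    (List.range 5).flatMap fun n =>
      [⟨s.map (Term.subst n 11), [s.map (Term.subst n 10)]⟩,
       ⟨s.map (Term.subst n 10), [s.map (Term.subst n 11)]⟩]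

/-- An inference rule as a Datalog rule. -/
def Inference.toRule {Name : Type u} (ρ : Inference (Term Name)) : Rule (Term Name) :=
  ⟨ρ.concl.atom, ρ.prems.map fun s => .reg s.atom⟩

/-- The variables 10 and 11 stand for individuals. -/
def assumptionGuard (Name : Type u) : List (BodyAtom (Term Name)) :=
  [.reg (Stmt.ind (.var 10)).atom, .reg (Stmt.ind (.var 11)).atom]

/-- An inference rule under the assumption that the individuals 10 and 11 are equal. -/
def Inference.toRuleAssuming {Name : Type u} (ρ : Inference (Term Name)) : Rule (Term Name) :=
  ⟨ρ.concl.atomAssuming (.var 10) (.var 11),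
    assumptionGuard Name ++ ρ.prems.map fun s => .reg (s.atomAssuming (.var 10) (.var 11))⟩

/-- The rule base `R^ql`, a finite list of Datalog rules: the saturation rules; the same rules under
the assumption that two individuals are equal, together with the rules that import what holds
anyway and replace equals by equals; and the rule that two individuals are different if assuming
them equal leads to a contradiction. -/
def rqlRules (Name : Type u) : List (Rule (Term Name)) :=
  (saturationRules Name).map Inference.toRule ++
  ((saturationRules Name).map Inference.toRuleAssuming ++
  ((stmtForms (.var 0) (.var 1) (.var 2) (.var 3) (.var 4)).map fun s =>
    ⟨s.atomAssuming (.var 10) (.var 11), assumptionGuard Name ++ [.reg s.atom]⟩) ++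
  (congruenceRules Name).map Inference.toRuleAssuming) ++
  [⟨(Stmt.ax (.diff (.var 10) (.var 11))).atom,
    [.reg (Stmt.clash.atomAssuming (.var 10) (.var 11))]⟩]

/-- `R^ql` as a program. -/
def rql (Name : Type u) : Program Name := {ρ | ρ ∈ rqlRules Name}

/-! ### Interface rules and the hybrid knowledge base -/

/-- The interface rules `π(S)` for a set `S` of IRIs: `instc(c, X) ← &g[c](X)` for each class
identifier `c` of the ontology in `S`, and `instr(r, X, Y) ← &g[r](X, Y)` for each property
identifier. -/
def interfaceRules {Name : Type u} (O : Ontology Name) (S : Set (IRI Name)) : Program Name :=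
  {ρ | ∃ c ∈ S, c ∈ O.classes ∧
    ρ = ⟨⟨.base .instc, [.iri c, .var 0]⟩, [.ext [.iri c] [.var 0]]⟩} ∪
  {ρ | ∃ r ∈ S, r ∈ O.roles ∧
    ρ = ⟨⟨.base .instr, [.iri r, .var 0, .var 1]⟩, [.ext [.iri r] [.var 0, .var 1]]⟩}

/-- The ontology function `E-AT`: the ontology part is empty and all of `O` is translated. -/
def hkbEAT {Name : Type u} (O : Ontology Name) : HKB Name := ⟨∅, rql Name ∪ O.tau⟩

/-- The query function `All`: add the query rule and the interface rules for the whole signature of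
the ontology part. -/
def hkbAll {Name : Type u} (K : HKB Name) (Q : Query Name) : HKB Name :=
  ⟨K.ontology, K.program ∪ Q.tau ∪ interfaceRules K.ontology K.ontology.sig⟩

end OWLQL

namespace OWLQL

variable {T Name : Type u} {D : DatatypeMap.{v}}

/-! ### Datalog programs and their answer sets -/

/-! The program has neither negation nor external atoms, so its ground rules have a least model, and
the minimal models of FLP-reducts reduce to that one set (`minimal_flpReduct_iff`). External atoms
over the empty ontology are false, since `Interp.void` is a model of it in which no class or
property has members; hence interface rules never fire. What remains is that, for a consistent
ontology, an axiom is derived exactly if it is entailed; the query rule then transfers this to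
answers.

Soundness is minimality of the least model: the semantically true atoms `soundAtoms`, where a
relativized atom counts as true if its two names denote individuals and its statement holds in every
model that identifies them, form a model of the program (`satGround_soundAtoms`). Since the ontology
has a model, no contradiction is derived.

Completeness rests on a canonical model. The derived statements are closed under the saturation
rules (`derived_saturated`). Out of any closed set without a contradiction, `canon` builds a
structure on the names and on generic witnesses: a common element of two left-hand sides, a common
edge of two roles, a loop of a property. An element lies in a class expression if a derived
inclusion leads there from one of its generators, and existential demands are met by witnesses one
level up. Saturation keeps generators and edge labels from violating derived disjointness
(`not_disj_of_gen`, `Label.not_disjRole`), so every derived axiom is true (`canon_sat`). The generic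
witnesses have no more properties than forced, so whatever is true of them is derived
(`mem_of_canon_sat`). A single model thus refutes all axioms that are not derived, except
inequalities.

Inequalities need other models, because distinct names denote distinct objects in `canon`. If `a ≠
b` is not derived, then no contradiction is derived under the assumption that `a` and `b` are equal.
The statements derived under that assumption are again closed under saturation, and replacing `b` by
`a` does not affect their derivability (`derivedAssuming_map_iff`). Their canonical model, with `b`
denoting what `a` denotes, is a model of the ontology and refutes `a ≠ b`.

Metamodeling costs little: a name is one object carrying both a class and a property extension, and
compound expressions denote extra objects that are not individuals (`exists_interp`). -/

theorem holdsBody_mono {f : Oracle Name} {J J' : Set (RegAtom (IRI Name))} (h : J ⊆ J')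
    {g : Rule (IRI Name)} (hg : g.Ordinary) (hJ : HoldsBody f J g) : HoldsBody f J' g := by
  intro b hb
  obtain ⟨a, rfl⟩ := hg b hb
  exact h (hJ _ hb)

theorem holdsBody_congr (f f' : Oracle Name) {J : Set (RegAtom (IRI Name))}
    {g : Rule (IRI Name)} (hg : g.Ordinary) (hJ : HoldsBody f J g) : HoldsBody f' J g := by
  intro b hb
  obtain ⟨a, rfl⟩ := hg b hb
  exact hJ _ hb

theorem Rule.Ordinary.map {T T' : Type u} {r : Rule T} (h : r.Ordinary) (f : T → T') :
    (r.map f).Ordinary := by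
  intro b hb
  obtain ⟨b', hb', rfl⟩ := List.mem_map.1 hb
  obtain ⟨a, rfl⟩ := h b' hb'
  exact ⟨_, rfl⟩

theorem Program.ground_ordinary {P : Program Name} (hP : ∀ ρ ∈ P, ρ.Ordinary)
    {U : Set (IRI Name)} {g : Rule (IRI Name)} (hg : g ∈ P.ground U) : g.Ordinary := by
  obtain ⟨r, hr, σ, -, rfl⟩ := hg
  exact (hP r hr).map _

theorem Program.satGround_herbrandBase (P : Program Name) (U : Set (IRI Name)) (f : Oracle Name) :
    SatGround f (P.herbrandBase U) (P.ground U) := by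
  rintro g ⟨r, hr, σ, hσ, rfl⟩ -
  exact ⟨r, hr, r.head, Or.inl rfl, σ, fun n hn => hσ n (List.mem_append_left _ hn), rfl⟩

theorem Program.minimalModel_subset {P : Program Name} {J : Set (RegAtom (IRI Name))}
    (hJ : SatGround (fun _ _ _ => False) J (P.ground P.constants)) : P.minimalModel ⊆ J :=
  Set.sInter_subset_of_mem hJ

theorem Program.satGround_minimalModel {P : Program Name} (hP : ∀ ρ ∈ P, ρ.Ordinary)
    (f : Oracle Name) : SatGround f P.minimalModel (P.ground P.constants) := by
  intro g hg hb
  refine Set.mem_sInter.2 fun J hJ => hJ g hg ?_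
  have ho := ground_ordinary hP hg
  exact holdsBody_congr f _ ho (holdsBody_mono (minimalModel_subset hJ) ho hb)

theorem satGround_of_flpReduct {f : Oracle Name} {J : Set (RegAtom (IRI Name))}
    {G : Set (Rule (IRI Name))} (h : SatGround f J (flpReduct f G J)) : SatGround f J G :=
  fun g hg hb => h g ⟨hg, hb⟩ hb

theorem SatGround.congr {f f' : Oracle Name} {J : Set (RegAtom (IRI Name))}
    {G : Set (Rule (IRI Name))} (hG : ∀ g ∈ G, g.Ordinary) (h : SatGround f J G) :
    SatGround f' J G :=
  fun g hg hb => h g hg (holdsBody_congr _ _ (hG g hg) hb)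

/-- A model of its own reduct is a model of the whole ground program, so it contains the least
model, which also satisfies the reduct. Conversely, a subset of the least model that satisfies the
reduct satisfies all ground rules, because a positive body true in the subset is true in the least
model, so its rule survives in the reduct. -/
theorem minimal_flpReduct_iff {P : Program Name} (hP : ∀ ρ ∈ P, ρ.Ordinary) (f : Oracle Name)
    (I : Set (RegAtom (IRI Name))) :
    Minimal (fun J => SatGround f J (flpReduct f (P.ground P.constants) I)) I ↔
      I = P.minimalModel := by
  constructor
  · rintro ⟨hI, hmin⟩
    have h1 : P.minimalModel ⊆ I :=
      Program.minimalModel_subset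
        ((satGround_of_flpReduct hI).congr fun g hg => Program.ground_ordinary hP hg)
    refine Set.Subset.antisymm (hmin ?_ h1) h1
    exact fun g hg hb => Program.satGround_minimalModel hP f g hg.1 hb
  · rintro rfl
    refine ⟨fun g hg hb => Program.satGround_minimalModel hP f g hg.1 hb, fun J hJ hle => ?_⟩
    refine Program.minimalModel_subset fun g hg hb => ?_
    have ho := Program.ground_ordinary hP hg
    have hb' : HoldsBody f J g := holdsBody_congr _ f ho hb
    exact hJ g ⟨hg, holdsBody_mono hle ho hb'⟩ hb'

theorem Program.minimalModel_subset_herbrandBase (P : Program Name) :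
    P.minimalModel ⊆ P.herbrandBase P.constants :=
  minimalModel_subset (P.satGround_herbrandBase _ _)

theorem HKB.constants_of_empty (P : Program Name) : (HKB.mk ∅ P).constants = P.constants := by
  simp [HKB.constants, Ontology.sig]

theorem HKB.answerSets_of_ordinary (D : DatatypeMap.{v}) {P : Program Name}
    (hP : ∀ ρ ∈ P, ρ.Ordinary) : (HKB.mk ∅ P).answerSets D = {P.minimalModel} := by
  ext I
  simp only [HKB.answerSets, HKB.constants_of_empty, Set.mem_ofPred_eq, Set.mem_singleton_iff]
  rw [minimal_flpReduct_iff hP]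
  constructor
  · exact fun h => h.2
  · rintro rfl
    exact ⟨P.minimalModel_subset_herbrandBase, rfl⟩

/-- Supplies the side condition of grounding: values read off a derived atom may be used to
instantiate further rules. -/
theorem Program.args_mem_constants {P : Program Name} {g : RegAtom (IRI Name)}
    (hg : g ∈ P.minimalModel) {e : IRI Name} (he : e ∈ g.args) : e ∈ P.constants := by
  obtain ⟨r, hr, a, ha, σ, hσ, rfl⟩ := P.minimalModel_subset_herbrandBase hg
  obtain ⟨t, ht, rfl⟩ := List.mem_map.1 he
  cases t with
  | var n => exact hσ n ht
  | iri e =>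
    refine ⟨r, hr, ?_⟩
    rcases ha with rfl | ha
    · exact List.mem_append_left _ ht
    · exact List.mem_append_right _ (List.mem_flatMap.2 ⟨_, ha, ht⟩)

/-! ### Interface rules over the empty ontology -/

/-- The interpretation with a single object, which is not an individual and has every extension
empty. -/
def Interp.void (Name : Type u) (D : DatatypeMap.{v}) : Interp Name D where
  Obj := PUnit
  nonempty := ⟨⟨⟩⟩
  isInd _ := False
  extC _ := some ∅
  extP _ := some ∅
  extD _ := some ∅
  extT _ := some ∅
  den _ := ⟨⟩
  ind_of_none := by simp
  ind_of_extC := by simp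
  ind_of_extP := by simp
  ind_of_extD := by simp
  den_thing := by simp
  den_inv := by simp
  den_some := by simp

/-- Every interpretation is a model of the empty ontology, and `Interp.void` falsifies every
assertion. -/
theorem not_ontologyOracle_empty (D : DatatypeMap.{v}) (J : Set (RegAtom (IRI Name)))
    (i o : List (IRI Name)) : ¬ ontologyOracle D ∅ J i o := by
  intro h
  unfold ontologyOracle at h
  split at h
  · obtain ⟨A, hA, h⟩ := h (Interp.void Name D) (by simp [Interp.IsModel])
    cases hA
    exact h
  · obtain ⟨A, hA, h⟩ := h (Interp.void Name D) (by simp [Interp.IsModel])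
    cases hA
    exact h
  · exact h

theorem flpReduct_union_eq {f : Oracle Name} {G G' : Set (Rule (IRI Name))}
    {I : Set (RegAtom (IRI Name))} (h : ∀ g ∈ G', ¬ HoldsBody f I g) :
    flpReduct f (G ∪ G') I = flpReduct f G I := by
  ext g
  constructor
  · rintro ⟨hg | hg, hb⟩
    · exact ⟨hg, hb⟩
    · exact absurd hb (h g hg)
  · rintro ⟨hg, hb⟩
    exact ⟨Or.inl hg, hb⟩

theorem Program.ground_union (P P' : Program Name) (U : Set (IRI Name)) :
    (P ∪ P').ground U = P.ground U ∪ P'.ground U := by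
  ext g
  simp only [Program.ground, Set.mem_union, Set.mem_ofPred_eq, or_and_right, exists_or]

theorem Program.constants_union (P P' : Program Name) :
    (P ∪ P').constants = P.constants ∪ P'.constants := by
  ext g
  simp only [Program.constants, Set.mem_union, Set.mem_ofPred_eq, or_and_right, exists_or]

theorem constants_interfaceRules_subset (O : Ontology Name) (S : Set (IRI Name)) :
    (interfaceRules O S).constants ⊆ S := by
  rintro e ⟨ρ, ⟨c, hc, -, rfl⟩ | ⟨c, hc, -, rfl⟩, he⟩ <;>
    simp [Rule.terms, BodyAtom.terms] at he <;> rwa [he]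

theorem not_holdsBody_interfaceRules (D : DatatypeMap.{v}) (O : Ontology Name)
    (S U : Set (IRI Name)) (J : Set (RegAtom (IRI Name))) :
    ∀ g ∈ (interfaceRules O S).ground U, ¬ HoldsBody (ontologyOracle D ∅) J g := by
  rintro g ⟨ρ, hρ, σ, -, rfl⟩ hb
  rcases hρ with ⟨c, -, -, rfl⟩ | ⟨c, -, -, rfl⟩ <;>
  · have h := hb _ (List.mem_cons_self ..)
    simp only [BodyAtom.map, HoldsAtom] at h
    exact not_ontologyOracle_empty D J _ _ h

/-- The added rules have false bodies, so they enter no reduct; the assumption on `S` keeps the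
grounding of `P` unchanged. The Herbrand base may grow, but the least model already lies in the
smaller one. -/
theorem HKB.answerSets_union_interfaceRules (D : DatatypeMap.{v}) (O : Ontology Name)
    {P : Program Name} (hP : ∀ ρ ∈ P, ρ.Ordinary) {S : Set (IRI Name)} (hS : S ⊆ P.constants) :
    (HKB.mk ∅ (P ∪ interfaceRules O S)).answerSets D = (HKB.mk ∅ P).answerSets D := by
  have hc : (P ∪ interfaceRules O S).constants = P.constants := by
    rw [Program.constants_union]
    exact Set.union_eq_left.2 ((constants_interfaceRules_subset O S).trans hS)
  rw [HKB.answerSets_of_ordinary D hP]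
  ext I
  simp only [HKB.answerSets, HKB.constants_of_empty, Set.mem_ofPred_eq, Set.mem_singleton_iff, hc,
    Program.ground_union, flpReduct_union_eq (not_holdsBody_interfaceRules D O S P.constants I)]
  rw [minimal_flpReduct_iff hP]
  constructor
  · exact fun h => h.2
  · rintro rfl
    refine ⟨P.minimalModel_subset_herbrandBase.trans ?_, rfl⟩
    rintro g ⟨r, hr, h⟩
    exact ⟨r, Or.inl hr, h⟩

/-! ### Saturated sets of statements -/

/-- The premises hold only if the conclusion does. -/
def Inference.Valid (S : Stmt T → Prop) (ρ : Inference T) : Prop :=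
  (∀ s ∈ ρ.prems, S s) → S ρ.concl

/-- Closure of a set of statements under the saturation rules, one field for each rule schema. -/
structure Saturated (thing : T) (S : Stmt T → Prop) : Prop where
  cls_thing : S (.cls thing)
  cls_of : ∀ α, S (.ax α) → ∀ e ∈ α.classArgs, S (.cls e)
  prop_of : ∀ α, S (.ax α) → ∀ e ∈ α.roleArgs, S (.prop e)
  ind_of : ∀ α, S (.ax α) → ∀ e ∈ α.indArgs, S (.ind e)
  sub_cls_self : ∀ c, S (.cls c) → S (.ax (.sub (.cls c) (.cls c)))
  sub_ex_self : ∀ R, S (.prop R.role) → S (.ax (.sub (.ex R) (.ex R thing)))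
  sub_thing : ∀ B : LeftExp T, (∀ s ∈ B.typing, S s) → S (.ax (.sub B (.cls thing)))
  sub_trans : ∀ B c E, S (.ax (.sub B (.cls c))) → S (.ax (.sub (.cls c) E)) → S (.ax (.sub B E))
  sub_of_empty : ∀ B E, S (.ax (.disj B B)) → (∀ s ∈ E.typing, S s) → S (.ax (.sub B E))
  sub_ex_trans : ∀ B R c E, S (.ax (.sub B (.ex R c))) → S (.ax (.sub (.ex R) E)) →
    S (.ax (.sub B E))
  sub_ex_mono : ∀ B R c d, S (.ax (.sub B (.ex R c))) → S (.ax (.sub (.cls c) (.cls d))) →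
    S (.ax (.sub B (.ex R d)))
  sub_ex_range : ∀ B R c d, S (.ax (.sub B (.ex R c))) → S (.ax (.sub (.ex R.flip) (.cls d))) →
    S (.ax (.sub B (.ex R d)))
  sub_ex_refl : ∀ B R c, S (.ax (.refl R.role)) → S (.ax (.sub B (.cls c))) →
    S (.ax (.sub B (.ex R c)))
  sub_ex_role : ∀ B R U c, S (.ax (.sub B (.ex R c))) → S (.ax (.subRole R.role U)) →
    S (.ax (.sub B (.ex (R.orient U) c)))
  disj_ex : ∀ R, S (.ax (.disjRole R.role (.dir R.role))) → S (.ax (.disj (.ex R) (.ex R)))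
  disj_of_ex : ∀ B R c, S (.ax (.sub B (.ex R c))) → S (.ax (.disj (.ex R.flip) (.cls c))) →
    S (.ax (.disj B B))
  disj_symm : ∀ B B', S (.ax (.disj B B')) → S (.ax (.disj B' B))
  disj_of_empty : ∀ B B', S (.ax (.disj B B)) → (∀ s ∈ B'.typing, S s) → S (.ax (.disj B B'))
  disj_of_sub : ∀ B c B', S (.ax (.sub B (.cls c))) → S (.ax (.disj (.cls c) B')) →
    S (.ax (.disj B B'))
  disj_of_sub_ex : ∀ B R c B', S (.ax (.sub B (.ex R c))) → S (.ax (.disj (.ex R) B')) →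
    S (.ax (.disj B B'))
  subRole_self : ∀ r, S (.prop r) → S (.ax (.subRole r (.dir r)))
  irrefl_of_empty : ∀ r, S (.ax (.disjRole r (.dir r))) → S (.ax (.irrefl r))
  irrefl_of_asymm : ∀ r, S (.ax (.disjRole r (.inv r))) → S (.ax (.irrefl r))
  thing_empty : ∀ r, S (.ax (.refl r)) → S (.ax (.irrefl r)) →
    S (.ax (.disj (.cls thing) (.cls thing)))
  refl_of_thing_empty : ∀ r, S (.ax (.disj (.cls thing) (.cls thing))) → S (.prop r) →
    S (.ax (.refl r))
  disjRole_symm : ∀ r s, S (.ax (.disjRole s (.dir r))) → S (.ax (.disjRole r (.dir s)))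
  disjRole_symm_inv : ∀ r s, S (.ax (.disjRole s (.inv r))) → S (.ax (.disjRole r (.inv s)))
  disjRole_of_domain : ∀ r U, S (.ax (.disj (.ex (.dir r)) (.ex U))) → S (.ax (.disjRole r U))
  disjRole_of_range : ∀ r U, S (.ax (.disj (.ex (.inv r)) (.ex U.flip))) → S (.ax (.disjRole r U))
  subRole_of_empty : ∀ r U, S (.ax (.disjRole r (.dir r))) → S (.prop U.role) →
    S (.ax (.subRole r U))
  disjRole_of_empty : ∀ r U, S (.ax (.disjRole r (.dir r))) → S (.prop U.role) →
    S (.ax (.disjRole r U))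
  refl_of_subRole : ∀ r U, S (.ax (.refl r)) → S (.ax (.subRole r U)) → S (.ax (.refl U.role))
  irrefl_of_subRole : ∀ r U, S (.ax (.subRole r U)) → S (.ax (.irrefl U.role)) →
    S (.ax (.irrefl r))
  irrefl_of_disjRole : ∀ r U, S (.ax (.refl U.role)) → S (.ax (.disjRole r U)) → S (.ax (.irrefl r))
  subRole_trans : ∀ r U V, S (.ax (.subRole r U)) → S (.ax (.subRole U.role V)) →
    S (.ax (.subRole r (U.orient V)))
  disjRole_of_subRole : ∀ r U V, S (.ax (.subRole r U)) → S (.ax (.disjRole U.role V)) →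
    S (.ax (.disjRole r (U.orient V)))
  thing_assert : ∀ x, S (.ind x) → S (.ax (.classAssert thing x))
  refl_assert : ∀ r x, S (.ax (.refl r)) → S (.ind x) → S (.ax (.roleAssert r x x))
  classAssert_of_sub : ∀ c d x, S (.ax (.classAssert c x)) → S (.ax (.sub (.cls c) (.cls d))) →
    S (.ax (.classAssert d x))
  classAssert_of_domain : ∀ r d x y, S (.ax (.roleAssert r x y)) →
    S (.ax (.sub (.ex (.dir r)) (.cls d))) → S (.ax (.classAssert d x))
  classAssert_of_range : ∀ r d x y, S (.ax (.roleAssert r x y)) →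
    S (.ax (.sub (.ex (.inv r)) (.cls d))) → S (.ax (.classAssert d y))
  roleAssert_of_subRole : ∀ r s x y, S (.ax (.roleAssert r x y)) → S (.ax (.subRole r (.dir s))) →
    S (.ax (.roleAssert s x y))
  roleAssert_of_subRole_inv : ∀ r s x y, S (.ax (.roleAssert r x y)) →
    S (.ax (.subRole r (.inv s))) → S (.ax (.roleAssert s y x))
  diff_symm : ∀ x y, S (.ax (.diff x y)) → S (.ax (.diff y x))
  clash_diff : ∀ x, S (.ax (.diff x x)) → S .clash
  clash_irrefl : ∀ r x, S (.ax (.irrefl r)) → S (.ax (.roleAssert r x x)) → S .clash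
  clash_cls_cls : ∀ c d x, S (.ax (.classAssert c x)) → S (.ax (.classAssert d x)) →
    S (.ax (.disj (.cls c) (.cls d))) → S .clash
  clash_cls_dir : ∀ c r x y, S (.ax (.classAssert c x)) → S (.ax (.roleAssert r x y)) →
    S (.ax (.disj (.ex (.dir r)) (.cls c))) → S .clash
  clash_cls_inv : ∀ c r x y, S (.ax (.classAssert c x)) → S (.ax (.roleAssert r y x)) →
    S (.ax (.disj (.ex (.inv r)) (.cls c))) → S .clash
  clash_dir_dir : ∀ r s x y z, S (.ax (.roleAssert r x y)) → S (.ax (.roleAssert s x z)) →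
    S (.ax (.disj (.ex (.dir r)) (.ex (.dir s)))) → S .clash
  clash_dir_inv : ∀ r s x y z, S (.ax (.roleAssert r x y)) → S (.ax (.roleAssert s z x)) →
    S (.ax (.disj (.ex (.dir r)) (.ex (.inv s)))) → S .clash
  clash_inv_inv : ∀ r s x y z, S (.ax (.roleAssert r y x)) → S (.ax (.roleAssert s z x)) →
    S (.ax (.disj (.ex (.inv r)) (.ex (.inv s)))) → S .clash
  clash_role : ∀ r s x y, S (.ax (.roleAssert r x y)) → S (.ax (.roleAssert s x y)) →
    S (.ax (.disjRole r (.dir s))) → S .clash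
  clash_role_inv : ∀ r s x y, S (.ax (.roleAssert r x y)) → S (.ax (.roleAssert s y x)) →
    S (.ax (.disjRole r (.inv s))) → S .clash

/-- The saturation rules with entities of `T` in place of variables. -/
def saturationInstances (thing : T) (σ : ℕ → T) : List (Inference T) :=
  typingRules thing (σ 0) (σ 1) (σ 2) (σ 3) (σ 4) ++
  classInclusionRules thing (σ 0) (σ 1) (σ 2) (σ 3) (σ 4) ++
  classDisjointnessRules (σ 0) (σ 1) (σ 2) (σ 3) ++
  propertyRules thing (σ 0) (σ 1) (σ 2) ++
  assertionRules thing (σ 0) (σ 1) (σ 2) (σ 3) (σ 4) (σ 5) ++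
  clashRules (σ 0) (σ 1) (σ 2) (σ 3) (σ 4) (σ 5) (σ 6)

def Inference.map {T T' : Type u} (f : T → T') (ρ : Inference T) : Inference T' :=
  ⟨ρ.concl.map f, ρ.prems.map (Stmt.map f)⟩

/-- The schemas are uniform in their parameters, so substitution passes through them by computation.
-/
theorem map_saturationRules {Name : Type u} (σ : ℕ → IRI Name) :
    (saturationRules Name).map (Inference.map (Term.eval σ)) =
      saturationInstances .owlThing σ := by
  simp only [saturationRules, saturationInstances, List.map_append]
  congr 1

/-! ### Schematic forms of expressions and axioms -/

def LeftExp.arg : LeftExp T → T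
  | .cls c => c
  | .ex R => R.role

theorem RoleExp.mem_roleForms (R : RoleExp T) : R ∈ roleForms R.role := by
  cases R <;> simp [roleForms, RoleExp.role]

theorem RoleExp.role_of_mem {R : RoleExp T} {r : T} (h : R ∈ roleForms r) : R.role = r := by
  simp only [roleForms, List.mem_cons, List.not_mem_nil, or_false] at h
  rcases h with rfl | rfl <;> rfl

theorem LeftExp.mem_leftForms (B : LeftExp T) : B ∈ leftForms B.arg := by
  rcases B with c | r | r <;> simp [leftForms, LeftExp.arg, RoleExp.role]

theorem RightExp.exists_mem_rightForms (E : RightExp T) : ∃ s d, E ∈ rightForms s d := by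
  rcases E with c | ⟨r | r, c⟩
  · exact ⟨c, c, by simp [rightForms]⟩
  · exact ⟨r, c, by simp [rightForms]⟩
  · exact ⟨r, c, by simp [rightForms]⟩

/-- The finite lists of schemas miss no axiom: each form occurs for suitable parameters, and
parameters that the form does not use are padded. -/
theorem QLAx.exists_mem_axiomForms [Inhabited T] (α : QLAx T) :
    ∃ a b c x y, α ∈ axiomForms a b c x y := by
  rcases α with ⟨B, E⟩ | ⟨B, B'⟩ | ⟨r, U⟩ | ⟨r, U⟩ | r | r | ⟨c, x⟩ | ⟨r, x, y⟩ | ⟨x, y⟩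
  · obtain ⟨s, d, hE⟩ := E.exists_mem_rightForms
    refine ⟨B.arg, s, d, default, default, ?_⟩
    simp [axiomForms, B.mem_leftForms, hE]
  · refine ⟨B.arg, B'.arg, default, default, default, ?_⟩
    simp [axiomForms, B.mem_leftForms, B'.mem_leftForms]
  · exact ⟨r, U.role, default, default, default, by simp [axiomForms, U.mem_roleForms]⟩
  · exact ⟨r, U.role, default, default, default, by simp [axiomForms, U.mem_roleForms]⟩
  · exact ⟨r, default, default, default, default, by simp [axiomForms]⟩
  · exact ⟨r, default, default, default, default, by simp [axiomForms]⟩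
  · exact ⟨c, default, default, x, default, by simp [axiomForms]⟩
  · exact ⟨r, default, default, x, y, by simp [axiomForms]⟩
  · exact ⟨default, default, default, x, y, by simp [axiomForms]⟩

/-- Together with `saturated_of_valid` this passes between the rule base as a list of schemas and
the named closure conditions used in arguments. This direction serves soundness; the other shows
that derivability is saturated. -/
theorem Saturated.valid {thing : T} {S : Stmt T → Prop} (h : Saturated thing S) (σ : ℕ → T) :
    ∀ ρ ∈ saturationInstances thing σ, ρ.Valid S := by
  simp only [saturationInstances, List.forall_mem_append]
  refine ⟨⟨⟨⟨⟨?_, ?_⟩, ?_⟩, ?_⟩, ?_⟩, ?_⟩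
  · simp only [typingRules, List.forall_mem_append, List.forall_mem_flatMap, List.forall_mem_map,
      List.forall_mem_cons, Inference.Valid, List.not_mem_nil, false_imp_iff, implies_true,
      forall_const, and_true]
    exact ⟨h.cls_thing, fun α _ => ⟨⟨fun e he hα => h.cls_of α hα e he,
      fun e he hα => h.prop_of α hα e he⟩, fun e he hα => h.ind_of α hα e he⟩⟩
  · simp only [classInclusionRules, List.forall_mem_append, List.forall_mem_flatMap,
      List.forall_mem_map, List.forall_mem_cons, Inference.Valid, List.not_mem_nil, false_imp_iff,
      implies_true, and_true, and_imp]
    refine ⟨⟨h.sub_cls_self _, fun R hR hp => h.sub_ex_self R (R.role_of_mem hR ▸ hp)⟩,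
      fun B _ => ⟨⟨⟨h.sub_thing B, fun E _ => h.sub_trans B _ E⟩,
        fun E _ => h.sub_of_empty B E⟩, fun R hR => ?_⟩⟩
    have hr := R.role_of_mem hR
    exact ⟨⟨fun E _ => h.sub_ex_trans B R _ E, h.sub_ex_mono B R _ _, h.sub_ex_range B R _ _,
      hr ▸ h.sub_ex_refl B R _⟩, fun U _ => hr ▸ h.sub_ex_role B R U _⟩
  · simp only [classDisjointnessRules, List.forall_mem_append, List.forall_mem_flatMap,
      List.forall_mem_map, List.forall_mem_cons, Inference.Valid, List.not_mem_nil, false_imp_iff,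
      implies_true, and_true, and_imp]
    exact ⟨fun R hR => R.role_of_mem hR ▸ h.disj_ex R, fun B _ => ⟨fun R _ => h.disj_of_ex B R _,
      fun B' _ => ⟨⟨h.disj_symm B B', h.disj_of_empty B B', h.disj_of_sub B _ B'⟩,
        fun R _ => h.disj_of_sub_ex B R _ B'⟩⟩⟩
  · simp only [propertyRules, List.forall_mem_append, List.forall_mem_flatMap,
      List.forall_mem_cons, Inference.Valid, List.not_mem_nil, false_imp_iff,
      implies_true, and_true, and_imp]
    refine ⟨⟨h.subRole_self _, h.irrefl_of_empty _, h.irrefl_of_asymm _, h.thing_empty _,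
      h.refl_of_thing_empty _, h.disjRole_symm _ _, h.disjRole_symm_inv _ _⟩, fun U hU => ?_⟩
    have hr := U.role_of_mem hU
    exact ⟨⟨h.disjRole_of_domain _ U, h.disjRole_of_range _ U, hr ▸ h.subRole_of_empty _ U,
      hr ▸ h.disjRole_of_empty _ U, hr ▸ h.refl_of_subRole _ U, hr ▸ h.irrefl_of_subRole _ U,
      hr ▸ h.irrefl_of_disjRole _ U⟩, fun V _ =>
      ⟨hr ▸ h.subRole_trans _ U V, hr ▸ h.disjRole_of_subRole _ U V⟩⟩
  · simp only [assertionRules, List.forall_mem_cons, Inference.Valid, List.not_mem_nil,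
      false_imp_iff, implies_true, and_true, and_imp]
    exact ⟨h.thing_assert _, h.refl_assert _ _, h.classAssert_of_sub _ _ _,
      h.classAssert_of_domain _ _ _ _, h.classAssert_of_range _ _ _ _,
      h.roleAssert_of_subRole _ _ _ _, h.roleAssert_of_subRole_inv _ _ _ _, h.diff_symm _ _⟩
  · simp only [clashRules, List.forall_mem_cons, Inference.Valid, List.not_mem_nil,
      false_imp_iff, implies_true, and_true, and_imp]
    exact ⟨h.clash_diff _, h.clash_irrefl _ _, h.clash_cls_cls _ _ _, h.clash_cls_dir _ _ _ _,
      h.clash_cls_inv _ _ _ _, h.clash_dir_dir _ _ _ _ _, h.clash_dir_inv _ _ _ _ _,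
      h.clash_inv_inv _ _ _ _ _, h.clash_role _ _ _ _, h.clash_role_inv _ _ _ _⟩

/-- The assignment of the first seven variables. -/
def assign (t₀ t₁ t₂ t₃ t₄ t₅ t₆ : T) : ℕ → T
  | 0 => t₀ | 1 => t₁ | 2 => t₂ | 3 => t₃ | 4 => t₄ | 5 => t₅ | _ => t₆

theorem saturated_of_valid {thing : T} {S : Stmt T → Prop}
    (h : ∀ σ, ∀ ρ ∈ saturationInstances thing σ, ρ.Valid S) : Saturated thing S := by
  simp only [saturationInstances, List.forall_mem_append] at h
  -- The groups of rules use different numbers of variables; the slots of `assign` that a group does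
  -- not use are filled with any parameter at hand.
  have hty : ∀ a b c x y, ∀ ρ ∈ typingRules thing a b c x y, ρ.Valid S := fun a b c x y =>
    (h (assign a b c x y a a)).1.1.1.1.1
  have hci : ∀ b c d r s, ∀ ρ ∈ classInclusionRules thing b c d r s, ρ.Valid S :=
    fun b c d r s => (h (assign b c d r s b b)).1.1.1.1.2
  have hcd : ∀ b b' c r, ∀ ρ ∈ classDisjointnessRules b b' c r, ρ.Valid S :=
    fun b b' c r => (h (assign b b' c r b b b)).1.1.1.2
  have hpr : ∀ r s t, ∀ ρ ∈ propertyRules thing r s t, ρ.Valid S :=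
    fun r s t => (h (assign r s t r r r r)).1.1.2
  have has : ∀ c d r s x y, ∀ ρ ∈ assertionRules thing c d r s x y, ρ.Valid S :=
    fun c d r s x y => (h (assign c d r s x y c)).1.2
  have hcl : ∀ c d r s x y z, ∀ ρ ∈ clashRules c d r s x y z, ρ.Valid S :=
    fun c d r s x y z => (h (assign c d r s x y z)).2
  clear h
  simp only [typingRules, List.forall_mem_append, List.forall_mem_flatMap, List.forall_mem_map,
    List.forall_mem_cons, Inference.Valid, List.not_mem_nil, false_imp_iff, implies_true,
    forall_const, and_true] at hty
  simp only [classInclusionRules, List.forall_mem_append, List.forall_mem_flatMap,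
    List.forall_mem_map, List.forall_mem_cons, Inference.Valid, List.not_mem_nil, false_imp_iff,
    implies_true, and_true, and_imp] at hci
  simp only [classDisjointnessRules, List.forall_mem_append, List.forall_mem_flatMap,
    List.forall_mem_map, List.forall_mem_cons, Inference.Valid, List.not_mem_nil, false_imp_iff,
    implies_true, and_true, and_imp] at hcd
  simp only [propertyRules, List.forall_mem_append, List.forall_mem_flatMap,
    List.forall_mem_cons, Inference.Valid, List.not_mem_nil, false_imp_iff,
    implies_true, and_true, and_imp] at hpr
  simp only [assertionRules, List.forall_mem_cons, Inference.Valid, List.not_mem_nil,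
    false_imp_iff, implies_true, and_true, and_imp] at has
  simp only [clashRules, List.forall_mem_cons, Inference.Valid, List.not_mem_nil,
    false_imp_iff, implies_true, and_true, and_imp] at hcl
  have : Inhabited T := ⟨thing⟩
  have hL := @LeftExp.mem_leftForms T
  have hR := @RoleExp.mem_roleForms T
  constructor
  case cls_thing => exact (hty thing thing thing thing thing).1
  case cls_of =>
    intro α hα e he
    obtain ⟨a, b, c, x, y, hm⟩ := α.exists_mem_axiomForms
    exact ((hty a b c x y).2 α hm).1.1 e he hα
  case prop_of =>
    intro α hα e he
    obtain ⟨a, b, c, x, y, hm⟩ := α.exists_mem_axiomForms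
    exact ((hty a b c x y).2 α hm).1.2 e he hα
  case ind_of =>
    intro α hα e he
    obtain ⟨a, b, c, x, y, hm⟩ := α.exists_mem_axiomForms
    exact ((hty a b c x y).2 α hm).2 e he hα
  case sub_cls_self => exact fun c => (hci c c c c c).1.1
  case sub_ex_self => exact fun R => (hci thing thing thing R.role thing).1.2 R (hR R)
  case sub_thing =>
    exact fun B => ((hci B.arg thing thing thing thing).2 B (hL B)).1.1.1
  case sub_trans =>
    intro B c E
    obtain ⟨s, d, hE⟩ := E.exists_mem_rightForms
    exact ((hci B.arg c d thing s).2 B (hL B)).1.1.2 E hE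
  case sub_of_empty =>
    intro B E
    obtain ⟨s, d, hE⟩ := E.exists_mem_rightForms
    exact ((hci B.arg thing d thing s).2 B (hL B)).1.2 E hE
  case sub_ex_trans =>
    intro B R c E
    obtain ⟨s, d, hE⟩ := E.exists_mem_rightForms
    exact (((hci B.arg c d R.role s).2 B (hL B)).2 R (hR R)).1.1 E hE
  case sub_ex_mono =>
    exact fun B R c d => (((hci B.arg c d R.role thing).2 B (hL B)).2 R (hR R)).1.2.1
  case sub_ex_range =>
    exact fun B R c d => (((hci B.arg c d R.role thing).2 B (hL B)).2 R (hR R)).1.2.2.1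
  case sub_ex_refl =>
    exact fun B R c => (((hci B.arg c c R.role thing).2 B (hL B)).2 R (hR R)).1.2.2.2
  case sub_ex_role =>
    exact fun B R U c => (((hci B.arg c c R.role U.role).2 B (hL B)).2 R (hR R)).2 U (hR U)
  case disj_ex => exact fun R => (hcd thing thing thing R.role).1 R (hR R)
  case disj_of_ex => exact fun B R c => ((hcd B.arg thing c R.role).2 B (hL B)).1 R (hR R)
  case disj_symm =>
    exact fun B B' => (((hcd B.arg B'.arg thing thing).2 B (hL B)).2 B' (hL B')).1.1
  case disj_of_empty =>
    exact fun B B' => (((hcd B.arg B'.arg thing thing).2 B (hL B)).2 B' (hL B')).1.2.1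
  case disj_of_sub =>
    exact fun B c B' => (((hcd B.arg B'.arg c thing).2 B (hL B)).2 B' (hL B')).1.2.2
  case disj_of_sub_ex =>
    exact fun B R c B' => (((hcd B.arg B'.arg c R.role).2 B (hL B)).2 B' (hL B')).2 R (hR R)
  case subRole_self => exact fun r => (hpr r r r).1.1
  case irrefl_of_empty => exact fun r => (hpr r r r).1.2.1
  case irrefl_of_asymm => exact fun r => (hpr r r r).1.2.2.1
  case thing_empty => exact fun r => (hpr r r r).1.2.2.2.1
  case refl_of_thing_empty => exact fun r => (hpr r r r).1.2.2.2.2.1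
  case disjRole_symm => exact fun r s => (hpr r s r).1.2.2.2.2.2.1
  case disjRole_symm_inv => exact fun r s => (hpr r s r).1.2.2.2.2.2.2
  case disjRole_of_domain => exact fun r U => ((hpr r U.role r).2 U (hR U)).1.1
  case disjRole_of_range => exact fun r U => ((hpr r U.role r).2 U (hR U)).1.2.1
  case subRole_of_empty => exact fun r U => ((hpr r U.role r).2 U (hR U)).1.2.2.1
  case disjRole_of_empty => exact fun r U => ((hpr r U.role r).2 U (hR U)).1.2.2.2.1
  case refl_of_subRole => exact fun r U => ((hpr r U.role r).2 U (hR U)).1.2.2.2.2.1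
  case irrefl_of_subRole => exact fun r U => ((hpr r U.role r).2 U (hR U)).1.2.2.2.2.2.1
  case irrefl_of_disjRole => exact fun r U => ((hpr r U.role r).2 U (hR U)).1.2.2.2.2.2.2
  case subRole_trans =>
    exact fun r U V => (((hpr r U.role V.role).2 U (hR U)).2 V (hR V)).1
  case disjRole_of_subRole =>
    exact fun r U V => (((hpr r U.role V.role).2 U (hR U)).2 V (hR V)).2
  case thing_assert => exact fun x => (has x x x x x x).1
  case refl_assert => exact fun r x => (has x x r x x x).2.1
  case classAssert_of_sub => exact fun c d x => (has c d x x x x).2.2.1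
  case classAssert_of_domain => exact fun r d x y => (has d d r r x y).2.2.2.1
  case classAssert_of_range => exact fun r d x y => (has d d r r x y).2.2.2.2.1
  case roleAssert_of_subRole => exact fun r s x y => (has r r r s x y).2.2.2.2.2.1
  case roleAssert_of_subRole_inv => exact fun r s x y => (has r r r s x y).2.2.2.2.2.2.1
  case diff_symm => exact fun x y => (has x x x x x y).2.2.2.2.2.2.2
  case clash_diff => exact fun x => (hcl x x x x x x x).1
  case clash_irrefl => exact fun r x => (hcl x x r x x x x).2.1
  case clash_cls_cls => exact fun c d x => (hcl c d x x x x x).2.2.1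
  case clash_cls_dir => exact fun c r x y => (hcl c c r r x y x).2.2.2.1
  case clash_cls_inv => exact fun c r x y => (hcl c c r r x y x).2.2.2.2.1
  case clash_dir_dir => exact fun r s x y z => (hcl r r r s x y z).2.2.2.2.2.1
  case clash_dir_inv => exact fun r s x y z => (hcl r r r s x y z).2.2.2.2.2.2.1
  case clash_inv_inv => exact fun r s x y z => (hcl r r r s x y z).2.2.2.2.2.2.2.1
  case clash_role => exact fun r s x y => (hcl r r r s x y x).2.2.2.2.2.2.2.2.1
  case clash_role_inv => exact fun r s x y => (hcl r r r s x y x).2.2.2.2.2.2.2.2.2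

/-- All arguments of a statement belong to `U`. -/
def Stmt.ArgsIn (U : Set T) (s : Stmt T) : Prop := ∀ e ∈ s.args, e ∈ U

/-- The arguments of a conclusion of a saturation rule occur in the premises. -/
theorem saturated_argsIn {thing : T} {U : Set T} (hU : thing ∈ U) :
    Saturated thing (Stmt.ArgsIn U) := by
  constructor
  case cls_of | prop_of | ind_of =>
    intro α hα e he e' he'
    obtain rfl : e' = e := by simpa [Stmt.args] using he'
    exact hα e' (by simp [Stmt.args, QLAx.args, he])
  all_goals
    intros
    (try casesm* LeftExp _, RightExp _, RoleExp _) <;>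
    simp_all [Stmt.ArgsIn, Stmt.args, QLAx.args, QLAx.classArgs, QLAx.roleArgs, QLAx.indArgs,
      LeftExp.typing, RightExp.typing, RightExp.classArgs, RightExp.roleArgs, LeftExp.classArgs,
      LeftExp.roleArgs, RoleExp.role, RoleExp.flip, RoleExp.orient]

/-! ### Roles and their orientation -/

@[simp] theorem RoleExp.flip_flip (R : RoleExp T) : R.flip.flip = R := by
  cases R <;> rfl

@[simp] theorem RoleExp.role_flip (R : RoleExp T) : R.flip.role = R.role := by
  cases R <;> rfl

@[simp] theorem RoleExp.role_dir (r : T) : (RoleExp.dir r).role = r := rfl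

@[simp] theorem RoleExp.role_orient (R U : RoleExp T) : (R.orient U).role = U.role := by
  cases R <;> cases U <;> rfl

@[simp] theorem RoleExp.orient_orient (R U : RoleExp T) : R.orient (R.orient U) = U := by
  cases R <;> cases U <;> rfl

theorem RoleExp.flip_injective : Function.Injective (RoleExp.flip (α := T)) :=
  Function.LeftInverse.injective RoleExp.flip_flip

/-! ### Semantics of statements -/

/-- The part of an interpretation that matters for statements over `T`: which objects are
individuals, classes and properties, the members of classes and properties, and the denotations. -/
structure Struct (T : Type u) : Type (u + 1) where
  Obj : Type u
  isInd : Obj → Prop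
  isCls : Obj → Prop
  isProp : Obj → Prop
  cls : Obj → Obj → Prop
  rel : Obj → Obj → Obj → Prop
  den : T → Obj

namespace Struct

def role (M : Struct T) : RoleExp T → M.Obj → M.Obj → Prop
  | .dir r, o, o' => M.rel (M.den r) o o'
  | .inv r, o, o' => M.rel (M.den r) o' o

def left (M : Struct T) : LeftExp T → M.Obj → Prop
  | .cls c, o => M.cls (M.den c) o
  | .ex R, o => ∃ o', M.role R o o'

def right (M : Struct T) : RightExp T → M.Obj → Prop
  | .cls c, o => M.cls (M.den c) o
  | .ex R c, o => ∃ o', M.role R o o' ∧ M.cls (M.den c) o'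

def leftTyped (M : Struct T) : LeftExp T → Prop
  | .cls c => M.isCls (M.den c)
  | .ex R => M.isProp (M.den R.role)

def rightTyped (M : Struct T) : RightExp T → Prop
  | .cls c => M.isCls (M.den c)
  | .ex R c => M.isProp (M.den R.role) ∧ M.isCls (M.den c)

def Sat (M : Struct T) : QLAx T → Prop
  | .sub B E => M.leftTyped B ∧ M.rightTyped E ∧ ∀ o, M.left B o → M.right E o
  | .disj B B' => M.leftTyped B ∧ M.leftTyped B' ∧ ∀ o, M.left B o → ¬ M.left B' o
  | .subRole r R => M.isProp (M.den r) ∧ M.isProp (M.den R.role) ∧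
      ∀ o o', M.rel (M.den r) o o' → M.role R o o'
  | .disjRole r R => M.isProp (M.den r) ∧ M.isProp (M.den R.role) ∧
      ∀ o o', M.rel (M.den r) o o' → ¬ M.role R o o'
  | .refl r => M.isProp (M.den r) ∧ ∀ o, M.isInd o → M.rel (M.den r) o o
  | .irrefl r => M.isProp (M.den r) ∧ ∀ o, M.isInd o → ¬ M.rel (M.den r) o o
  | .classAssert c x => M.isCls (M.den c) ∧ M.cls (M.den c) (M.den x)
  | .roleAssert r x y => M.isProp (M.den r) ∧ M.rel (M.den r) (M.den x) (M.den y)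
  | .diff x y => M.isInd (M.den x) ∧ M.isInd (M.den y) ∧ M.den x ≠ M.den y

def Holds (M : Struct T) : Stmt T → Prop
  | .ax α => M.Sat α
  | .cls c => M.isCls (M.den c)
  | .prop r => M.isProp (M.den r)
  | .ind x => M.isInd (M.den x)
  | .clash => False

/-- The entities denote through `f`. -/
def comap (M : Struct T) {T' : Type u} (f : T' → T) : Struct T' := { M with den := M.den ∘ f }

theorem holds_map (M : Struct T) {T' : Type u} (f : T' → T) (s : Stmt T') :
    M.Holds (s.map f) ↔ (M.comap f).Holds s := by
  rcases s with (⟨c | r | r, c | ⟨r | r, c⟩⟩ | ⟨c | r | r, c | r | r⟩ | ⟨r, r | r⟩ | ⟨r, r | r⟩ | r | r |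
    ⟨c, x⟩ | ⟨r, x, y⟩ | ⟨x, y⟩) | c | c | c | _ <;> rfl

/-- Truth depends on an entity only through its denotation; this is the soundness of replacing
equals by equals. -/
theorem holds_map_congr (M : Struct T) {T' : Type u} {f g : T' → T}
    (h : ∀ t, M.den (f t) = M.den (g t)) (s : Stmt T') :
    M.Holds (s.map f) ↔ M.Holds (s.map g) := by
  have : M.comap f = M.comap g := by
    simp only [comap, Struct.mk.injEq, heq_eq_eq, true_and]
    exact funext h
  rw [holds_map, holds_map, this]

/-- The members of classes and properties are individuals, and `thing` is the class of all
individuals. -/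
structure WellFormed (M : Struct T) (thing : T) : Prop where
  isInd_of_cls : ∀ {c o}, M.cls c o → M.isInd o
  isInd_of_rel : ∀ {r o o'}, M.rel r o o' → M.isInd o ∧ M.isInd o'
  isCls_thing : M.isCls (M.den thing)
  cls_thing : ∀ {o}, M.cls (M.den thing) o ↔ M.isInd o

theorem role_flip (M : Struct T) (R : RoleExp T) (o o' : M.Obj) :
    M.role R.flip o o' ↔ M.role R o' o := by
  cases R <;> rfl

theorem WellFormed.isInd_of_role {M : Struct T} {thing : T} (h : M.WellFormed thing)
    {R : RoleExp T} {o o' : M.Obj} (hR : M.role R o o') : M.isInd o ∧ M.isInd o' := by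
  cases R with
  | dir r => exact h.isInd_of_rel hR
  | inv r => exact (h.isInd_of_rel hR).symm

theorem WellFormed.isInd_of_left {M : Struct T} {thing : T} (h : M.WellFormed thing)
    {B : LeftExp T} {o : M.Obj} (hB : M.left B o) : M.isInd o := by
  cases B with
  | cls c => exact h.isInd_of_cls hB
  | ex R => exact (h.isInd_of_role hB.choose_spec).1

theorem forall_mem_leftTyping (M : Struct T) (B : LeftExp T) :
    (∀ s ∈ B.typing, M.Holds s) ↔ M.leftTyped B := by
  cases B <;> simp [LeftExp.typing, LeftExp.classArgs, LeftExp.roleArgs, leftTyped, Holds]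

theorem forall_mem_rightTyping (M : Struct T) (E : RightExp T) :
    (∀ s ∈ E.typing, M.Holds s) ↔ M.rightTyped E := by
  cases E <;>
    simp [RightExp.typing, RightExp.classArgs, RightExp.roleArgs, rightTyped, Holds, and_comm]

theorem role_self_iff (M : Struct T) (R : RoleExp T) (o : M.Obj) :
    M.role R o o ↔ M.rel (M.den R.role) o o := by
  cases R <;> rfl

theorem role_orient (M : Struct T) {R V : RoleExp T}
    (h : ∀ o o', M.rel (M.den R.role) o o' → M.role V o o') {o o' : M.Obj} (hR : M.role R o o') :
    M.role (R.orient V) o o' := by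
  cases R with
  | dir r => exact h _ _ hR
  | inv r => exact (M.role_flip V o o').2 (h _ _ hR)

theorem typed_of_sat_classArgs (M : Struct T) {α : QLAx T} (h : M.Sat α) :
    ∀ e ∈ α.classArgs, M.isCls (M.den e) := by
  rcases α with ⟨c | r, c | ⟨r, c⟩⟩ | ⟨c | r, c | r⟩ | ⟨r, r⟩ | ⟨r, r⟩ | r | r |
    ⟨c, x⟩ | ⟨r, x, y⟩ | ⟨x, y⟩ <;>
  simp_all [Sat, QLAx.classArgs, LeftExp.classArgs, RightExp.classArgs, leftTyped, rightTyped]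

theorem typed_of_sat_roleArgs (M : Struct T) {α : QLAx T} (h : M.Sat α) :
    ∀ e ∈ α.roleArgs, M.isProp (M.den e) := by
  rcases α with ⟨c | r, c | ⟨r, c⟩⟩ | ⟨c | r, c | r⟩ | ⟨r, r⟩ | ⟨r, r⟩ | r | r |
    ⟨c, x⟩ | ⟨r, x, y⟩ | ⟨x, y⟩ <;>
  simp_all [Sat, QLAx.roleArgs, LeftExp.roleArgs, RightExp.roleArgs, leftTyped, rightTyped]

theorem WellFormed.typed_of_sat_indArgs {M : Struct T} {thing : T} (hM : M.WellFormed thing)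
    {α : QLAx T} (h : M.Sat α) : ∀ e ∈ α.indArgs, M.isInd (M.den e) := by
  cases α with
  | classAssert c x => simpa [QLAx.indArgs] using hM.isInd_of_cls h.2
  | roleAssert r x y => simpa [QLAx.indArgs] using hM.isInd_of_rel h.2
  | diff x y => simpa [QLAx.indArgs] using ⟨h.1, h.2.1⟩
  | _ => simp [QLAx.indArgs]

/-- Soundness of the saturation rules. -/
theorem WellFormed.saturated {M : Struct T} {thing : T} (hM : M.WellFormed thing) :
    Saturated thing M.Holds where
  cls_thing := hM.isCls_thing
  cls_of _ h := M.typed_of_sat_classArgs h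
  prop_of _ h := M.typed_of_sat_roleArgs h
  ind_of _ h := hM.typed_of_sat_indArgs h
  sub_cls_self c h := ⟨h, h, fun _ => id⟩
  sub_ex_self R h := ⟨h, ⟨h, hM.isCls_thing⟩, fun _ ⟨o', ho⟩ =>
    ⟨o', ho, hM.cls_thing.2 (hM.isInd_of_role ho).2⟩⟩
  sub_thing B h := ⟨(M.forall_mem_leftTyping B).1 h, hM.isCls_thing, fun _ ho =>
    hM.cls_thing.2 (hM.isInd_of_left ho)⟩
  sub_trans B c E h h' := ⟨h.1, h'.2.1, fun o ho => h'.2.2 o (h.2.2 o ho)⟩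
  sub_of_empty B E h h' := ⟨h.1, (M.forall_mem_rightTyping E).1 h', fun o ho =>
    absurd ho (h.2.2 o ho)⟩
  sub_ex_trans B R c E h h' := ⟨h.1, h'.2.1, fun o ho =>
    let ⟨o', ho', _⟩ := h.2.2 o ho
    h'.2.2 o ⟨o', ho'⟩⟩
  sub_ex_mono B R c d h h' := ⟨h.1, ⟨h.2.1.1, h'.2.1⟩, fun o ho =>
    let ⟨o', ho', hc⟩ := h.2.2 o ho
    ⟨o', ho', h'.2.2 o' hc⟩⟩
  sub_ex_range B R c d h h' := ⟨h.1, ⟨h.2.1.1, h'.2.1⟩, fun o ho =>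
    let ⟨o', ho', _⟩ := h.2.2 o ho
    ⟨o', ho', h'.2.2 o' ⟨o, (M.role_flip R o' o).2 ho'⟩⟩⟩
  sub_ex_refl B R c h h' := ⟨h'.1, ⟨h.1, h'.2.1⟩, fun o ho =>
    ⟨o, (M.role_self_iff R o).2 (h.2 o (hM.isInd_of_left ho)), h'.2.2 o ho⟩⟩
  sub_ex_role B R U c h h' := ⟨h.1, ⟨RoleExp.role_orient R U ▸ h'.2.1, h.2.1.2⟩, fun o ho =>
    let ⟨o', ho', hc⟩ := h.2.2 o ho
    ⟨o', M.role_orient h'.2.2 ho', hc⟩⟩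
  disj_ex R h := by
    refine ⟨h.1, h.1, fun o ⟨o', ho⟩ _ => ?_⟩
    cases R with
    | dir r => exact h.2.2 o o' ho ho
    | inv r => exact h.2.2 o' o ho ho
  disj_of_ex B R c h h' := ⟨h.1, h.1, fun o ho _ =>
    let ⟨o', ho', hc⟩ := h.2.2 o ho
    h'.2.2 o' ⟨o, (M.role_flip R o' o).2 ho'⟩ hc⟩
  disj_symm B B' h := ⟨h.2.1, h.1, fun o ho ho' => h.2.2 o ho' ho⟩
  disj_of_empty B B' h h' := ⟨h.1, (M.forall_mem_leftTyping B').1 h', fun o ho =>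
    absurd ho (h.2.2 o ho)⟩
  disj_of_sub B c B' h h' := ⟨h.1, h'.2.1, fun o ho => h'.2.2 o (h.2.2 o ho)⟩
  disj_of_sub_ex B R c B' h h' := ⟨h.1, h'.2.1, fun o ho =>
    let ⟨o', ho', _⟩ := h.2.2 o ho
    h'.2.2 o ⟨o', ho'⟩⟩
  subRole_self r h := ⟨h, h, fun _ _ => id⟩
  irrefl_of_empty r h := ⟨h.1, fun o _ ho => h.2.2 o o ho ho⟩
  irrefl_of_asymm r h := ⟨h.1, fun o _ ho => h.2.2 o o ho ho⟩
  thing_empty r h h' := ⟨hM.isCls_thing, hM.isCls_thing, fun o ho _ =>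
    h'.2 o (hM.cls_thing.1 ho) (h.2 o (hM.cls_thing.1 ho))⟩
  refl_of_thing_empty r h h' := ⟨h', fun o ho =>
    absurd (hM.cls_thing.2 ho) (h.2.2 o (hM.cls_thing.2 ho))⟩
  disjRole_symm r s h := ⟨h.2.1, h.1, fun o o' ho ho' => h.2.2 o o' ho' ho⟩
  disjRole_symm_inv r s h := ⟨h.2.1, h.1, fun o o' ho ho' => h.2.2 o' o ho' ho⟩
  disjRole_of_domain r U h := ⟨h.1, h.2.1, fun o o' ho ho' => h.2.2 o ⟨o', ho⟩ ⟨o', ho'⟩⟩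
  disjRole_of_range r U h := ⟨h.1, RoleExp.role_flip U ▸ h.2.1, fun o o' ho ho' =>
    h.2.2 o' ⟨o, ho⟩ ⟨o, (M.role_flip U o' o).2 ho'⟩⟩
  subRole_of_empty r U h h' := ⟨h.1, h', fun o o' ho => absurd ho (h.2.2 o o' ho)⟩
  disjRole_of_empty r U h h' := ⟨h.1, h', fun o o' ho => absurd ho (h.2.2 o o' ho)⟩
  refl_of_subRole r U h h' := ⟨h'.2.1, fun o ho =>
    (M.role_self_iff U o).1 (h'.2.2 o o (h.2 o ho))⟩
  irrefl_of_subRole r U h h' := ⟨h.1, fun o ho ho' =>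
    h'.2 o ho ((M.role_self_iff U o).1 (h.2.2 o o ho'))⟩
  irrefl_of_disjRole r U h h' := ⟨h'.1, fun o ho ho' =>
    h'.2.2 o o ho' ((M.role_self_iff U o).2 (h.2 o ho))⟩
  subRole_trans r U V h h' := ⟨h.1, RoleExp.role_orient U V ▸ h'.2.1, fun o o' ho =>
    M.role_orient h'.2.2 (h.2.2 o o' ho)⟩
  disjRole_of_subRole r U V h h' := by
    refine ⟨h.1, RoleExp.role_orient U V ▸ h'.2.1, fun o o' ho hV => ?_⟩
    have hU := h.2.2 o o' ho
    cases U with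
    | dir s => exact h'.2.2 o o' hU hV
    | inv s => exact h'.2.2 o' o hU ((M.role_flip V o o').1 hV)
  thing_assert x h := ⟨hM.isCls_thing, hM.cls_thing.2 h⟩
  refl_assert r x h h' := ⟨h.1, h.2 _ h'⟩
  classAssert_of_sub c d x h h' := ⟨h'.2.1, h'.2.2 _ h.2⟩
  classAssert_of_domain r d x y h h' := ⟨h'.2.1, h'.2.2 _ ⟨_, h.2⟩⟩
  classAssert_of_range r d x y h h' := ⟨h'.2.1, h'.2.2 _ ⟨_, h.2⟩⟩
  roleAssert_of_subRole r s x y h h' := ⟨h'.2.1, h'.2.2 _ _ h.2⟩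
  roleAssert_of_subRole_inv r s x y h h' := ⟨h'.2.1, h'.2.2 _ _ h.2⟩
  diff_symm x y h := ⟨h.2.1, h.1, h.2.2.symm⟩
  clash_diff x h := h.2.2 rfl
  clash_irrefl r x h h' := h.2 _ (hM.isInd_of_rel h'.2).1 h'.2
  clash_cls_cls c d x h h' h'' := h''.2.2 _ h.2 h'.2
  clash_cls_dir c r x y h h' h'' := h''.2.2 _ ⟨_, h'.2⟩ h.2
  clash_cls_inv c r x y h h' h'' := h''.2.2 _ ⟨_, h'.2⟩ h.2
  clash_dir_dir r s x y z h h' h'' := h''.2.2 _ ⟨_, h.2⟩ ⟨_, h'.2⟩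
  clash_dir_inv r s x y z h h' h'' := h''.2.2 _ ⟨_, h.2⟩ ⟨_, h'.2⟩
  clash_inv_inv r s x y z h h' h'' := h''.2.2 _ ⟨_, h.2⟩ ⟨_, h'.2⟩
  clash_role r s x y h h' h'' := h''.2.2 _ _ h.2 h'.2
  clash_role_inv r s x y h h' h'' := h''.2.2 _ _ h.2 h'.2

end Struct

/-! ### Interpretations as structures -/

/-- The structure underlying an interpretation. -/
def Interp.toStruct (I : Interp Name D) : Struct (IRI Name) where
  Obj := I.Obj
  isInd := I.isInd
  isCls o := ∃ A, I.extC o = some A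
  isProp o := ∃ A, I.extP o = some A
  cls c o := ∃ A, I.extC c = some A ∧ o ∈ A
  rel r o o' := ∃ A, I.extP r = some A ∧ (o, o') ∈ A
  den e := I.den (.iri e)

theorem Interp.wellFormed_toStruct (I : Interp Name D) : I.toStruct.WellFormed .owlThing where
  isInd_of_cls := fun ⟨A, hA, h⟩ => I.ind_of_extC _ A hA _ h
  isInd_of_rel := fun ⟨A, hA, h⟩ => I.ind_of_extP _ A hA _ h
  isCls_thing := ⟨_, I.den_thing⟩
  cls_thing := ⟨fun ⟨_, hA, h⟩ => by
    cases I.den_thing.symm.trans hA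
    exact h, fun h => ⟨_, I.den_thing, h⟩⟩

/-- Splits the partial extension function into a typing condition and a total relation, so that
satisfaction becomes `Struct.Sat`; the next lemmas do the same for class expressions. -/
theorem Interp.extP_eq_some_iff (I : Interp Name D) (R : RoleExp (IRI Name))
    (A : Set (I.Obj × I.Obj)) : I.extP (I.den R.toExp) = some A ↔
      I.toStruct.isProp (I.toStruct.den R.role) ∧ A = {p | I.toStruct.role R p.1 p.2} := by
  cases R with
  | dir r =>
    constructor
    · intro h
      refine ⟨⟨A, h⟩, Set.ext fun p => ⟨fun hp => ⟨A, h, hp⟩, ?_⟩⟩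
      rintro ⟨A', h', hp⟩
      cases h.symm.trans h'
      exact hp
    · rintro ⟨⟨A', h'⟩, rfl⟩
      refine h'.trans (congrArg some (Set.ext fun p => ⟨fun hp => ⟨A', h', hp⟩, ?_⟩))
      rintro ⟨A'', h'', hp⟩
      cases h'.symm.trans h''
      exact hp
  | inv r =>
    rw [RoleExp.toExp, I.den_inv]
    constructor
    · intro h
      obtain ⟨A', h', rfl⟩ := Option.map_eq_some_iff.1 h
      refine ⟨⟨A', h'⟩, Set.ext fun p => ⟨fun hp => ⟨A', h', hp⟩, ?_⟩⟩
      rintro ⟨A'', h'', hp⟩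
      cases h'.symm.trans h''
      exact hp
    · rintro ⟨⟨A', h'⟩, rfl⟩
      refine Option.map_eq_some_iff.2 ⟨A', h', Set.ext fun p => ⟨fun hp => ⟨A', h', hp⟩, ?_⟩⟩
      rintro ⟨A'', h'', hp⟩
      cases h'.symm.trans h''
      exact hp

theorem Interp.extC_iri_eq_some_iff (I : Interp Name D) (c : IRI Name) (A : Set I.Obj) :
    I.extC (I.den (.iri c)) = some A ↔
      I.toStruct.isCls (I.toStruct.den c) ∧ A = {o | I.toStruct.cls (I.toStruct.den c) o} := by
  constructor
  · intro h
    refine ⟨⟨A, h⟩, Set.ext fun p => ⟨fun hp => ⟨A, h, hp⟩, ?_⟩⟩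
    rintro ⟨A', h', hp⟩
    cases h.symm.trans h'
    exact hp
  · rintro ⟨⟨A', h'⟩, rfl⟩
    refine h'.trans (congrArg some (Set.ext fun p => ⟨fun hp => ⟨A', h', hp⟩, ?_⟩))
    rintro ⟨A'', h'', hp⟩
    cases h'.symm.trans h''
    exact hp

theorem Interp.extC_some_eq_some_iff (I : Interp Name D) (R : RoleExp (IRI Name)) (c : IRI Name)
    (A : Set I.Obj) : I.extC (I.den (.some R c)) = some A ↔
      I.toStruct.rightTyped (.ex R c) ∧ A = {o | I.toStruct.right (.ex R c) o} := by
  rw [I.den_some, Option.bind_eq_some_iff]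
  simp only [I.extP_eq_some_iff, Option.map_eq_some_iff, I.extC_iri_eq_some_iff]
  constructor
  · rintro ⟨_, ⟨hR, rfl⟩, _, ⟨hc, rfl⟩, rfl⟩
    exact ⟨⟨hR, hc⟩, rfl⟩
  · rintro ⟨⟨hR, hc⟩, rfl⟩
    exact ⟨_, ⟨hR, rfl⟩, _, ⟨hc, rfl⟩, rfl⟩

theorem Interp.extC_right_eq_some_iff (I : Interp Name D) (E : RightExp (IRI Name))
    (A : Set I.Obj) : I.extC (I.den E.toExp) = some A ↔
      I.toStruct.rightTyped E ∧ A = {o | I.toStruct.right E o} := by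
  cases E with
  | cls c => exact I.extC_iri_eq_some_iff c A
  | ex R c => exact I.extC_some_eq_some_iff R c A

theorem Interp.extC_left_eq_some_iff (I : Interp Name D) (B : LeftExp (IRI Name))
    (A : Set I.Obj) : I.extC (I.den B.toExp) = some A ↔
      I.toStruct.leftTyped B ∧ A = {o | I.toStruct.left B o} := by
  cases B with
  | cls c => exact I.extC_iri_eq_some_iff c A
  | ex R =>
    have hM := I.wellFormed_toStruct
    rw [LeftExp.toExp, I.extC_some_eq_some_iff]
    -- The filler `owl:Thing` imposes nothing, because the ends of an edge are individuals.
    have h : ∀ o, I.toStruct.right (.ex R .owlThing) o ↔ I.toStruct.left (.ex R) o := fun o =>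
      ⟨fun ⟨o', ho, _⟩ => ⟨o', ho⟩,
        fun ⟨o', ho⟩ => ⟨o', ho, hM.cls_thing.2 (hM.isInd_of_role ho).2⟩⟩
    simp only [h, Struct.rightTyped, hM.isCls_thing, and_true, Struct.leftTyped]

theorem Interp.sat_iff (I : Interp Name D) (α : QLAx (IRI Name)) :
    I.Sat α ↔ I.toStruct.Sat α := by
  have hdir : ∀ r A, I.extP (I.den (.iri r)) = some A ↔ _ := fun r => I.extP_eq_some_iff (.dir r)
  cases α with
  | sub B E =>
    simp only [Sat, extC_left_eq_some_iff, extC_right_eq_some_iff]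
    exact ⟨fun ⟨_, _, ⟨hB, h1⟩, ⟨hE, h2⟩, h⟩ => ⟨hB, hE, by subst h1 h2; exact h⟩,
      fun ⟨hB, hE, h⟩ => ⟨_, _, ⟨hB, rfl⟩, ⟨hE, rfl⟩, h⟩⟩
  | disj B B' =>
    simp only [Sat, extC_left_eq_some_iff]
    exact ⟨fun ⟨_, _, ⟨hB, h1⟩, ⟨hE, h2⟩, h⟩ => ⟨hB, hE, by
        subst h1 h2; exact fun o h1 h2 => Set.disjoint_left.1 h h1 h2⟩,
      fun ⟨hB, hE, h⟩ => ⟨_, _, ⟨hB, rfl⟩, ⟨hE, rfl⟩, Set.disjoint_left.2 h⟩⟩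
  | subRole r R =>
    simp only [Sat, hdir, extP_eq_some_iff]
    exact ⟨fun ⟨_, _, ⟨hB, h1⟩, ⟨hE, h2⟩, h⟩ => ⟨hB, hE, by
        subst h1 h2; exact fun o o' ho => @h (o, o') ho⟩,
      fun ⟨hB, hE, h⟩ => ⟨_, _, ⟨hB, rfl⟩, ⟨hE, rfl⟩, fun p hp => h p.1 p.2 hp⟩⟩
  | disjRole r R =>
    simp only [Sat, hdir, extP_eq_some_iff]
    exact ⟨fun ⟨_, _, ⟨hB, h1⟩, ⟨hE, h2⟩, h⟩ => ⟨hB, hE, by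
        subst h1 h2; exact fun o o' h1 h2 => Set.disjoint_left.1 h (show (o, o') ∈ _ from h1) h2⟩,
      fun ⟨hB, hE, h⟩ => ⟨_, _, ⟨hB, rfl⟩, ⟨hE, rfl⟩,
        Set.disjoint_left.2 fun {p} hp => h p.1 p.2 hp⟩⟩
  | refl r =>
    simp only [Sat, hdir]
    exact ⟨fun ⟨_, ⟨hB, h1⟩, h⟩ => ⟨hB, by subst h1; exact h⟩,
      fun ⟨hB, h⟩ => ⟨_, ⟨hB, rfl⟩, h⟩⟩
  | irrefl r =>
    simp only [Sat, hdir]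
    exact ⟨fun ⟨_, ⟨hB, h1⟩, h⟩ => ⟨hB, by subst h1; exact h⟩,
      fun ⟨hB, h⟩ => ⟨_, ⟨hB, rfl⟩, h⟩⟩
  | classAssert c x => exact ⟨fun ⟨A, hA, h⟩ => ⟨⟨A, hA⟩, A, hA, h⟩, fun ⟨_, h⟩ => h⟩
  | roleAssert r x y => exact ⟨fun ⟨A, hA, h⟩ => ⟨⟨A, hA⟩, A, hA, h⟩, fun ⟨_, h⟩ => h⟩
  | diff x y => exact Iff.rfl

/-! ### Consequences of saturation -/

/-- A left-hand side as a right-hand side. -/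
def LeftExp.toRight (thing : T) : LeftExp T → RightExp T
  | .cls c => .cls c
  | .ex R => .ex R thing

/-- `R ⊑ U` is derived. -/
def SubRole (S : Stmt T → Prop) (R U : RoleExp T) : Prop := S (.ax (.subRole R.role (R.orient U)))

/-- `R ⊑ ¬ U` is derived. -/
def DisjRole (S : Stmt T → Prop) (R U : RoleExp T) : Prop := S (.ax (.disjRole R.role (R.orient U)))

theorem SubRole.flip {S : Stmt T → Prop} {R U : RoleExp T} (h : SubRole S R U) :
    SubRole S R.flip U.flip := by
  cases R <;> cases U <;> exact h

theorem DisjRole.flip {S : Stmt T → Prop} {R U : RoleExp T} (h : DisjRole S R U) :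
    DisjRole S R.flip U.flip := by
  cases R <;> cases U <;> exact h

namespace Saturated

variable {thing : T} {S : Stmt T → Prop} (h : Saturated thing S)
include h

theorem typing_of_sub_left {B E} (hs : S (.ax (.sub B E))) : ∀ s ∈ B.typing, S s := by
  have h1 := h.cls_of _ hs
  have h2 := h.prop_of _ hs
  cases B <;> simp_all [QLAx.classArgs, QLAx.roleArgs, LeftExp.typing, LeftExp.classArgs,
    LeftExp.roleArgs]

theorem typing_of_disj_left {B B'} (hs : S (.ax (.disj B B'))) : ∀ s ∈ B.typing, S s := by
  have h1 := h.cls_of _ hs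
  have h2 := h.prop_of _ hs
  cases B <;> simp_all [QLAx.classArgs, QLAx.roleArgs, LeftExp.typing, LeftExp.classArgs,
    LeftExp.roleArgs]

theorem typing_of_sub_right {B E} (hs : S (.ax (.sub B E))) : ∀ s ∈ E.typing, S s := by
  have h1 := h.cls_of _ hs
  have h2 := h.prop_of _ hs
  cases E <;> simp_all [QLAx.classArgs, QLAx.roleArgs, RightExp.typing, RightExp.classArgs,
    RightExp.roleArgs]

omit h in
theorem prop_of_ex {R : RoleExp T} (hR : ∀ s ∈ (LeftExp.ex R).typing, S s) : S (.prop R.role) :=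
  hR _ (by simp [LeftExp.typing, LeftExp.roleArgs])

theorem sub_self {B : LeftExp T} (hB : ∀ s ∈ B.typing, S s) :
    S (.ax (.sub B (B.toRight thing))) := by
  cases B with
  | cls c => exact h.sub_cls_self c (hB _ (by simp [LeftExp.typing, LeftExp.classArgs]))
  | ex R => exact h.sub_ex_self R (prop_of_ex hB)

theorem sub_of_sub {B M : LeftExp T} {E} (h1 : S (.ax (.sub B (M.toRight thing))))
    (h2 : S (.ax (.sub M E))) : S (.ax (.sub B E)) := by
  cases M with
  | cls c => exact h.sub_trans _ _ _ h1 h2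
  | ex R => exact h.sub_ex_trans _ _ _ _ h1 h2

theorem disj_left {B M B' : LeftExp T} (h1 : S (.ax (.sub B (M.toRight thing))))
    (h2 : S (.ax (.disj M B'))) : S (.ax (.disj B B')) := by
  cases M with
  | cls c => exact h.disj_of_sub _ _ _ h1 h2
  | ex R => exact h.disj_of_sub_ex _ _ _ _ h1 h2

theorem disj_both {B M B' M' : LeftExp T} (h1 : S (.ax (.sub B (M.toRight thing))))
    (h1' : S (.ax (.sub B' (M'.toRight thing)))) (h2 : S (.ax (.disj M M'))) :
    S (.ax (.disj B B')) :=
  h.disj_symm _ _ (h.disj_left h1' (h.disj_symm _ _ (h.disj_left h1 h2)))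

theorem sub_ex_subRole {B : LeftExp T} {R U : RoleExp T} {c} (h1 : S (.ax (.sub B (.ex R c))))
    (h2 : SubRole S R U) : S (.ax (.sub B (.ex U c))) := by
  simpa using h.sub_ex_role B R (R.orient U) c h1 h2

theorem sub_ex_thing {B : LeftExp T} {R : RoleExp T} {c} (h1 : S (.ax (.sub B (.ex R c)))) :
    S (.ax (.sub B (.ex R thing))) := by
  refine h.sub_ex_mono B R c thing h1 (h.sub_thing _ fun s hs => h.typing_of_sub_right h1 s ?_)
  simp_all [LeftExp.typing, LeftExp.classArgs, RightExp.typing, RightExp.classArgs,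
    LeftExp.roleArgs]

theorem subRole_refl {R : RoleExp T} (hR : S (.prop R.role)) : SubRole S R R := by
  cases R <;> exact h.subRole_self _ hR

/-- The rules speak of inclusions whose left side is a plain property. Inverting both sides where
necessary, which is what `orient` records, turns them into composition of inclusions between
arbitrary roles. -/
theorem subRole_comp {P Q R : RoleExp T} (h1 : SubRole S P Q) (h2 : SubRole S Q R) :
    SubRole S P R := by
  have := h.subRole_trans P.role (P.orient Q) (Q.orient R) h1 (by rwa [RoleExp.role_orient])
  cases P <;> cases Q <;> cases R <;> exact this

theorem disjRole_left {P Q R : RoleExp T} (h1 : SubRole S P Q) (h2 : DisjRole S Q R) :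
    DisjRole S P R := by
  have := h.disjRole_of_subRole P.role (P.orient Q) (Q.orient R) h1 (by rwa [RoleExp.role_orient])
  cases P <;> cases Q <;> cases R <;> exact this

theorem disjRole_comm {P Q : RoleExp T} (h1 : DisjRole S P Q) : DisjRole S Q P := by
  cases P <;> cases Q <;>
  first
  | exact h.disjRole_symm _ _ h1
  | exact h.disjRole_symm_inv _ _ h1

theorem disjRole_both {P P' Q Q' : RoleExp T} (h1 : SubRole S P Q) (h2 : SubRole S P' Q')
    (h3 : DisjRole S Q Q') : DisjRole S P P' :=
  h.disjRole_comm (h.disjRole_left h2 (h.disjRole_comm (h.disjRole_left h1 h3)))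

omit h in
theorem disjRole_self {P : RoleExp T} (h1 : DisjRole S P P) :
    S (.ax (.disjRole P.role (.dir P.role))) := by
  cases P <;> exact h1

theorem disj_ex_of_disjRole_self {P : RoleExp T} (h1 : DisjRole S P P) :
    S (.ax (.disj (.ex P) (.ex P))) :=
  h.disj_ex P (disjRole_self h1)

/-- Two roles over one property are equal or converse to each other, so their disjointness makes the
property empty or asymmetric; either way it has no loops. -/
theorem irrefl_of_role_eq {P Q : RoleExp T} (hPQ : P.role = Q.role) (h1 : DisjRole S P Q) :
    S (.ax (.irrefl P.role)) := by
  cases P <;> cases Q <;> cases hPQ <;>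
  first
  | exact h.irrefl_of_empty _ h1
  | exact h.irrefl_of_asymm _ h1

theorem irrefl_of_refl {P Q : RoleExp T} (hQ : S (.ax (.refl Q.role))) (h1 : DisjRole S P Q) :
    S (.ax (.irrefl P.role)) :=
  h.irrefl_of_disjRole _ _ (by simpa using hQ) h1

theorem disjRole_of_disj_ex {P Q : RoleExp T} (h1 : S (.ax (.disj (.ex P) (.ex Q)))) :
    DisjRole S P Q := by
  cases P with
  | dir r => exact h.disjRole_of_domain _ _ h1
  | inv r => exact h.disjRole_of_range r Q.flip (by rwa [RoleExp.flip_flip])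

theorem disjRole_of_self {P Q : RoleExp T} (h1 : DisjRole S P P) (hQ : S (.prop Q.role)) :
    DisjRole S P Q :=
  h.disjRole_of_empty _ _ (disjRole_self h1) (by simpa using hQ)

end Saturated

/-! ### The canonical model -/

/-- The objects of the canonical model: the named individuals; at each level, a generic common
element of two left-hand sides; the two ends of a generic common edge of two roles; a generic loop
of a property; and objects that are the values of compound expressions. -/
inductive Elt (Name : Type u) : Type u
  | ind : IRI Name → Elt Name
  | pair : LeftExp (IRI Name) → LeftExp (IRI Name) → ℕ → Elt Name
  | src : RoleExp (IRI Name) → RoleExp (IRI Name) → Elt Name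
  | tgt : RoleExp (IRI Name) → RoleExp (IRI Name) → Elt Name
  | loop : IRI Name → Elt Name
  | comp : Exp Name → Elt Name

namespace Elt

variable (S : Stmt (IRI Name) → Prop)

/-- Levels orient the edges to witnesses: a witness lies one level above the element that needs it,
so such an edge is never a loop, nor the reverse of another one. -/
def level : Elt Name → ℕ
  | pair _ _ n => n
  | _ => 0

/-- The individuals of the canonical model. -/
def Alive : Elt Name → Prop
  | ind x => S (.ind x)
  | pair B B' _ => (∀ s ∈ B.typing, S s) ∧ (∀ s ∈ B'.typing, S s) ∧ ¬ S (.ax (.disj B B'))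
  | src R U => S (.prop R.role) ∧ S (.prop U.role) ∧ ¬ DisjRole S R U
  | tgt R U => S (.prop R.role) ∧ S (.prop U.role) ∧ ¬ DisjRole S R U
  | loop r => S (.prop r) ∧ ¬ S (.ax (.irrefl r))
  | comp _ => False

/-- The left-hand sides that generate the type of an element. -/
inductive Gen : Elt Name → LeftExp (IRI Name) → Prop
  | cls {c x} : S (.ax (.classAssert c x)) → Gen (ind x) (.cls c)
  | dom {r x y} : S (.ax (.roleAssert r x y)) → Gen (ind x) (.ex (.dir r))
  | ran {r x y} : S (.ax (.roleAssert r x y)) → Gen (ind y) (.ex (.inv r))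
  | pair_left {B B' n} : Gen (pair B B' n) B
  | pair_right {B B' n} : Gen (pair B B' n) B'
  | src_left {R U} : Gen (src R U) (.ex R)
  | src_right {R U} : Gen (src R U) (.ex U)
  | tgt_left {R U} : Gen (tgt R U) (.ex R.flip)
  | tgt_right {R U} : Gen (tgt R U) (.ex U.flip)
  | loop_dir {r} : Gen (loop r) (.ex (.dir r))
  | loop_inv {r} : Gen (loop r) (.ex (.inv r))

/-- The element belongs to a left-hand side. -/
def Has (o : Elt Name) (B : LeftExp (IRI Name)) : Prop :=
  ∃ B₀, Gen S o B₀ ∧ S (.ax (.sub B₀ (B.toRight .owlThing)))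

/-- The roles that generate the labels of an edge. -/
inductive Lab : Elt Name → Elt Name → RoleExp (IRI Name) → Prop
  | assert {o o' r x y} : o = ind x → o' = ind y → S (.ax (.roleAssert r x y)) → Lab o o' (.dir r)
  -- The witness of `∃ R . d` is a generic common element of `∃ R⁻` and `d`. Apart from `R` and `d`
  -- it depends only on the level, so elements of equal level with the same demand share it.
  | child {o o' B R d} : Gen S o B → S (.ax (.sub B (.ex R d))) →
      o' = pair (.ex R.flip) (.cls d) (o.level + 1) → Lab o o' R
  | edge_left {o o' R U} : o = src R U → o' = tgt R U → Lab o o' R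
  | edge_right {o o' R U} : o = src R U → o' = tgt R U → Lab o o' U
  | loop {o o' r} : o = loop r → o' = loop r → Lab o o' (.dir r)
  -- Named individuals are excluded: `refl_assert` derives their loops, so labels between named
  -- individuals all come from derived assertions.
  | refl {o o' r} : (∀ x, o ≠ ind x) → o' = o → S (.ax (.refl r)) → Lab o o' (.dir r)

def Label (o o' : Elt Name) (P : RoleExp (IRI Name)) : Prop := Lab S o o' P ∨ Lab S o' o P.flip

/-- Edges between individuals, labelled by all the roles to which they belong. -/
def Edge (o o' : Elt Name) (R : RoleExp (IRI Name)) : Prop :=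
  Alive S o ∧ Alive S o' ∧ ∃ P, Label S o o' P ∧ SubRole S P R

variable {S}

theorem Label.flip {o o' : Elt Name} {P} (hP : Label S o o' P) : Label S o' o P.flip :=
  hP.symm.imp_right fun h => by simpa using h

theorem Edge.flip {o o' : Elt Name} {R} (hR : Edge S o o' R) : Edge S o' o R.flip :=
  let ⟨ho, ho', P, hP, hR⟩ := hR
  ⟨ho', ho, P.flip, hP.flip, hR.flip⟩

/-! ### Types of elements and ends of edges -/

variable (h : Saturated .owlThing S)
include h

theorem typing_of_gen {o : Elt Name} {B} (ho : Alive S o) (hB : Gen S o B) :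
    ∀ s ∈ B.typing, S s := by
  have hp : ∀ R : RoleExp (IRI Name), S (.prop R.role) → ∀ s ∈ (LeftExp.ex R).typing, S s := by
    intro R hR
    simpa [LeftExp.typing, LeftExp.classArgs, LeftExp.roleArgs] using hR
  cases hB with
  | cls hx =>
    have := h.cls_of _ hx
    simpa [QLAx.classArgs, LeftExp.typing, LeftExp.classArgs, LeftExp.roleArgs] using this
  | dom hx => exact hp _ (h.prop_of _ hx _ (by simp [QLAx.roleArgs, RoleExp.role]))
  | ran hx => exact hp _ (h.prop_of _ hx _ (by simp [QLAx.roleArgs, RoleExp.role]))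
  | pair_left => exact ho.1
  | pair_right => exact ho.2.1
  | src_left => exact hp _ ho.1
  | src_right => exact hp _ ho.2.1
  | tgt_left => exact hp _ (by simpa using ho.1)
  | tgt_right => exact hp _ (by simpa using ho.2.1)
  | loop_dir => exact hp _ ho.1
  | loop_inv => exact hp _ ho.1

theorem exists_gen {o : Elt Name} (ho : Alive S o) : ∃ B, Gen S o B := by
  cases o with
  | ind x => exact ⟨_, .cls (h.thing_assert x ho)⟩
  | pair B B' n => exact ⟨_, .pair_left⟩
  | src R U => exact ⟨_, .src_left⟩
  | tgt R U => exact ⟨_, .tgt_left⟩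
  | loop r => exact ⟨_, .loop_dir⟩
  | comp e => exact ho.elim

theorem has_of_gen {o : Elt Name} {B} (ho : Alive S o) (hB : Gen S o B) : Has S o B :=
  ⟨B, hB, h.sub_self (typing_of_gen h ho hB)⟩

theorem has_thing {o : Elt Name} (ho : Alive S o) : Has S o (.cls .owlThing) :=
  let ⟨B, hB⟩ := exists_gen h ho
  ⟨B, hB, h.sub_thing B (typing_of_gen h ho hB)⟩

theorem has_ex_of_refl {o : Elt Name} (ho : Alive S o) {R : RoleExp (IRI Name)}
    (hR : S (.ax (.refl R.role))) : Has S o (.ex R) :=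
  let ⟨B, hB, hB'⟩ := has_thing h ho
  ⟨B, hB, h.sub_ex_refl B R _ hR hB'⟩

/-- A label is visible in the types of both ends; hence membership in `∃ R`, defined through
derivations, will agree with having an `R`-edge. -/
theorem Lab.has {o o' : Elt Name} {P} (ho : Alive S o) (ho' : Alive S o') (hP : Lab S o o' P) :
    Has S o (.ex P) ∧ Has S o' (.ex P.flip) := by
  cases hP with
  | assert hx hy hr =>
    subst hx hy
    exact ⟨has_of_gen h ho (.dom hr), has_of_gen h ho' (.ran hr)⟩
  | child hB hs hv =>
    subst hv
    exact ⟨⟨_, hB, h.sub_ex_thing hs⟩, has_of_gen h ho' .pair_left⟩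
  | edge_left hx hy =>
    subst hx hy
    exact ⟨has_of_gen h ho .src_left, has_of_gen h ho' .tgt_left⟩
  | edge_right hx hy =>
    subst hx hy
    exact ⟨has_of_gen h ho .src_right, has_of_gen h ho' .tgt_right⟩
  | loop hx hy =>
    subst hx hy
    exact ⟨has_of_gen h ho .loop_dir, has_of_gen h ho .loop_inv⟩
  | refl _ hx hr =>
    subst hx
    exact ⟨has_ex_of_refl h ho hr, has_ex_of_refl h ho hr⟩

theorem Label.has {o o' : Elt Name} {P} (ho : Alive S o) (ho' : Alive S o')
    (hP : Label S o o' P) : Has S o (.ex P) := by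
  rcases hP with hP | hP
  · exact (hP.has h ho ho').1
  · simpa using (hP.has h ho' ho).2

theorem Edge.has {o o' : Elt Name} {R} (hR : Edge S o o' R) : Has S o (.ex R) := by
  obtain ⟨ho, ho', P, hP, hR⟩ := hR
  obtain ⟨B, hB, hs⟩ := hP.has h ho ho'
  exact ⟨B, hB, h.sub_ex_subRole hs hR⟩

/-! ### Compatibility of types and labels -/

variable (hc : ¬ S .clash)
include hc

/-- The generators of the type of an element are compatible. -/
theorem not_disj_of_gen {o : Elt Name} {B B'} (ho : Alive S o) (hB : Gen S o B)
    (hB' : Gen S o B') : ¬ S (.ax (.disj B B')) := by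
  intro hd
  have hd' := h.disj_symm _ _ hd
  cases o with
  | ind x =>
    refine hc ?_
    cases hB with
    | cls h1 =>
      cases hB' with
      | cls h2 => exact h.clash_cls_cls _ _ _ h1 h2 hd
      | dom h2 => exact h.clash_cls_dir _ _ _ _ h1 h2 hd'
      | ran h2 => exact h.clash_cls_inv _ _ _ _ h1 h2 hd'
    | dom h1 =>
      cases hB' with
      | cls h2 => exact h.clash_cls_dir _ _ _ _ h2 h1 hd
      | dom h2 => exact h.clash_dir_dir _ _ _ _ _ h1 h2 hd
      | ran h2 => exact h.clash_dir_inv _ _ _ _ _ h1 h2 hd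
    | ran h1 =>
      cases hB' with
      | cls h2 => exact h.clash_cls_inv _ _ _ _ h2 h1 hd
      | dom h2 => exact h.clash_dir_inv _ _ _ _ _ h2 h1 hd'
      | ran h2 => exact h.clash_inv_inv _ _ _ _ _ h1 h2 hd
  -- A left-hand side disjoint from itself is empty, hence disjoint from the other one, whereas the
  -- pair exists only if the two are not disjoint.
  | pair B₁ B₂ n =>
    cases hB with
    | pair_left =>
      cases hB' with
      | pair_left => exact ho.2.2 (h.disj_of_empty _ _ hd ho.2.1)
      | pair_right => exact ho.2.2 hd
    | pair_right =>
      cases hB' with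
      | pair_left => exact ho.2.2 hd'
      | pair_right => exact ho.2.2 (h.disj_symm _ _ (h.disj_of_empty _ _ hd ho.1))
  -- Disjoint domains make the roles disjoint, and an empty role is disjoint from every other; both
  -- are excluded for a generic edge. The target end is symmetric, with converse roles.
  | src R U =>
    cases hB with
    | src_left =>
      cases hB' with
      | src_left => exact ho.2.2 (h.disjRole_of_self (h.disjRole_of_disj_ex hd) ho.2.1)
      | src_right => exact ho.2.2 (h.disjRole_of_disj_ex hd)
    | src_right =>
      cases hB' with
      | src_left => exact ho.2.2 (h.disjRole_of_disj_ex hd')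
      | src_right =>
        exact ho.2.2 (h.disjRole_comm (h.disjRole_of_self (h.disjRole_of_disj_ex hd) ho.1))
  | tgt R U =>
    have hf : ∀ {P Q : RoleExp (IRI Name)}, S (.ax (.disj (.ex P.flip) (.ex Q.flip))) →
        DisjRole S P Q := fun hd => by simpa using (h.disjRole_of_disj_ex hd).flip
    cases hB with
    | tgt_left =>
      cases hB' with
      | tgt_left => exact ho.2.2 (h.disjRole_of_self (hf hd) ho.2.1)
      | tgt_right => exact ho.2.2 (hf hd)
    | tgt_right =>
      cases hB' with
      | tgt_left => exact ho.2.2 (hf hd')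
      | tgt_right => exact ho.2.2 (h.disjRole_comm (h.disjRole_of_self (hf hd) ho.1))
  -- Both generators restrict the same property, so their disjointness would make it irreflexive.
  | loop r =>
    cases hB <;> cases hB' <;>
    · have hd := h.disjRole_of_disj_ex hd
      exact ho.2 (h.irrefl_of_role_eq (by rfl) hd)
  | comp e => exact ho

theorem Has.not_disj {o : Elt Name} {B B'} (ho : Alive S o) (hB : Has S o B)
    (hB' : Has S o B') : ¬ S (.ax (.disj B B')) := fun hd =>
  let ⟨_, h1, h2⟩ := hB
  let ⟨_, h1', h2'⟩ := hB'
  not_disj_of_gen h hc ho h1 h1' (h.disj_both h2 h2' hd)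

theorem not_disjRole_of_self {o o' : Elt Name} {P} (ho : Alive S o) (ho' : Alive S o')
    (hP : Label S o o' P) : ¬ DisjRole S P P := fun hd =>
  (hP.has h ho ho').not_disj h hc ho (hP.has h ho ho') (h.disj_ex_of_disjRole_self hd)

/-- A property both reflexive and irreflexive leaves no individuals at all, but `o` is one. -/
theorem not_irrefl_of_refl {o : Elt Name} {r} (ho : Alive S o) (hr : S (.ax (.refl r))) :
    ¬ S (.ax (.irrefl r)) := fun hi =>
  (has_thing h ho).not_disj h hc ho (has_thing h ho) (h.thing_empty _ hr hi)

/-- No loop belongs to an irreflexive property. -/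
theorem Lab.not_irrefl {o : Elt Name} {P} (ho : Alive S o) (hP : Lab S o o P) :
    ¬ S (.ax (.irrefl P.role)) := by
  intro hi
  cases hP with
  | assert hx hy hr =>
    cases hx.symm.trans hy
    exact hc (h.clash_irrefl _ _ hi hr)
  -- The witness would have to lie one level above itself.
  | child hB hs hv => simpa [level] using congrArg level hv
  | edge_left hx hy => cases hx.symm.trans hy
  | edge_right hx hy => cases hx.symm.trans hy
  | loop hx _ =>
    subst hx
    exact ho.2 hi
  | refl _ hx hr => exact not_irrefl_of_refl h hc ho hr hi

theorem Label.not_irrefl {o : Elt Name} {P} (ho : Alive S o) (hP : Label S o o P) :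
    ¬ S (.ax (.irrefl P.role)) := by
  rcases hP with hP | hP
  · exact hP.not_irrefl h hc ho
  · simpa using hP.not_irrefl h hc ho

omit h hc in
theorem Lab.self_cases {o : Elt Name} {P} (ho : ∀ x, o ≠ ind x) (hP : Lab S o o P) :
    S (.ax (.refl P.role)) ∨ o = Elt.loop P.role := by
  cases hP with
  | assert hx hy hr => exact absurd hx (ho _)
  | child hB hs hv => simpa [level] using congrArg level hv
  | edge_left hx hy => cases hx.symm.trans hy
  | edge_right hx hy => cases hx.symm.trans hy
  | loop hx _ => exact .inr hx
  | refl _ hx hr => exact .inl hr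

/-- Away from named individuals, a loop label is a role over a derived reflexive property or over
the property of a generic loop. If one label is over a reflexive property, disjointness makes the
other irreflexive; otherwise both are over the same property, which becomes irreflexive. No loop
carries an irreflexive label. -/
theorem Label.self_not_disjRole {o : Elt Name} {P Q} (ho : Alive S o) (hx : ∀ x, o ≠ ind x)
    (hP : Label S o o P) (hQ : Label S o o Q) : ¬ DisjRole S P Q := by
  intro hd
  have key : ∀ {P}, Label S o o P → S (.ax (.refl P.role)) ∨ o = Elt.loop P.role := by
    rintro P (hP | hP)
    · exact hP.self_cases hx
    · simpa using hP.self_cases hx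
  have hiP := hP.not_irrefl h hc ho
  have hiQ := hQ.not_irrefl h hc ho
  rcases key hQ with hq | hq
  · exact hiP (h.irrefl_of_refl hq hd)
  · rcases key hP with hp | hp
    · exact hiQ (h.irrefl_of_refl hp (h.disjRole_comm hd))
    · exact hiP (h.irrefl_of_role_eq (loop.inj (hp.symm.trans hq)) hd)

omit h hc in
-- Levels strictly increase towards witnesses and generic edges run only from source to target, so
-- labels in opposite directions meet only between named individuals or on loops.
theorem Lab.reverse_cases {o o' : Elt Name} {P Q} (hP : Lab S o o' P) (hQ : Lab S o' o Q) :
    (∃ x y, o = ind x ∧ o' = ind y) ∨ o' = o := by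
  cases hP with
  | assert hx hy _ => exact .inl ⟨_, _, hx, hy⟩
  | child _ _ hv =>
    subst hv
    cases hQ with
    | assert hx => cases hx
    | child _ _ hv =>
      have := congrArg level hv
      simp only [level] at this
      omega
    | edge_left hx => cases hx
    | edge_right hx => cases hx
    | loop hx => cases hx
    | refl _ hv _ => exact .inr hv.symm
  | edge_left hx hy =>
    subst hx hy
    cases hQ with
    | assert hx => cases hx
    | child _ _ hv => cases hv
    | edge_left hx => cases hx
    | edge_right hx => cases hx
    | loop hx => cases hx
    | refl _ hv _ => cases hv
  | edge_right hx hy =>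
    subst hx hy
    cases hQ with
    | assert hx => cases hx
    | child _ _ hv => cases hv
    | edge_left hx => cases hx
    | edge_right hx => cases hx
    | loop hx => cases hx
    | refl _ hv _ => cases hv
  | loop hx hy => exact .inr (hy.trans hx.symm)
  | refl _ hv _ => exact .inr hv

omit h hc in
-- A witness records the role for which it was made, so the label leading to it is determined by the
-- target. Apart from named individuals and loops, only a generic edge can carry two different
-- labels.
theorem Lab.same_cases {o o' : Elt Name} {P Q} (hP : Lab S o o' P) (hQ : Lab S o o' Q) :
    (∃ x y, o = ind x ∧ o' = ind y) ∨ o' = o ∨ P = Q ∨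
      ∃ R U, o = src R U ∧ (P = R ∨ P = U) ∧ (Q = R ∨ Q = U) := by
  cases hP with
  | assert hx hy _ => exact .inl ⟨_, _, hx, hy⟩
  | child _ _ hv =>
    cases hQ with
    | assert _ hx => cases hv.symm.trans hx
    | child _ _ hv' =>
      have := hv.symm.trans hv'
      simp only [pair.injEq, LeftExp.ex.injEq] at this
      exact .inr (.inr (.inl (RoleExp.flip_injective this.1)))
    | edge_left _ hx => cases hv.symm.trans hx
    | edge_right _ hx => cases hv.symm.trans hx
    | loop _ hx => cases hv.symm.trans hx
    | refl _ hv _ => exact .inr (.inl hv)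
  | edge_left hx hy =>
    cases hQ with
    | assert _ hx => cases hy.symm.trans hx
    | child _ _ hv => cases hy.symm.trans hv
    | edge_left hx' => cases hx.symm.trans hx'; exact .inr (.inr (.inl rfl))
    | edge_right hx' =>
      cases hx.symm.trans hx'
      exact .inr (.inr (.inr ⟨_, _, hx, .inl rfl, .inr rfl⟩))
    | loop _ hx => cases hy.symm.trans hx
    | refl _ hv _ => exact .inr (.inl hv)
  | edge_right hx hy =>
    cases hQ with
    | assert _ hx => cases hy.symm.trans hx
    | child _ _ hv => cases hy.symm.trans hv
    | edge_left hx' =>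
      cases hx.symm.trans hx'
      exact .inr (.inr (.inr ⟨_, _, hx, .inr rfl, .inl rfl⟩))
    | edge_right hx' => cases hx.symm.trans hx'; exact .inr (.inr (.inl rfl))
    | loop _ hx => cases hy.symm.trans hx
    | refl _ hv _ => exact .inr (.inl hv)
  | loop hx hy => exact .inr (.inl (hy.trans hx.symm))
  | refl _ hv _ => exact .inr (.inl hv)

omit h hc in
theorem Label.ind_cases {x y : IRI Name} {P} (hP : Label S (ind x) (ind y) P) :
    (∃ r, P = .dir r ∧ S (.ax (.roleAssert r x y))) ∨
      ∃ r, P = .inv r ∧ S (.ax (.roleAssert r y x)) := by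
  have key : ∀ {x y P}, Lab S (ind x) (ind y) P → ∃ r, P = .dir r ∧ S (.ax (.roleAssert r x y)) := by
    intro x y P hP
    cases hP with
    | assert hx hy hr =>
      cases hx
      cases hy
      exact ⟨_, rfl, hr⟩
    | child _ _ hv => cases hv
    | edge_left hx => cases hx
    | edge_right hx => cases hx
    | loop hx => cases hx
    | refl hx => exact absurd rfl (hx _)
  rcases hP with hP | hP
  · exact .inl (key hP)
  · obtain ⟨r, hr, hP⟩ := key hP
    refine .inr ⟨r, ?_, hP⟩
    rw [← P.flip_flip, hr]
    rfl

theorem Label.ind_not_disjRole {x y : IRI Name} {P Q} (hP : Label S (ind x) (ind y) P)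
    (hQ : Label S (ind x) (ind y) Q) : ¬ DisjRole S P Q := by
  intro hd
  refine hc ?_
  rcases hP.ind_cases with ⟨r, rfl, hr⟩ | ⟨r, rfl, hr⟩ <;>
  rcases hQ.ind_cases with ⟨s, rfl, hs⟩ | ⟨s, rfl, hs⟩
  · exact h.clash_role _ _ _ _ hr hs hd
  · exact h.clash_role_inv _ _ _ _ hr hs hd
  · exact h.clash_role_inv _ _ _ _ hr hs hd
  · exact h.clash_role _ _ _ _ hr hs hd

/-- The labels of an edge are compatible. -/
theorem Label.not_disjRole {o o' : Elt Name} {P Q} (ho : Alive S o) (ho' : Alive S o')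
    (hP : Label S o o' P) (hQ : Label S o o' Q) : ¬ DisjRole S P Q := by
  intro hd
  have hself : o' ≠ o := by
    rintro rfl
    by_cases hx : ∃ x, o' = ind x
    · obtain ⟨x, rfl⟩ := hx
      exact hP.ind_not_disjRole h hc hQ hd
    · exact hP.self_not_disjRole h hc ho (not_exists.1 hx) hQ hd
  have hind : ¬ ∃ x y, o = ind x ∧ o' = ind y := by
    rintro ⟨x, y, rfl, rfl⟩
    exact hP.ind_not_disjRole h hc hQ hd
  have hsrc : ∀ {R U P Q}, Alive S (src R U) → (P = R ∨ P = U) → (Q = R ∨ Q = U) →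
      DisjRole S P Q → P ≠ Q → False := by
    rintro R U P Q ho (rfl | rfl) (rfl | rfl) hd hPQ
    · exact hPQ rfl
    · exact ho.2.2 hd
    · exact ho.2.2 (h.disjRole_comm hd)
    · exact hPQ rfl
  have hPQ : P ≠ Q := by
    rintro rfl
    exact not_disjRole_of_self h hc ho ho' hP hd
  -- Equal orientations fall under `Lab.same_cases`, opposite ones under `Lab.reverse_cases`; what
  -- is left after the exclusions above is a generic edge, whose two roles are not disjoint.
  rcases hP with hP | hP <;> rcases hQ with hQ | hQ
  · rcases hP.same_cases hQ with h1 | h1 | h1 | ⟨R, U, rfl, h1, h2⟩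
    · exact hind h1
    · exact hself h1
    · exact hPQ h1
    · exact hsrc ho h1 h2 hd hPQ
  · exact (hP.reverse_cases hQ).elim hind hself
  · exact (hQ.reverse_cases hP).elim hind hself
  · rcases hP.same_cases hQ with ⟨x, y, h1, h2⟩ | h1 | h1 | ⟨R, U, rfl, h1, h2⟩
    · exact hind ⟨y, x, h2, h1⟩
    · exact hself h1.symm
    · exact hPQ (RoleExp.flip_injective h1)
    · exact hsrc ho' h1 h2 hd.flip fun h1 => hPQ (RoleExp.flip_injective h1)

/-- Every existential restriction in the type of an individual has a witness. -/
theorem exists_edge {o : Elt Name} {B R d} (ho : Alive S o) (hB : Gen S o B)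
    (hs : S (.ax (.sub B (.ex R d)))) :
    ∃ o', Edge S o o' R ∧ Has S o' (.cls d) := by
  have hR : ∀ s ∈ (LeftExp.ex R.flip).typing, S s := by
    have := h.typing_of_sub_right hs
    simp_all [LeftExp.typing, LeftExp.classArgs, LeftExp.roleArgs, RightExp.typing,
      RightExp.classArgs, RightExp.roleArgs]
  have hd : ∀ s ∈ (LeftExp.cls d).typing, S s := by
    have := h.typing_of_sub_right hs
    simp_all [LeftExp.typing, LeftExp.classArgs, LeftExp.roleArgs, RightExp.typing,
      RightExp.classArgs, RightExp.roleArgs]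
  -- Were `∃ R⁻` and `d` disjoint, `B` would be disjoint from itself, although it generates the type
  -- of an individual.
  have ho' : Alive S (pair (.ex R.flip) (.cls d) (o.level + 1)) :=
    ⟨hR, hd, fun hdisj => not_disj_of_gen h hc ho hB hB (h.disj_of_ex _ _ _ hs hdisj)⟩
  have hp : S (.prop R.role) := by simpa using Saturated.prop_of_ex hR
  exact ⟨_, ⟨ho, ho', R, .inl (.child hB hs rfl), h.subRole_refl hp⟩,
    has_of_gen h ho' .pair_right⟩

end Elt

open Elt

/-- The canonical model of a saturated set of statements. The compound expressions denote objects
of their own, whose extensions are those that result when `e` denotes `ind (ρ e)`. -/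
def canon (S : Stmt (IRI Name) → Prop) (ρ : IRI Name → IRI Name) : Struct (IRI Name) where
  Obj := Elt Name
  isInd := Alive S
  isCls
    | ind c => S (.cls c)
    | comp (.some R c) => S (.prop (ρ R.role)) ∧ S (.cls (ρ c))
    | _ => False
  isProp
    | ind r => S (.prop r)
    | comp (.inv r) => S (.prop (ρ r))
    | _ => False
  cls
    | ind c, o => Alive S o ∧ Has S o (.cls c)
    | comp (.some R c), o => ∃ o', Edge S o o' (R.map ρ) ∧ Has S o' (.cls (ρ c))
    | _, _ => False
  rel
    | ind r, o, o' => Edge S o o' (.dir r)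
    | comp (.inv r), o, o' => Edge S o' o (.dir (ρ r))
    | _, _, _ => False
  den := ind

/-! ### Truth in the canonical model -/

section Canon

variable {S : Stmt (IRI Name) → Prop} {ρ : IRI Name → IRI Name}

theorem canon_role {R : RoleExp (IRI Name)} {o o' : Elt Name} :
    (canon S ρ).role R o o' ↔ Edge S o o' R := by
  cases R with
  | dir r => exact Iff.rfl
  | inv r => exact ⟨fun h => h.flip, fun h => h.flip⟩

theorem canon_leftTyped {B : LeftExp (IRI Name)} :
    (canon S ρ).leftTyped B ↔ ∀ s ∈ B.typing, S s := by
  cases B <;> simp [Struct.leftTyped, canon, LeftExp.typing, LeftExp.classArgs, LeftExp.roleArgs]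

theorem canon_rightTyped {E : RightExp (IRI Name)} :
    (canon S ρ).rightTyped E ↔ ∀ s ∈ E.typing, S s := by
  cases E <;> simp [Struct.rightTyped, canon, RightExp.typing, RightExp.classArgs,
    RightExp.roleArgs, and_comm]

variable (h : Saturated .owlThing S)
include h

theorem canon_wellFormed : (canon S ρ).WellFormed .owlThing where
  isInd_of_cls {c o} hc := by
    rcases c with _ | _ | _ | _ | _ | (_ | _ | _)
    case ind => exact hc.1
    case comp.some =>
      obtain ⟨_, hR, _⟩ := hc
      exact hR.1
    all_goals exact hc.elim
  isInd_of_rel {r o o'} hr := by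
    rcases r with _ | _ | _ | _ | _ | (_ | _ | _)
    case ind => exact ⟨hr.1, hr.2.1⟩
    case comp.inv => exact ⟨hr.2.1, hr.1⟩
    all_goals exact hr.elim
  isCls_thing := h.cls_thing
  cls_thing := ⟨fun ho => ho.1, fun ho => ⟨ho, has_thing h ho⟩⟩

variable (hc : ¬ S .clash)
include hc

/-- The truth lemma for left-hand sides: edges show up in the types of their ends, and every
existential in a type has a witness. -/
theorem canon_left {B : LeftExp (IRI Name)} {o : Elt Name} :
    (canon S ρ).left B o ↔ Alive S o ∧ Has S o B := by
  cases B with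
  | cls c => exact Iff.rfl
  | ex R =>
    constructor
    · rintro ⟨o', ho'⟩
      have hE := canon_role.1 ho'
      exact ⟨hE.1, hE.has h⟩
    · rintro ⟨ho, B, hB, hs⟩
      obtain ⟨o', hE, -⟩ := exists_edge h hc ho hB hs
      exact ⟨o', canon_role.2 hE⟩

/-- The canonical model satisfies the derived axioms. -/
theorem canon_sat {α : QLAx (IRI Name)} (hα : S (.ax α)) : (canon S ρ).Sat α := by
  have hcls := h.cls_of _ hα
  have hprop := h.prop_of _ hα
  have hind := h.ind_of _ hα
  cases α with
  | sub B E =>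
    refine ⟨(canon_leftTyped).2 (h.typing_of_sub_left hα),
      (canon_rightTyped).2 (h.typing_of_sub_right hα), fun o ho => ?_⟩
    obtain ⟨ho, B₀, hB, hs⟩ := (canon_left h hc).1 ho
    have hsE := h.sub_of_sub hs hα
    cases E with
    | cls c => exact ⟨ho, B₀, hB, hsE⟩
    | ex R c =>
      obtain ⟨o', hE, ho'⟩ := exists_edge h hc ho hB hsE
      exact ⟨o', canon_role.2 hE, hE.2.1, ho'⟩
  | disj B B' =>
    refine ⟨(canon_leftTyped).2 (h.typing_of_disj_left hα),
      (canon_leftTyped).2 (h.typing_of_disj_left (h.disj_symm _ _ hα)), fun o ho ho' => ?_⟩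
    replace ho := (canon_left h hc).1 ho
    replace ho' := (canon_left h hc).1 ho'
    exact ho.2.not_disj h hc ho.1 ho'.2 hα
  | subRole r R =>
    refine ⟨hprop r (by simp [QLAx.roleArgs]), hprop R.role (by simp [QLAx.roleArgs]), ?_⟩
    rintro o o' ⟨ho, ho', P, hP, hs⟩
    exact canon_role.2 ⟨ho, ho', P, hP, h.subRole_comp hs (Q := .dir r) hα⟩
  | disjRole r R =>
    refine ⟨hprop r (by simp [QLAx.roleArgs]), hprop R.role (by simp [QLAx.roleArgs]), ?_⟩
    rintro o o' ⟨ho, ho', P, hP, hs⟩ hR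
    obtain ⟨-, -, Q, hQ, hs'⟩ := canon_role.1 hR
    exact hP.not_disjRole h hc ho ho' hQ (h.disjRole_both (Q := .dir r) hs hs' hα)
  | refl r =>
    have hr := hprop r (by simp [QLAx.roleArgs])
    refine ⟨hr, fun o ho => ⟨ho, ho, .dir r, ?_, h.subRole_refl hr⟩⟩
    -- At a named individual the loop comes from a derived assertion, elsewhere from the generating
    -- label `refl`.
    by_cases hx : ∃ x, o = ind x
    · obtain ⟨x, rfl⟩ := hx
      exact .inl (.assert rfl rfl (h.refl_assert _ _ hα ho))
    · exact .inl (.refl (not_exists.1 hx) rfl hα)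
  | irrefl r =>
    refine ⟨hprop r (by simp [QLAx.roleArgs]), ?_⟩
    rintro o ho ⟨-, -, P, hP, hs⟩
    exact hP.not_irrefl h hc ho (h.irrefl_of_subRole _ _ hs (by simpa using hα))
  | classAssert c x =>
    exact ⟨hcls c (by simp [QLAx.classArgs]), hind x (by simp [QLAx.indArgs]),
      has_of_gen h (hind x (by simp [QLAx.indArgs])) (.cls hα)⟩
  | roleAssert r x y =>
    have hr := hprop r (by simp [QLAx.roleArgs])
    exact ⟨hr, hind x (by simp [QLAx.indArgs]), hind y (by simp [QLAx.indArgs]), .dir r,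
      .inl (.assert rfl rfl hα), h.subRole_refl hr⟩
  | diff x y =>
    refine ⟨hind x (by simp [QLAx.indArgs]), hind y (by simp [QLAx.indArgs]), fun hxy => ?_⟩
    cases hxy
    exact hc (h.clash_diff _ hα)

omit hc in
theorem classAssert_of_has {x c} (hx : Has S (ind x) (.cls c)) : S (.ax (.classAssert c x)) := by
  obtain ⟨B, hB, hs⟩ := hx
  cases hB with
  | cls h1 => exact h.classAssert_of_sub _ _ _ h1 hs
  | dom h1 => exact h.classAssert_of_domain _ _ _ _ h1 hs
  | ran h1 => exact h.classAssert_of_range _ _ _ _ h1 hs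

omit hc in
theorem roleAssert_of_edge {x y r} (hr : Edge S (ind x) (ind y) (.dir r)) :
    S (.ax (.roleAssert r x y)) := by
  obtain ⟨-, -, P, hP, hs⟩ := hr
  rcases hP.ind_cases with ⟨s, rfl, h1⟩ | ⟨s, rfl, h1⟩
  · exact h.roleAssert_of_subRole _ _ _ _ h1 hs
  · exact h.roleAssert_of_subRole_inv _ _ _ _ h1 hs

omit h hc in
-- At level zero a pair is nobody's witness, so its only neighbours are itself, through reflexive
-- properties, and its own witnesses. This is why refutations use level zero.
theorem Elt.Label.pair_zero {B B'} {o : Elt Name} {P} (hP : Label S (pair B B' 0) o P) :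
    (o = pair B B' 0 ∧ S (.ax (.refl P.role))) ∨
      ∃ B₀ d, Gen S (pair B B' 0) B₀ ∧ S (.ax (.sub B₀ (.ex P d))) ∧
        o = pair (.ex P.flip) (.cls d) 1 := by
  rcases hP with hP | hP
  · cases hP with
    | assert hx => cases hx
    | child hB hs hv => exact .inr ⟨_, _, hB, hs, hv⟩
    | edge_left hx => cases hx
    | edge_right hx => cases hx
    | loop hx => cases hx
    | refl _ hv hr => exact .inl ⟨hv, hr⟩
  · generalize hQ : P.flip = Q at hP
    have hrole : Q.role = P.role := by rw [← hQ, RoleExp.role_flip]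
    rw [← hrole]
    cases hP with
    | assert _ hx => cases hx
    | child hB hs hv => simp at hv
    | edge_left _ hx => cases hx
    | edge_right _ hx => cases hx
    | loop _ hx => cases hx
    | refl _ hv hr => exact .inl ⟨hv.symm, hr⟩

omit h hc in
theorem Elt.Label.src_tgt {R U P : RoleExp (IRI Name)} (hP : Label S (src R U) (tgt R U) P) :
    P = R ∨ P = U := by
  rcases hP with hP | hP
  · cases hP with
    | assert hx => cases hx
    | child hB hs hv => cases hv
    | edge_left hx => cases hx; exact .inl rfl
    | edge_right hx => cases hx; exact .inr rfl
    | loop hx => cases hx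
    | refl _ hv hr => cases hv
  · generalize P.flip = Q at hP
    cases hP with
    | assert hx => cases hx
    | child hB hs hv => cases hv
    | edge_left hx => cases hx
    | edge_right hx => cases hx
    | loop hx => cases hx
    | refl _ hv hr => cases hv

/-- The canonical model refutes the axioms that are not derived, inequalities excepted. -/
theorem mem_of_canon_sat {α : QLAx (IRI Name)} (hα : (canon S ρ).Sat α)
    (hdiff : ∀ x y, α ≠ .diff x y) : S (.ax α) := by
  cases α with
  | sub B E =>
    obtain ⟨hB, hE, hsub⟩ := hα
    rw [canon_leftTyped] at hB
    rw [canon_rightTyped] at hE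
    -- An empty left-hand side is included in everything well typed; otherwise its generic element
    -- exists, with `B` as its only generator.
    by_cases hd : S (.ax (.disj B B))
    · exact h.sub_of_empty _ _ hd hE
    have ho : Alive S (pair B B 0) := ⟨hB, hB, hd⟩
    have hgen : ∀ {B'}, Gen S (pair B B 0) B' → B' = B := by
      intro B' hB'
      cases hB' <;> rfl
    have hr := hsub _ ((canon_left h hc).2 ⟨ho, has_of_gen h ho .pair_left⟩)
    cases E with
    | cls c =>
      obtain ⟨-, B₀, hB₀, hs⟩ := hr
      cases hgen hB₀
      exact hs
    | ex R d =>
      obtain ⟨o', hR, -, B', hB', hs'⟩ := hr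
      obtain ⟨-, ho', P, hP, hs⟩ := canon_role.1 hR
      -- The successor is the element itself, by reflexivity, or a witness made for some `∃ P . e`.
      -- In the second case `d` follows from one of the two generators of the witness: from the
      -- range of `P` or from the filler `e`.
      rcases hP.pair_zero with ⟨rfl, hr⟩ | ⟨B₀, e, hB₀, hs₀, rfl⟩
      · cases hgen hB'
        refine h.sub_ex_refl _ _ _ ?_ hs'
        simpa using h.refl_of_subRole _ _ hr hs
      · cases hgen hB₀
        refine h.sub_ex_subRole ?_ hs
        cases hB' with
        | pair_left => exact h.sub_ex_range _ _ _ _ hs₀ hs'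
        | pair_right => exact h.sub_ex_mono _ _ _ _ hs₀ hs'
  | disj B B' =>
    obtain ⟨hB, hB', hdisj⟩ := hα
    rw [canon_leftTyped] at hB hB'
    by_contra hd
    have ho : Alive S (pair B B' 0) := ⟨hB, hB', hd⟩
    exact hdisj _ ((canon_left h hc).2 ⟨ho, has_of_gen h ho .pair_left⟩)
      ((canon_left h hc).2 ⟨ho, has_of_gen h ho .pair_right⟩)
  | subRole r R =>
    obtain ⟨hr, hR, hsub⟩ := hα
    by_cases hd : S (.ax (.disjRole r (.dir r)))
    · exact h.subRole_of_empty _ _ hd hR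
    -- The generic edge of `r` alone: its only label is `r`, so any role containing it includes `r`
    -- by derivation.
    have ho : Alive S (src (.dir r) (.dir r)) := ⟨hr, hr, hd⟩
    have ho' : Alive S (tgt (.dir r) (.dir r)) := ⟨hr, hr, hd⟩
    have hE := canon_role.1 (hsub (src (.dir r) (.dir r)) (tgt (.dir r) (.dir r))
      ⟨ho, ho', .dir r, .inl (.edge_left rfl rfl), h.subRole_refl hr⟩)
    obtain ⟨-, -, P, hP, hs⟩ := hE
    obtain rfl | rfl := hP.src_tgt <;> exact hs
  | disjRole r R =>
    obtain ⟨hr, hR, hdisj⟩ := hα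
    by_contra hd
    have ho : Alive S (src (.dir r) R) := ⟨hr, hR, hd⟩
    have ho' : Alive S (tgt (.dir r) R) := ⟨hr, hR, hd⟩
    exact hdisj (src (.dir r) R) (tgt (.dir r) R)
      ⟨ho, ho', .dir r, .inl (.edge_left rfl rfl), h.subRole_refl hr⟩
      (canon_role.2 ⟨ho, ho', R, .inl (.edge_right rfl rfl), h.subRole_refl hR⟩)
  | refl r =>
    obtain ⟨hr, hrefl⟩ := hα
    by_cases hd : S (.ax (.disj (.cls .owlThing) (.cls .owlThing)))
    · exact h.refl_of_thing_empty _ hd hr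
    have ht : ∀ s ∈ (LeftExp.cls (.owlThing : IRI Name)).typing, S s := by
      simpa [LeftExp.typing, LeftExp.classArgs, LeftExp.roleArgs] using h.cls_thing
    -- The generic individual knows only that it is an individual; a loop at it must come from a
    -- derived reflexivity, its witnesses lying one level higher.
    obtain ⟨-, -, P, hP, hs⟩ := hrefl (pair (.cls .owlThing) (.cls .owlThing) 0) ⟨ht, ht, hd⟩
    rcases hP.pair_zero with ⟨-, hr⟩ | ⟨B₀, e, hB₀, hs₀, hv⟩
    · simpa using h.refl_of_subRole _ _ hr hs
    · simp at hv
  | irrefl r =>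
    obtain ⟨hr, hirr⟩ := hα
    by_contra hi
    have ho : Alive S (loop r) := ⟨hr, hi⟩
    exact hirr (loop r) ho ⟨ho, ho, .dir r, .inl (.loop rfl rfl), h.subRole_refl hr⟩
  | classAssert c x => exact classAssert_of_has h hα.2.2
  | roleAssert r x y => exact roleAssert_of_edge h hα.2
  | diff x y => exact absurd rfl (hdiff x y)

end Canon

/-! ### From structures to interpretations -/

open Classical in
/-- The interpretation given by a structure over expressions. -/
noncomputable def Interp.ofStruct (D : DatatypeMap.{v}) (M : Struct (Exp Name))
    (hM : M.WellFormed (.iri .owlThing))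
    (hprop : ∀ r, M.isProp (M.den (.inv r)) ↔ M.isProp (M.den (.iri r)))
    (hrel : ∀ r o o', M.rel (M.den (.inv r)) o o' ↔ M.rel (M.den (.iri r)) o' o)
    (hcls : ∀ R c, M.isCls (M.den (.some R c)) ↔
      M.isProp (M.den R.toExp) ∧ M.isCls (M.den (.iri c)))
    (hmem : ∀ R c o, M.cls (M.den (.some R c)) o ↔
      ∃ o', M.rel (M.den R.toExp) o o' ∧ M.cls (M.den (.iri c)) o') : Interp Name D where
  Obj := M.Obj
  nonempty := ⟨M.den (.iri .owlThing)⟩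
  isInd := M.isInd
  extC c := if M.isCls c then some {o | M.cls c o} else none
  extP r := if M.isProp r then some {p | M.rel r p.1 p.2} else none
  -- Giving every object an empty data property extension makes `ind_of_none` vacuous, so objects
  -- outside the intended individuals are not forced to be individuals.
  extD _ := some ∅
  extT _ := none
  den := M.den
  ind_of_none := by simp
  ind_of_extC c A hA a ha := by
    cases (Option.ite_none_right_eq_some.1 hA).2
    exact hM.isInd_of_cls ha
  ind_of_extP r A hA p hp := by
    cases (Option.ite_none_right_eq_some.1 hA).2
    exact hM.isInd_of_rel hp
  ind_of_extD o A hA p hp := by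
    cases hA
    exact hp.elim
  den_thing := by
    rw [if_pos hM.isCls_thing]
    exact congrArg some (Set.ext fun o => hM.cls_thing)
  den_inv r := by
    by_cases h : M.isProp (M.den (.iri r))
    · rw [if_pos h, if_pos ((hprop r).2 h)]
      exact congrArg some (Set.ext fun p => hrel r p.1 p.2)
    · rw [if_neg h, if_neg (mt (hprop r).1 h)]
      rfl
  den_some R c := by
    by_cases h : M.isProp (M.den R.toExp)
    · by_cases h' : M.isCls (M.den (.iri c))
      · rw [if_pos h, if_pos h', if_pos ((hcls R c).2 ⟨h, h'⟩)]
        exact congrArg some (Set.ext fun o => hmem R c o)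
      · rw [if_pos h, if_neg h', if_neg fun h1 => h' ((hcls R c).1 h1).2]
        rfl
    · rw [if_neg h, if_neg fun h1 => h ((hcls R c).1 h1).1]
      rfl

/-! ### The canonical interpretation -/

section Model

variable {S : Stmt (IRI Name) → Prop} {ρ : IRI Name → IRI Name}

/-- Denotation of expressions in the canonical model. -/
def canonDen (ρ : IRI Name → IRI Name) : Exp Name → Elt Name
  | .iri e => ind (ρ e)
  | .inv r => comp (.inv r)
  | .some R c => comp (.some R c)

/-- `Interp.ofStruct` discards the members of objects that are not classes; in the canonical model
there are none to discard, and the same holds for properties. -/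
theorem canon_isCls_of_cls (h : Saturated .owlThing S) {c o : Elt Name}
    (hc : (canon S ρ).cls c o) : (canon S ρ).isCls c := by
  have hcls : ∀ {o c}, Has S o (.cls c) → S (.cls c) := by
    rintro o c ⟨B, -, hs⟩
    exact h.typing_of_sub_right hs _ (by simp [LeftExp.toRight, RightExp.typing,
      RightExp.classArgs])
  rcases c with _ | _ | _ | _ | _ | (_ | _ | _)
  case ind => exact hcls hc.2
  case comp.some R c =>
    obtain ⟨o', ⟨_, _, P, _, hs⟩, hc⟩ := hc
    refine ⟨?_, hcls hc⟩
    have := h.prop_of _ hs (R.map ρ).role (by simp [QLAx.roleArgs])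
    cases R <;> exact this
  all_goals exact hc.elim

theorem canon_isProp_of_rel (h : Saturated .owlThing S) {r o o' : Elt Name}
    (hr : (canon S ρ).rel r o o') : (canon S ρ).isProp r := by
  rcases r with _ | _ | _ | _ | _ | (_ | _ | _)
  case ind =>
    obtain ⟨_, _, P, _, hs⟩ := hr
    exact h.prop_of _ hs _ (by simp [QLAx.roleArgs])
  case comp.inv =>
    obtain ⟨_, _, P, _, hs⟩ := hr
    exact h.prop_of _ hs _ (by simp [QLAx.roleArgs])
  all_goals exact hr.elim

/-- A saturated set of statements without a contradiction that is invariant under `ρ` is realized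
by an interpretation in which `e` and `ρ e` denote the same object. -/
theorem exists_interp (D : DatatypeMap.{v}) (h : Saturated .owlThing S)
    (hc : S (.cls (ρ .owlThing)))
    (ht : S (.ax (.sub (.cls .owlThing) (.cls (ρ .owlThing))))) :
    ∃ I : Interp Name D, I.toStruct = (canon S ρ).comap ρ := by
  let M : Struct (Exp Name) := { canon S ρ with den := canonDen ρ }
  have hM : M.WellFormed (.iri .owlThing) :=
    { isInd_of_cls := (canon_wellFormed h).isInd_of_cls
      isInd_of_rel := (canon_wellFormed h).isInd_of_rel
      isCls_thing := hc
      -- `owl:Thing` denotes the object of `ρ owl:Thing`, which may be another name; the derived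
      -- inclusion `ht` puts every individual into that class.
      cls_thing := fun {o} => ⟨fun ho => ho.1, fun ho =>
        let ⟨B, hB, hs⟩ := has_thing h ho
        ⟨ho, B, hB, h.sub_trans _ _ _ hs ht⟩⟩ }
  refine ⟨Interp.ofStruct D M hM (fun _ => Iff.rfl) (fun _ _ _ => Iff.rfl) ?_ ?_, ?_⟩
  · rintro (r | r) c <;> exact Iff.rfl
  · rintro (r | r) c o
    · exact ⟨fun ⟨o', hE, ho'⟩ => ⟨o', hE, hE.2.1, ho'⟩, fun ⟨o', hE, ho'⟩ => ⟨o', hE, ho'.2⟩⟩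
    · exact ⟨fun ⟨o', hE, ho'⟩ => ⟨o', hE.flip, hE.2.1, ho'⟩,
        fun ⟨o', hE, ho'⟩ => ⟨o', hE.flip, ho'.2⟩⟩
  · have hext : ∀ {p : Prop} [Decidable p] {β : Type u} {A : Set β},
        (∃ A', (if p then some A else none) = some A') ↔ p := by
      intro p _ β A
      by_cases hp : p <;> simp [hp]
    simp only [Interp.toStruct, Interp.ofStruct, Struct.comap, hext]
    congr 1
    · funext c o
      refine propext ⟨?_, fun hco => ⟨_, if_pos (canon_isCls_of_cls h hco), hco⟩⟩
      rintro ⟨A, hA, ho⟩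
      cases (Option.ite_none_right_eq_some.1 hA).2
      exact ho
    · funext r o o'
      refine propext ⟨?_, fun hco => ⟨_, if_pos (canon_isProp_of_rel h hco), hco⟩⟩
      rintro ⟨A, hA, ho⟩
      cases (Option.ite_none_right_eq_some.1 hA).2
      exact ho

end Model

/-! ### Encoding of statements -/

theorem Stmt.map_map {T' T'' : Type u} (f : T → T') (g : T' → T'') (s : Stmt T) :
    (s.map f).map g = s.map (g ∘ f) := by
  rcases s with (⟨c | r | r, c | ⟨r | r, c⟩⟩ | ⟨c | r | r, c | r | r⟩ | ⟨r, r | r⟩ | ⟨r, r | r⟩ | r | r |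
    ⟨c, x⟩ | ⟨r, x, y⟩ | ⟨x, y⟩) | c | c | c | _ <;> rfl

theorem Stmt.map_congr {T' : Type u} {f g : T → T'} {s : Stmt T} (h : ∀ t ∈ s.args, f t = g t) :
    s.map f = s.map g := by
  rcases s with (⟨c | r | r, c | ⟨r | r, c⟩⟩ | ⟨c | r | r, c | r | r⟩ | ⟨r, r | r⟩ | ⟨r, r | r⟩ | r | r |
    ⟨c, x⟩ | ⟨r, x, y⟩ | ⟨x, y⟩) | c | c | c | _ <;>
  simp_all [Stmt.args, QLAx.args, QLAx.classArgs, QLAx.roleArgs, QLAx.indArgs, Stmt.map, QLAx.map,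
    LeftExp.classArgs, LeftExp.roleArgs, RightExp.classArgs, RightExp.roleArgs, RoleExp.role,
    LeftExp.map, RightExp.map, RoleExp.map]

theorem Stmt.atom_map {T' : Type u} (f : T → T') (s : Stmt T) :
    (s.map f).atom = s.atom.map f := by
  rcases s with (⟨c | r | r, c | ⟨r | r, c⟩⟩ | ⟨c | r | r, c | r | r⟩ | ⟨r, r | r⟩ | ⟨r, r | r⟩ | r | r |
    ⟨c, x⟩ | ⟨r, x, y⟩ | ⟨x, y⟩) | c | c | c | _ <;> rfl

theorem Stmt.atomAssuming_map {T' : Type u} (f : T → T') (a b : T) (s : Stmt T) :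
    (s.map f).atomAssuming (f a) (f b) = (s.atomAssuming a b).map f := by
  rcases s with (⟨c | r | r, c | ⟨r | r, c⟩⟩ | ⟨c | r | r, c | r | r⟩ | ⟨r, r | r⟩ | ⟨r, r | r⟩ | r | r |
    ⟨c, x⟩ | ⟨r, x, y⟩ | ⟨x, y⟩) | c | c | c | _ <;> rfl

/-- Only membership can be compared: the encoding lists entities in another order, and `c ⊑ ¬ ∃ r`
is encoded with its sides exchanged. -/
theorem Stmt.mem_encode_iff {s : Stmt T} {t : T} : t ∈ s.encode.2 ↔ t ∈ s.args := by
  rcases s with (⟨c | r | r, c | ⟨r | r, c⟩⟩ | ⟨c | r | r, c | r | r⟩ | ⟨r, r | r⟩ | ⟨r, r | r⟩ | r | r |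
    ⟨c, x⟩ | ⟨r, x, y⟩ | ⟨x, y⟩) | c | c | c | _ <;>
  simp [Stmt.args, QLAx.args, QLAx.classArgs, QLAx.roleArgs, QLAx.indArgs, Stmt.encode, QLAx.encode,
    LeftExp.classArgs, LeftExp.roleArgs, RightExp.classArgs, RightExp.roleArgs, RoleExp.role,
    or_comm, or_left_comm]

theorem Stmt.mem_args_map {T' : Type u} {f : T → T'} {s : Stmt T} {t : T} (h : t ∈ s.args) :
    f t ∈ (s.map f).args := by
  rw [← Stmt.mem_encode_iff] at h ⊢
  have : (s.map f).encode.2 = s.encode.2.map f := congrArg RegAtom.args (Stmt.atom_map f s)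
  exact this ▸ List.mem_map_of_mem h

theorem Stmt.exists_mem_stmtForms [Inhabited T] (s : Stmt T) :
    ∃ a b c x y, s ∈ stmtForms a b c x y := by
  cases s with
  | ax α =>
    obtain ⟨a, b, c, x, y, h⟩ := α.exists_mem_axiomForms
    exact ⟨a, b, c, x, y, List.mem_append_left _ (List.mem_map_of_mem h)⟩
  | cls c => exact ⟨c, c, c, c, c, by simp [stmtForms]⟩
  | prop c => exact ⟨c, c, c, c, c, by simp [stmtForms]⟩
  | ind c => exact ⟨c, c, c, c, c, by simp [stmtForms]⟩
  | clash => exact ⟨default, default, default, default, default, by simp [stmtForms]⟩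

theorem args_of_mem_stmtForms {a b c x y : T} :
    ∀ s ∈ stmtForms a b c x y, ∀ t ∈ s.args, t ∈ [a, b, c, x, y] := by
  simp [stmtForms, axiomForms, leftForms, rightForms, roleForms, Stmt.args, QLAx.args,
    QLAx.classArgs, QLAx.roleArgs, QLAx.indArgs, LeftExp.classArgs, LeftExp.roleArgs,
    RightExp.classArgs, RightExp.roleArgs, RoleExp.role]

/-- The forms of statements with the variables 0, …, 4. -/
abbrev genericForms (Name : Type u) : List (Stmt (Term Name)) :=
  stmtForms (.var 0) (.var 1) (.var 2) (.var 3) (.var 4)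

theorem map_genericForms (f : Term Name → T) : (genericForms Name).map (Stmt.map f) =
    stmtForms (f (.var 0)) (f (.var 1)) (f (.var 2)) (f (.var 3)) (f (.var 4)) := by
  rfl

theorem exists_var_of_mem_genericForms {s : Stmt (Term Name)} (hs : s ∈ genericForms Name)
    {t : Term Name} (ht : t ∈ s.args) : ∃ k < 5, t = .var k := by
  have := args_of_mem_stmtForms s hs t ht
  simp only [List.mem_cons, List.not_mem_nil, or_false] at this
  rcases this with rfl | rfl | rfl | rfl | rfl
  exacts [⟨0, by omega, rfl⟩, ⟨1, by omega, rfl⟩, ⟨2, by omega, rfl⟩, ⟨3, by omega, rfl⟩,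
    ⟨4, by omega, rfl⟩]

theorem map_eval_congr {s : Stmt (Term Name)} (hs : s ∈ genericForms Name)
    {f g : Term Name → T} (h : ∀ k < 5, f (.var k) = g (.var k)) : s.map f = s.map g := by
  refine Stmt.map_congr fun t ht => ?_
  obtain ⟨k, hk, rfl⟩ := exists_var_of_mem_genericForms hs ht
  exact h k hk

/-- Every statement is an instance of one of the forms. -/
theorem exists_generic (s : Stmt (IRI Name)) {U : Set (IRI Name)} (hU : .owlThing ∈ U)
    (hs : s.ArgsIn U) :
    ∃ s₀ ∈ genericForms Name, ∃ v : ℕ → IRI Name, (∀ n, v n ∈ U) ∧ s = s₀.map (Term.eval v) := by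
  classical
  have : Inhabited (IRI Name) := ⟨.owlThing⟩
  obtain ⟨a, b, c, x, y, h⟩ := s.exists_mem_stmtForms
  have h' : s ∈ (genericForms Name).map (Stmt.map (Term.eval (assign a b c x y y y))) := by
    rw [map_genericForms]
    exact h
  obtain ⟨s₀, hs₀, rfl⟩ := List.mem_map.1 h'
  set v := assign a b c x y y y
  -- Slots that the form does not use may hold padding not known to lie in `U`; it is replaced by
  -- `owl:Thing`.
  refine ⟨s₀, hs₀, fun n => if v n ∈ U then v n else .owlThing, fun n => ?_, ?_⟩
  · dsimp only
    split
    · assumption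
    · exact hU
  · refine Stmt.map_congr fun t ht => ?_
    obtain ⟨k, -, rfl⟩ := exists_var_of_mem_genericForms hs₀ ht
    have hk : v k ∈ U := hs _ (Stmt.mem_args_map ht)
    simp [Term.eval, hk]

/-! ### The least model is saturated -/

/-- The Datalog program of an ontology and a query. -/
abbrev dlProgram (O : Ontology Name) (Q : Query Name) : Program Name := rql Name ∪ O.tau ∪ Q.tau

variable (O : Ontology Name) (Q : Query Name)

theorem dlProgram_ordinary : ∀ ρ ∈ dlProgram O Q, ρ.Ordinary := by
  rintro ρ ((hρ | ⟨a, _, rfl⟩) | rfl) b hb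
  · change ρ ∈ rqlRules Name at hρ
    simp only [rqlRules, List.mem_append, List.mem_map, List.mem_singleton] at hρ
    rcases hρ with (⟨ρ, -, rfl⟩ | (⟨ρ, -, rfl⟩ | ⟨s, -, rfl⟩) | ⟨ρ, -, rfl⟩) | rfl
    all_goals
      simp only [Inference.toRule, Inference.toRuleAssuming, assumptionGuard, List.mem_append,
        List.mem_map, List.mem_cons, List.not_mem_nil, or_false] at hb
      aesop
  · simp at hb
  · obtain ⟨a, -, rfl⟩ := List.mem_map.1 hb
    exact ⟨_, rfl⟩

/-- The derived statements. -/
def Derived (s : Stmt (IRI Name)) : Prop := s.atom ∈ (dlProgram O Q).minimalModel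

/-- The statements derived under the assumption that `a` and `b` are equal. -/
def DerivedAssuming (a b : IRI Name) (s : Stmt (IRI Name)) : Prop :=
  s.atomAssuming a b ∈ (dlProgram O Q).minimalModel

variable {O Q}

/-- One rule application. Only head variables need a check against the constants, because the values
of body variables occur in derived atoms. -/
theorem mem_minimalModel_of_rule {ρ : Rule (Term Name)} (hρ : ρ ∈ dlProgram O Q)
    (σ : ℕ → IRI Name) (hσ : ∀ n, Term.var n ∈ ρ.head.args → σ n ∈ (dlProgram O Q).constants)
    (hb : ∀ a, .reg a ∈ ρ.body → a.map (Term.eval σ) ∈ (dlProgram O Q).minimalModel) :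
    ρ.head.map (Term.eval σ) ∈ (dlProgram O Q).minimalModel := by
  have hord := dlProgram_ordinary O Q ρ hρ
  refine Program.satGround_minimalModel (dlProgram_ordinary O Q) (fun _ _ _ => False)
    (ρ.map (Term.eval σ)) ⟨ρ, hρ, σ, fun n hn => ?_, rfl⟩ fun b hb' => ?_
  · rcases List.mem_append.1 hn with hn | hn
    · exact hσ n hn
    · obtain ⟨b, hb', hn⟩ := List.mem_flatMap.1 hn
      obtain ⟨a, rfl⟩ := hord b hb'
      exact Program.args_mem_constants (hb a hb') (List.mem_map_of_mem (f := Term.eval σ) hn)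
  · obtain ⟨b, hmem, rfl⟩ := List.mem_map.1 hb'
    obtain ⟨a, rfl⟩ := hord b hmem
    exact hb a hmem

theorem Derived.argsIn {s : Stmt (IRI Name)} (hs : Derived O Q s) :
    s.ArgsIn (dlProgram O Q).constants := fun _ he =>
  Program.args_mem_constants hs (Stmt.mem_encode_iff.2 he)

theorem DerivedAssuming.argsIn {a b : IRI Name} {s : Stmt (IRI Name)}
    (hs : DerivedAssuming O Q a b s) : s.ArgsIn (dlProgram O Q).constants := fun _ he =>
  Program.args_mem_constants hs (List.mem_cons_of_mem _ (List.mem_cons_of_mem _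
    (Stmt.mem_encode_iff.2 he)))

theorem mem_dlProgram_of_rqlRules {ρ : Rule (Term Name)} (hρ : ρ ∈ rqlRules Name) :
    ρ ∈ dlProgram O Q := Or.inl (Or.inl hρ)

theorem toRule_mem {ρ : Inference (Term Name)} (hρ : ρ ∈ saturationRules Name) :
    ρ.toRule ∈ dlProgram O Q := by
  refine mem_dlProgram_of_rqlRules ?_
  simp only [rqlRules, List.mem_append]
  exact .inl (.inl (List.mem_map_of_mem hρ))

theorem toRuleAssuming_mem {ρ : Inference (Term Name)}
    (hρ : ρ ∈ saturationRules Name ∨ ρ ∈ congruenceRules Name) :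
    ρ.toRuleAssuming ∈ dlProgram O Q := by
  refine mem_dlProgram_of_rqlRules ?_
  simp only [rqlRules, List.mem_append]
  rcases hρ with hρ | hρ
  · exact .inl (.inr (.inl (.inl (List.mem_map_of_mem hρ))))
  · exact .inl (.inr (.inr (List.mem_map_of_mem hρ)))

theorem owlThing_mem_constants : .owlThing ∈ (dlProgram O Q).constants := by
  refine ⟨_, toRule_mem (ρ := ⟨.cls (.iri .owlThing), []⟩) ?_, ?_⟩
  · simp [saturationRules, typingRules]
  · simp [Rule.terms, Inference.toRule, Stmt.atom, Stmt.encode]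

theorem exists_map_of_mem_saturationInstances {σ : ℕ → IRI Name} {ρ : Inference (IRI Name)}
    (hρ : ρ ∈ saturationInstances .owlThing σ) :
    ∃ ρ₀ ∈ saturationRules Name, ρ₀.map (Term.eval σ) = ρ := by
  rw [← map_saturationRules] at hρ
  exact List.mem_map.1 hρ

theorem var_mem_of_argsIn {s : Stmt (Term Name)} {σ : ℕ → IRI Name} {U : Set (IRI Name)}
    (h : (s.map (Term.eval σ)).ArgsIn U) {n : ℕ} (hn : .var n ∈ s.args) : σ n ∈ U :=
  h _ (Stmt.mem_args_map (f := Term.eval σ) hn)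

/-- Grounding ranges only over the constants of the program. This does no harm, since by
`saturated_argsIn` a conclusion mentions nothing beyond its premises and `owl:Thing`. -/
theorem derived_saturated : Saturated .owlThing (Derived O Q) := by
  refine saturated_of_valid fun σ ρ hρ hp => ?_
  have hargs := (saturated_argsIn (owlThing_mem_constants (O := O) (Q := Q))).valid σ ρ hρ
    fun s hs => (hp s hs).argsIn
  obtain ⟨ρ, hmem, rfl⟩ := exists_map_of_mem_saturationInstances hρ
  rw [Derived, Inference.map, Stmt.atom_map]
  refine mem_minimalModel_of_rule (toRule_mem hmem) σ
    (fun n hn => var_mem_of_argsIn hargs (Stmt.mem_encode_iff.1 hn)) fun a ha => ?_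
  obtain ⟨s, hs, h⟩ := List.mem_map.1 ha
  cases h
  have := hp _ (List.mem_map_of_mem hs)
  rwa [Derived, Stmt.atom_map] at this

/-! ### Derivation under the assumption of an equality -/

section Assuming

variable {a b : IRI Name} (ha : Derived O Q (.ind a)) (hb : Derived O Q (.ind b))
include ha hb

theorem derivedAssuming_of_rule {s : Stmt (Term Name)} {body : List (BodyAtom (Term Name))}
    (hρ : ⟨s.atomAssuming (.var 10) (.var 11), assumptionGuard Name ++ body⟩ ∈ dlProgram O Q)
    {σ : ℕ → IRI Name} (h10 : σ 10 = a) (h11 : σ 11 = b)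
    (hargs : (s.map (Term.eval σ)).ArgsIn (dlProgram O Q).constants)
    (hbody : ∀ a, .reg a ∈ body → a.map (Term.eval σ) ∈ (dlProgram O Q).minimalModel) :
    DerivedAssuming O Q a b (s.map (Term.eval σ)) := by
  subst h10 h11
  have := mem_minimalModel_of_rule hρ σ (fun n hn => ?_) fun c hc => ?_
  · rwa [← Stmt.atomAssuming_map] at this
  · simp only [Stmt.atomAssuming, List.mem_cons, Term.var.injEq, Stmt.mem_encode_iff] at hn
    rcases hn with rfl | rfl | hn
    · exact ha.argsIn _ (by simp [Stmt.args])
    · exact hb.argsIn _ (by simp [Stmt.args])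
    · exact var_mem_of_argsIn hargs hn
  · rcases List.mem_append.1 hc with hc | hc
    · simp only [assumptionGuard, List.mem_cons, BodyAtom.reg.injEq, List.not_mem_nil,
        or_false] at hc
      rcases hc with rfl | rfl
      · exact ha
      · exact hb
    · exact hbody c hc

theorem derivedAssuming_of_inference {ρ : Inference (Term Name)}
    (hρ : ρ ∈ saturationRules Name ∨ ρ ∈ congruenceRules Name)
    {σ : ℕ → IRI Name} (h10 : σ 10 = a) (h11 : σ 11 = b)
    (hargs : (ρ.concl.map (Term.eval σ)).ArgsIn (dlProgram O Q).constants)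
    (hp : ∀ s ∈ ρ.prems, DerivedAssuming O Q a b (s.map (Term.eval σ))) :
    DerivedAssuming O Q a b (ρ.concl.map (Term.eval σ)) := by
  refine derivedAssuming_of_rule ha hb (toRuleAssuming_mem hρ) h10 h11 hargs fun c hc => ?_
  obtain ⟨s, hs, h⟩ := List.mem_map.1 hc
  cases h
  subst h10 h11
  have := hp s hs
  change (s.atomAssuming (.var 10) (.var 11)).map (Term.eval σ) ∈ _
  rw [← Stmt.atomAssuming_map]
  exact this

theorem derivedAssuming_saturated : Saturated .owlThing (DerivedAssuming O Q a b) := by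
  refine saturated_of_valid fun σ ρ hρ hp => ?_
  have hargs := (saturated_argsIn (owlThing_mem_constants (O := O) (Q := Q))).valid σ ρ hρ
    fun s hs => (hp s hs).argsIn
  -- The saturation rules use only the variables 0 to 6, so the values of 10 and 11 can be set to
  -- `a` and `b` without changing the instance.
  have hρ' : ρ ∈ saturationInstances .owlThing
      (Function.update (Function.update σ 10 a) 11 b) := hρ
  obtain ⟨ρ, hmem, rfl⟩ := exists_map_of_mem_saturationInstances hρ'
  exact derivedAssuming_of_inference ha hb (.inl hmem) (by simp) (by simp) hargs
    fun s hs => hp _ (List.mem_map_of_mem hs)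

theorem Derived.assuming {s : Stmt (IRI Name)} (hs : Derived O Q s) :
    DerivedAssuming O Q a b s := by
  obtain ⟨s₀, hs₀, v, hv, rfl⟩ := exists_generic s owlThing_mem_constants hs.argsIn
  have hmap : s₀.map (Term.eval v) =
      s₀.map (Term.eval (Function.update (Function.update v 10 a) 11 b)) := by
    refine map_eval_congr hs₀ fun k hk => ?_
    have h1 : k ≠ 11 := by omega
    have h2 : k ≠ 10 := by omega
    simp [Term.eval, h1, h2]
  have hargs := hs.argsIn
  rw [hmap] at hs hargs ⊢
  refine derivedAssuming_of_rule ha hb (mem_dlProgram_of_rqlRules ?_) (body := [.reg s₀.atom])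
    (by simp) (by simp) hargs fun c hc => ?_
  · simp only [rqlRules, List.mem_append]
    exact .inl (.inr (.inl (.inr (List.mem_map_of_mem hs₀))))
  · cases List.mem_singleton.1 hc
    rwa [Derived, Stmt.atom_map] at hs

/-- The two congruence rules for slot `k` of the form, one for each direction; the guard variables
10 and 11 lie outside the slots of the form. -/
theorem derivedAssuming_update_iff {s : Stmt (Term Name)} (hs : s ∈ genericForms Name)
    {v : ℕ → IRI Name} (hv : ∀ n, v n ∈ (dlProgram O Q).constants) {k : ℕ} (hk : k < 5) :
    DerivedAssuming O Q a b (s.map (Term.eval (Function.update v k b))) ↔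
      DerivedAssuming O Q a b (s.map (Term.eval (Function.update v k a))) := by
  set σ := Function.update (Function.update v 10 a) 11 b with hσ
  have hσ10 : σ 10 = a := by simp [hσ]
  have hσ11 : σ 11 = b := by simp [hσ]
  have hmap : ∀ m, (s.map (Term.subst k m)).map (Term.eval σ) =
      s.map (Term.eval (Function.update v k (σ m))) := by
    intro m
    rw [Stmt.map_map]
    refine map_eval_congr hs fun j hj => ?_
    have h1 : j ≠ 11 := by omega
    have h2 : j ≠ 10 := by omega
    by_cases h : j = k
    · simp [Term.subst, Term.eval, h]
    · simp [Term.subst, Term.eval, h, hσ, h1, h2]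
  have hA : a ∈ (dlProgram O Q).constants := ha.argsIn _ (by simp [Stmt.args])
  have hB : b ∈ (dlProgram O Q).constants := hb.argsIn _ (by simp [Stmt.args])
  have hargs : ∀ c ∈ (dlProgram O Q).constants,
      (s.map (Term.eval (Function.update v k c))).ArgsIn (dlProgram O Q).constants := by
    intro c hc e he
    rw [← Stmt.mem_encode_iff] at he
    have : (s.map (Term.eval (Function.update v k c))).encode.2 = s.encode.2.map _ :=
      congrArg RegAtom.args (Stmt.atom_map _ s)
    rw [this] at he
    obtain ⟨t, ht, rfl⟩ := List.mem_map.1 he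
    obtain ⟨j, -, rfl⟩ := exists_var_of_mem_genericForms hs (Stmt.mem_encode_iff.1 ht)
    by_cases h : j = k
    · simpa [Term.eval, h] using hc
    · simpa [Term.eval, h] using hv j
  have hmem : ∀ ρ ∈ [(⟨s.map (Term.subst k 11), [s.map (Term.subst k 10)]⟩ :
      Inference (Term Name)), ⟨s.map (Term.subst k 10), [s.map (Term.subst k 11)]⟩],
      ρ ∈ congruenceRules Name := fun ρ hρ =>
    List.mem_flatMap.2 ⟨s, hs, List.mem_flatMap.2 ⟨k, List.mem_range.2 hk, hρ⟩⟩
  constructor <;> intro h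
  · have := derivedAssuming_of_inference ha hb
      (.inr (hmem ⟨s.map (Term.subst k 10), [s.map (Term.subst k 11)]⟩ (by simp))) hσ10 hσ11
    simp only [List.forall_mem_singleton, hmap, hσ10, hσ11] at this
    exact this (hargs a hA) h
  · have := derivedAssuming_of_inference ha hb
      (.inr (hmem ⟨s.map (Term.subst k 11), [s.map (Term.subst k 10)]⟩ (by simp))) hσ10 hσ11
    simp only [List.forall_mem_singleton, hmap, hσ10, hσ11] at this
    exact this (hargs b hB) h

open Classical in
/-- Under the assumption that `a` and `b` are equal, `b` may be replaced by `a`. -/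
theorem derivedAssuming_map_iff {s : Stmt (IRI Name)}
    (hs : s.ArgsIn (dlProgram O Q).constants) :
    DerivedAssuming O Q a b (s.map fun e => if e = b then a else e) ↔
      DerivedAssuming O Q a b s := by
  obtain ⟨s₀, hs₀, v, hv, rfl⟩ := exists_generic s owlThing_mem_constants hs
  set ρ : IRI Name → IRI Name := fun e => if e = b then a else e with hρ
  have hA : a ∈ (dlProgram O Q).constants := ha.argsIn _ (by simp [Stmt.args])
  have hρU : ∀ e ∈ (dlProgram O Q).constants, ρ e ∈ (dlProgram O Q).constants := by
    intro e he
    simp only [hρ]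
    split
    · exact hA
    · exact he
  -- The congruence rules change one slot at a time, so `ρ` is applied to the slots 0 to 4
  -- successively; a slot not holding `b` is left unchanged.
  have hstep : ∀ n ≤ 5, (DerivedAssuming O Q a b
      (s₀.map (Term.eval fun j => if j < n then ρ (v j) else v j)) ↔
        DerivedAssuming O Q a b (s₀.map (Term.eval v))) := by
    intro n
    induction n with
    | zero => intro _; simp
    | succ n ih =>
      intro hn
      rw [← ih (by omega)]
      set w : ℕ → IRI Name := fun j => if j < n then ρ (v j) else v j with hw
      have hwU : ∀ j, w j ∈ (dlProgram O Q).constants := by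
        intro j
        simp only [hw]
        split
        · exact hρU _ (hv j)
        · exact hv j
      have hsucc : (fun j => if j < n + 1 then ρ (v j) else v j) =
          Function.update w n (ρ (v n)) := by
        funext j
        rcases lt_trichotomy j n with h | rfl | h
        · rw [Function.update_of_ne h.ne]
          simp [hw, h, Nat.lt_succ_of_lt h]
        · simp
        · rw [Function.update_of_ne h.ne']
          have h1 : ¬ j < n + 1 := by omega
          have h2 : ¬ j < n := by omega
          simp [hw, h1, h2]
      have hwn : w n = v n := by simp [hw]
      rw [hsucc]
      by_cases hb' : v n = b
      · have h1 : ρ (v n) = a := by simp [hρ, hb']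
        rw [h1, ← derivedAssuming_update_iff ha hb hs₀ hwU (by omega), ← hb', ← hwn,
          Function.update_eq_self]
      · have h1 : ρ (v n) = v n := by simp [hρ, hb']
        rw [h1, ← hwn, Function.update_eq_self]
  rw [← hstep 5 le_rfl, Stmt.map_map]
  refine iff_of_eq (congrArg _ (map_eval_congr hs₀ fun k hk => ?_))
  simp [Term.eval, hk]

end Assuming

/-! ### Completeness -/

theorem derived_of_mem {α : QLAx (IRI Name)} (hα : α ∈ O) : Derived O Q (.ax α) := by
  have hmap : ((Stmt.ax α).map Term.iri).map (Term.eval fun _ => (.owlThing : IRI Name)) =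
      .ax α := by
    rw [Stmt.map_map]
    rcases α with ⟨c | r | r, c | ⟨r | r, c⟩⟩ | ⟨c | r | r, c | r | r⟩ | ⟨r, r | r⟩ | ⟨r, r | r⟩ | r | r |
      ⟨c, x⟩ | ⟨r, x, y⟩ | ⟨x, y⟩ <;> rfl
  have hnv : ∀ n, Term.var n ∉ ((Stmt.ax α).map Term.iri).atom.args := by
    intro n hn
    rw [Stmt.atom_map] at hn
    obtain ⟨e, -, he⟩ := List.mem_map.1 hn
    cases he
  rw [Derived, ← hmap, Stmt.atom_map]
  exact mem_minimalModel_of_rule (ρ := ⟨((Stmt.ax α).map Term.iri).atom, []⟩)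
    (Or.inl (Or.inr ⟨α, hα, rfl⟩)) _ (fun n hn => absurd hn (hnv n)) (by simp)

theorem derived_diff {a b : IRI Name} (h : DerivedAssuming O Q a b .clash) :
    Derived O Q (.ax (.diff a b)) := by
  have hargs : ∀ e ∈ [a, b], e ∈ (dlProgram O Q).constants := fun e he =>
    Program.args_mem_constants h he
  have hmem := mem_minimalModel_of_rule (O := O) (Q := Q)
    (ρ := ⟨(Stmt.ax (.diff (.var 10) (.var 11))).atom,
      [.reg (Stmt.clash.atomAssuming (.var 10) (.var 11))]⟩)
    (mem_dlProgram_of_rqlRules (by simp [rqlRules])) (fun n => if n = 10 then a else b) ?_ ?_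
  · exact hmem
  · intro n _
    by_cases hn : n = 10
    · simpa [hn] using hargs a (by simp)
    · simpa [hn] using hargs b (by simp)
  · intro c hc
    cases List.mem_singleton.1 hc
    exact h

theorem Interp.sat_of_canon {S : Stmt (IRI Name) → Prop} {ρ : IRI Name → IRI Name}
    {I : Interp Name D} (hI : I.toStruct = (canon S ρ).comap ρ) (α : QLAx (IRI Name)) :
    I.Sat α ↔ (canon S ρ).Sat (α.map ρ) := by
  rw [I.sat_iff, hI]
  exact ((canon S ρ).holds_map ρ (.ax α)).symm

theorem Stmt.map_id (s : Stmt T) : s.map id = s := by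
  rcases s with (⟨c | r | r, c | ⟨r | r, c⟩⟩ | ⟨c | r | r, c | r | r⟩ | ⟨r, r | r⟩ | ⟨r, r | r⟩ | r | r |
    ⟨c, x⟩ | ⟨r, x, y⟩ | ⟨x, y⟩) | c | c | c | _ <;> rfl

theorem QLAx.map_id (α : QLAx T) : α.map id = α :=
  Stmt.ax.inj (Stmt.map_id (.ax α))

/-- Everything that is entailed is derived. -/
theorem derived_of_entails (hc : ¬ Derived O Q .clash) {α : QLAx (IRI Name)}
    (hα : Entails D O α) : Derived O Q (.ax α) := by
  classical
  have hS := derived_saturated (O := O) (Q := Q)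
  -- The canonical model of the derived statements settles everything but inequalities; for an
  -- inequality it still shows that both names are derived to be individuals.
  obtain ⟨I, hI⟩ := exists_interp (ρ := id) D hS hS.cls_thing (hS.sub_cls_self _ hS.cls_thing)
  have hsat : (canon (Derived O Q) id).Sat α := by
    have := hα I fun β hβ => by
      rw [Interp.sat_of_canon hI, QLAx.map_id]
      exact canon_sat hS hc (derived_of_mem hβ)
    rwa [Interp.sat_of_canon hI, QLAx.map_id] at this
  by_cases hdiff : ∀ x y, α ≠ .diff x y
  · exact mem_of_canon_sat hS hc hsat hdiff
  push Not at hdiff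
  obtain ⟨a, b, rfl⟩ := hdiff
  have ha : Derived O Q (.ind a) := hsat.1
  have hb : Derived O Q (.ind b) := hsat.2.1
  by_contra hd
  have hS' := derivedAssuming_saturated ha hb
  have hc' : ¬ DerivedAssuming O Q a b .clash := mt derived_diff hd
  set ρ : IRI Name → IRI Name := fun e => if e = b then a else e with hρ
  have hρa : ρ a = a := by simp [hρ]
  have hρρ : ∀ e, ρ (ρ e) = ρ e := by
    intro e
    by_cases h : e = b
    · have : ρ e = a := by simp [hρ, h]
      rw [this, hρa]
    · have : ρ e = e := by simp [hρ, h]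
      rw [this, this]
  have hinv : ∀ {s}, DerivedAssuming O Q a b s → DerivedAssuming O Q a b (s.map ρ) := fun hs =>
    (derivedAssuming_map_iff ha hb hs.argsIn).2 hs
  have hcls : DerivedAssuming O Q a b (.cls (ρ .owlThing)) := hinv hS'.cls_thing
  have hU : ∀ e ∈ [.owlThing, ρ .owlThing], e ∈ (dlProgram O Q).constants := by
    have h1 := hS'.cls_thing.argsIn
    have h2 := hcls.argsIn
    simp_all [Stmt.ArgsIn, Stmt.args]
  -- This matters when `b` is `owl:Thing` itself. Applying `ρ` to the inclusion turns it, by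
  -- idempotence, into the trivial inclusion of `ρ owl:Thing` in itself.
  have ht : DerivedAssuming O Q a b (.ax (.sub (.cls .owlThing) (.cls (ρ .owlThing)))) := by
    refine (derivedAssuming_map_iff ha hb ?_).1 ?_
    · simpa [Stmt.ArgsIn, Stmt.args, QLAx.args, QLAx.classArgs, QLAx.roleArgs, QLAx.indArgs,
        LeftExp.classArgs, LeftExp.roleArgs, RightExp.classArgs, RightExp.roleArgs] using hU
    · change DerivedAssuming O Q a b (.ax (.sub (.cls (ρ .owlThing)) (.cls (ρ (ρ .owlThing)))))
      rw [hρρ]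
      exact hS'.sub_cls_self _ hcls
  obtain ⟨I, hI⟩ := exists_interp D hS' hcls ht
  -- The axioms of the ontology are derived, hence derived under the assumption, and so are their
  -- images under `ρ`. The interpretation is thus a model of the ontology, and in it `a` and `b`
  -- denote the same object.
  have := hα I fun β hβ => by
    rw [Interp.sat_of_canon hI]
    exact canon_sat hS' hc' (hinv (Derived.assuming ha hb (derived_of_mem hβ)))
  rw [Interp.sat_of_canon hI] at this
  refine this.2.2 ?_
  change Elt.ind (ρ a) = Elt.ind (ρ b)
  rw [hρa]
  simp [hρ]

/-! ### Soundness -/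

/-- The statement with a given encoding. -/
def decode : BasePred → List T → Stmt T
  | .isacCC, [a, b] => .ax (.sub (.cls a) (.cls b))
  | .isacCR, [a, b, c] => .ax (.sub (.cls a) (.ex (.dir b) c))
  | .isacCI, [a, b, c] => .ax (.sub (.cls a) (.ex (.inv b) c))
  | .isacRC, [a, b] => .ax (.sub (.ex (.dir a)) (.cls b))
  | .isacRR, [a, b, c] => .ax (.sub (.ex (.dir a)) (.ex (.dir b) c))
  | .isacRI, [a, b, c] => .ax (.sub (.ex (.dir a)) (.ex (.inv b) c))
  | .isacIC, [a, b] => .ax (.sub (.ex (.inv a)) (.cls b))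
  | .isacIR, [a, b, c] => .ax (.sub (.ex (.inv a)) (.ex (.dir b) c))
  | .isacII, [a, b, c] => .ax (.sub (.ex (.inv a)) (.ex (.inv b) c))
  | .disjcCC, [a, b] => .ax (.disj (.cls a) (.cls b))
  | .disjcCI, [a, b] => .ax (.disj (.cls a) (.ex (.inv b)))
  | .disjcRC, [a, b] => .ax (.disj (.ex (.dir a)) (.cls b))
  | .disjcRR, [a, b] => .ax (.disj (.ex (.dir a)) (.ex (.dir b)))
  | .disjcRI, [a, b] => .ax (.disj (.ex (.dir a)) (.ex (.inv b)))
  | .disjcIC, [a, b] => .ax (.disj (.ex (.inv a)) (.cls b))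
  | .disjcIR, [a, b] => .ax (.disj (.ex (.inv a)) (.ex (.dir b)))
  | .disjcII, [a, b] => .ax (.disj (.ex (.inv a)) (.ex (.inv b)))
  | .isarRR, [a, b] => .ax (.subRole a (.dir b))
  | .isarRI, [a, b] => .ax (.subRole a (.inv b))
  | .disjrRR, [a, b] => .ax (.disjRole a (.dir b))
  | .disjrRI, [a, b] => .ax (.disjRole a (.inv b))
  | .refl, [a] => .ax (.refl a)
  | .irrefl, [a] => .ax (.irrefl a)
  | .instc, [a, b] => .ax (.classAssert a b)
  | .instr, [a, b, c] => .ax (.roleAssert a b c)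
  | .diff, [a, b] => .ax (.diff a b)
  | .cls, [a] => .cls a
  | .prop, [a] => .prop a
  | .ind, [a] => .ind a
  -- Besides the encoding of `clash` this catches argument lists of the wrong length, which encode
  -- no statement.
  | _, _ => .clash

/-- Decoding undoes encoding except for `c ⊑ ¬ ∃ r`, which comes back as `∃ r ⊑ ¬ c`; the two are
equivalent because disjointness is symmetric. -/
theorem Struct.holds_decode (M : Struct T) (s : Stmt T) :
    M.Holds (decode s.encode.1 s.encode.2) ↔ M.Holds s := by
  rcases s with (⟨c | r | r, c | ⟨r | r, c⟩⟩ | ⟨c | r | r, c | r | r⟩ | ⟨r, r | r⟩ | ⟨r, r | r⟩ | r | r |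
    ⟨c, x⟩ | ⟨r, x, y⟩ | ⟨x, y⟩) | c | c | c | _
  case ax.disj.cls.ex.dir =>
    exact ⟨fun h => ⟨h.2.1, h.1, fun o h1 h2 => h.2.2 o h2 h1⟩,
      fun h => ⟨h.2.1, h.1, fun o h1 h2 => h.2.2 o h2 h1⟩⟩
  all_goals exact Iff.rfl

/-- The statement holds in every model of the ontology. -/
def Sound (D : DatatypeMap.{v}) (O : Ontology Name) (s : Stmt (IRI Name)) : Prop :=
  ∀ I : Interp Name D, I.IsModel O → I.toStruct.Holds s

/-- `a` and `b` are individuals, and the statement holds in every model of the ontology in which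
they are equal. -/
def SoundAssuming (D : DatatypeMap.{v}) (O : Ontology Name) (a b : IRI Name)
    (s : Stmt (IRI Name)) : Prop :=
  (Sound D O (.ind a) ∧ Sound D O (.ind b)) ∧ ∀ I : Interp Name D, I.IsModel O →
    I.toStruct.den a = I.toStruct.den b → I.toStruct.Holds s

/-- The atoms that are true by virtue of the semantics. -/
def soundAtoms (D : DatatypeMap.{v}) (O : Ontology Name) (Q : Query Name) :
    Set (RegAtom (IRI Name)) :=
  {g | match g.pred with
    | .base p => Sound D O (decode p g.args)
    | .assuming p => ∃ a b l, g.args = a :: b :: l ∧ SoundAssuming D O a b (decode p l)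
    | .query => g.args ∈ Q.answers D O}

theorem atom_mem_soundAtoms {s : Stmt (IRI Name)} :
    s.atom ∈ soundAtoms D O Q ↔ Sound D O s :=
  forall₂_congr fun I _ => I.toStruct.holds_decode s

theorem atomAssuming_mem_soundAtoms {a b : IRI Name} {s : Stmt (IRI Name)} :
    s.atomAssuming a b ∈ soundAtoms D O Q ↔ SoundAssuming D O a b s := by
  have key : SoundAssuming D O a b (decode s.encode.1 s.encode.2) ↔ SoundAssuming D O a b s :=
    and_congr_right fun _ => forall₃_congr fun I _ _ => I.toStruct.holds_decode s
  rw [← key]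
  constructor
  · rintro ⟨a', b', l, hl, h⟩
    cases hl
    exact h
  · exact fun h => ⟨a, b, _, rfl, h⟩

theorem sound_ax_iff {α : QLAx (IRI Name)} : Sound D O (.ax α) ↔ Entails D O α :=
  forall₂_congr fun I _ => (I.sat_iff α).symm

theorem valid_of_mem_saturationRules {ρ : Inference (Term Name)} (hρ : ρ ∈ saturationRules Name)
    (σ : ℕ → IRI Name) (I : Interp Name D) :
    (∀ s ∈ ρ.prems, I.toStruct.Holds (s.map (Term.eval σ))) →
      I.toStruct.Holds (ρ.concl.map (Term.eval σ)) := by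
  intro h
  have hmem : ρ.map (Term.eval σ) ∈ saturationInstances .owlThing σ := by
    rw [← map_saturationRules]
    exact List.mem_map_of_mem hρ
  refine I.wellFormed_toStruct.saturated.valid σ _ hmem fun s hs => ?_
  obtain ⟨s, hmem, rfl⟩ := List.mem_map.1 hs
  exact h s hmem

theorem mem_of_holdsBody_map {J : Set (RegAtom (IRI Name))} {f : Oracle Name} {σ : ℕ → IRI Name}
    {head : RegAtom (Term Name)} {body : List (BodyAtom (Term Name))}
    (hb : HoldsBody f J (Rule.map (Term.eval σ) ⟨head, body⟩)) :
    ∀ a, .reg a ∈ body → a.map (Term.eval σ) ∈ J := fun _ ha =>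
  hb _ (List.mem_map_of_mem (f := BodyAtom.map (Term.eval σ)) ha)

theorem soundAssuming_guard {σ : ℕ → IRI Name} {body : List (BodyAtom (Term Name))}
    (hb : ∀ a, .reg a ∈ assumptionGuard Name ++ body →
      a.map (Term.eval σ) ∈ soundAtoms D O Q) :
    Sound D O (.ind (σ 10)) ∧ Sound D O (.ind (σ 11)) :=
  ⟨atom_mem_soundAtoms.1 (hb (Stmt.ind (.var 10)).atom (by simp [assumptionGuard])),
    atom_mem_soundAtoms.1 (hb (Stmt.ind (.var 11)).atom (by simp [assumptionGuard]))⟩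

theorem soundAssuming_prems {σ : ℕ → IRI Name} {prems : List (Stmt (Term Name))}
    (hb : ∀ a, .reg a ∈ assumptionGuard Name ++
        prems.map (fun s => BodyAtom.reg (s.atomAssuming (.var 10) (.var 11))) →
      a.map (Term.eval σ) ∈ soundAtoms D O Q) (s) (hs : s ∈ prems) :
    SoundAssuming D O (σ 10) (σ 11) (s.map (Term.eval σ)) := by
  have := hb _ (List.mem_append_right _ (List.mem_map_of_mem hs))
  rw [← Stmt.atomAssuming_map] at this
  exact atomAssuming_mem_soundAtoms.1 this

/-- Soundness of the whole program, rule by rule: saturation rules preserve truth in each model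
separately, so they also do so in the models that identify two given individuals. -/
theorem satGround_soundAtoms (O : Ontology Name) (Q : Query Name) :
    SatGround (fun _ _ _ => False) (soundAtoms D O Q)
      ((dlProgram O Q).ground (dlProgram O Q).constants) := by
  rintro g ⟨ρ, hρ, σ, -, rfl⟩ hb
  replace hb := mem_of_holdsBody_map hb
  rcases hρ with (hρ | ⟨α, hα, rfl⟩) | rfl
  · change ρ ∈ rqlRules Name at hρ
    simp only [rqlRules, List.mem_append, List.mem_map, List.mem_singleton] at hρ
    rcases hρ with (⟨ρ, hρ, rfl⟩ | (⟨ρ, hρ, rfl⟩ | ⟨s, hs, rfl⟩) | ⟨ρ, hρ, rfl⟩) | rfl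
    · change ρ.concl.atom.map _ ∈ _
      rw [← Stmt.atom_map, atom_mem_soundAtoms]
      intro I hI
      refine valid_of_mem_saturationRules hρ σ I fun s hs => ?_
      have := hb _ (List.mem_map_of_mem hs)
      rw [← Stmt.atom_map, atom_mem_soundAtoms] at this
      exact this I hI
    · change (ρ.concl.atomAssuming _ _).map _ ∈ _
      rw [← Stmt.atomAssuming_map, atomAssuming_mem_soundAtoms]
      exact ⟨soundAssuming_guard hb, fun I hI heq => valid_of_mem_saturationRules hρ σ I
        fun s hs => (soundAssuming_prems hb s hs).2 I hI heq⟩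
    · change (s.atomAssuming _ _).map _ ∈ _
      rw [← Stmt.atomAssuming_map, atomAssuming_mem_soundAtoms]
      have := hb s.atom (by simp)
      rw [← Stmt.atom_map, atom_mem_soundAtoms] at this
      exact ⟨soundAssuming_guard hb, fun I hI _ => this I hI⟩
    · change (ρ.concl.atomAssuming _ _).map _ ∈ _
      rw [← Stmt.atomAssuming_map, atomAssuming_mem_soundAtoms]
      refine ⟨soundAssuming_guard hb, fun I hI heq => ?_⟩
      have hp := fun s hs => (soundAssuming_prems hb s hs).2 I hI heq
      obtain ⟨s, -, hρ⟩ := List.mem_flatMap.1 hρ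
      obtain ⟨n, -, hρ⟩ := List.mem_flatMap.1 hρ
      -- The two sides of a congruence rule differ only in names with the same denotation in the
      -- models considered.
      have hden : ∀ t, I.toStruct.den (Term.eval σ (Term.subst n 10 t)) =
          I.toStruct.den (Term.eval σ (Term.subst n 11 t)) := by
        rintro (k | e)
        · by_cases hk : k = n
          · simpa [Term.subst, hk, Term.eval] using heq
          · simp [Term.subst, hk]
        · rfl
      simp only [List.mem_cons, List.not_mem_nil, or_false] at hρ
      rcases hρ with rfl | rfl
      · have := hp _ (List.mem_singleton_self _)
        rw [Stmt.map_map] at this ⊢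
        exact (I.toStruct.holds_map_congr hden s).1 this
      · have := hp _ (List.mem_singleton_self _)
        rw [Stmt.map_map] at this ⊢
        exact (I.toStruct.holds_map_congr hden s).2 this
    · change (Stmt.atom _).map _ ∈ _
      rw [← Stmt.atom_map, atom_mem_soundAtoms]
      have := hb _ (List.mem_singleton_self _)
      rw [← Stmt.atomAssuming_map, atomAssuming_mem_soundAtoms] at this
      -- A contradiction under the assumption means that no model identifies the two; the typing
      -- that an inequality also requires was carried along from the guard.
      exact fun I hI => ⟨this.1.1 I hI, this.1.2 I hI, fun heq => this.2 I hI heq⟩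
  · have hmap : (((Stmt.ax α).map Term.iri).atom).map (Term.eval σ) = (Stmt.ax α).atom := by
      rw [← Stmt.atom_map, Stmt.map_map]
      exact congrArg Stmt.atom (Stmt.map_id (.ax α))
    change (((Stmt.ax α).map Term.iri).atom).map (Term.eval σ) ∈ _
    rw [hmap, atom_mem_soundAtoms]
    exact fun I hI => (I.sat_iff α).1 (hI α hα)
  · refine ⟨σ, ?_, fun α hα => ?_⟩
    · simp [Rule.map, RegAtom.map, Term.eval, Function.comp_def]
    · have := hb (Stmt.ax α).atom (List.mem_map_of_mem (f := fun a => BodyAtom.reg a.tau) hα)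
      rw [← Stmt.atom_map, atom_mem_soundAtoms] at this
      exact sound_ax_iff.1 this

/-- Consistency enters here: a derived contradiction would hold in every model of the ontology, and
there is one. -/
theorem not_derived_clash (hO : Consistent D O) : ¬ Derived O Q .clash := fun h =>
  let ⟨I, hI⟩ := hO
  atom_mem_soundAtoms.1 (Program.minimalModel_subset (satGround_soundAtoms O Q) h) I hI

/-- The query atoms of the least model are the answers. -/
theorem query_mem_minimalModel_iff (hO : Consistent D O) {t : List (IRI Name)} :
    (⟨.query, t⟩ : RegAtom (IRI Name)) ∈ (dlProgram O Q).minimalModel ↔ t ∈ Q.answers D O := by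
  refine ⟨fun h => Program.minimalModel_subset (satGround_soundAtoms O Q) h, ?_⟩
  rintro ⟨μ, rfl, hμ⟩
  have hd : ∀ α ∈ Q.body, ((Stmt.ax α).map (Term.eval μ)).atom ∈ (dlProgram O Q).minimalModel :=
    fun α hα => derived_of_entails (not_derived_clash hO) (hμ α hα)
  have := mem_minimalModel_of_rule (O := O) (Q := Q)
    (ρ := ⟨⟨.query, Q.select.map Term.var⟩, Q.body.map fun a => .reg a.tau⟩)
    (Or.inr (Set.mem_singleton _)) μ
    (fun n hn => ?_) fun a ha => ?_
  · simpa [RegAtom.map, Term.eval, Function.comp_def] using this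
  · obtain ⟨m, hm, h⟩ := List.mem_map.1 hn
    cases h
    -- A selected variable occurs in the pattern, so its value occurs in a derived atom and is a
    -- constant of the program.
    obtain ⟨α, hα, hn⟩ := Q.safe n hm
    exact Program.args_mem_constants (hd α hα) (Stmt.mem_encode_iff.2
      (Stmt.mem_args_map (s := .ax α) hn))
  · obtain ⟨α, hα, h⟩ := List.mem_map.1 ha
    cases h
    have := hd α hα
    rwa [Stmt.atom_map] at this

theorem interfaceRules_empty_ontology (S : Set (IRI Name)) :
    interfaceRules (∅ : Ontology Name) S = ∅ := by
  simp [interfaceRules, Ontology.classes, Ontology.roles]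

theorem sig_subset_constants (O : Ontology Name) (Q : Query Name) :
    O.sig ⊆ (dlProgram O Q).constants := by
  rintro e ⟨α, hα, he⟩
  exact (derived_of_mem hα).argsIn e he

end OWLQL

/-! ### Answers of the hybrid knowledge base -/

theorem proposition1 {Name : Type u} (D : OWLQL.DatatypeMap.{v})
    (O : OWLQL.Ontology Name) (hO : OWLQL.Consistent D O) (Q : OWLQL.Query Name) :
    -- the answers under the entailment regime are the answers of the hybrid knowledge base,
    -- which has exactly one answer set
    (∃! I, I ∈ (OWLQL.hkbAll (OWLQL.hkbEAT O) Q).answerSets D) ∧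
    Q.answers D O = (OWLQL.hkbAll (OWLQL.hkbEAT O) Q).answers D ∧
    -- the hybrid knowledge base is a pure Datalog program with an empty ontology
    OWLQL.hkbAll (OWLQL.hkbEAT O) Q = ⟨∅, OWLQL.rql Name ∪ O.tau ∪ Q.tau⟩ ∧
    (∀ ρ ∈ OWLQL.rql Name ∪ O.tau ∪ Q.tau, ρ.Ordinary) ∧
    -- interface rules for the signature of `O` would have no effect either
    (OWLQL.HKB.mk ∅ (OWLQL.rql Name ∪ O.tau ∪ Q.tau ∪ OWLQL.interfaceRules O O.sig)).answerSets D =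
      (OWLQL.HKB.mk ∅ (OWLQL.rql Name ∪ O.tau ∪ Q.tau)).answerSets D ∧
    -- the unique answer set is the least model of the Datalog program
    (OWLQL.hkbAll (OWLQL.hkbEAT O) Q).answerSets D =
      {OWLQL.Program.minimalModel (OWLQL.rql Name ∪ O.tau ∪ Q.tau)} := by
  have hord := OWLQL.dlProgram_ordinary O Q
  have hK : OWLQL.hkbAll (OWLQL.hkbEAT O) Q = ⟨∅, OWLQL.rql Name ∪ O.tau ∪ Q.tau⟩ := by
    simp only [OWLQL.hkbAll, OWLQL.hkbEAT, OWLQL.interfaceRules_empty_ontology, Set.union_empty]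
  have hA := OWLQL.HKB.answerSets_of_ordinary D hord
  refine ⟨?_, ?_, hK, hord,
    OWLQL.HKB.answerSets_union_interfaceRules D O hord (OWLQL.sig_subset_constants O Q), ?_⟩
  · rw [hK, hA]
    exact ⟨_, rfl, fun _ h => h⟩
  · rw [hK]
    ext t
    simp only [OWLQL.HKB.answers, hA]
    rw [← OWLQL.query_mem_minimalModel_iff hO]
    constructor
    · exact fun h => ⟨_, rfl, h⟩
    · rintro ⟨I, hI, h⟩
      rwa [Set.singleton_eq_singleton_iff.1 hI]
  · rw [hK, hA]
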